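/- Let $k$ be a field, let $A$ and $B$ be $k$-algebras, let $M$ be a ($k$-central) $B$-$A$-bimodule, and let $T=\begin{pmatrix}A&0\\M&B\end{pmatrix}$ be the triangular matrix algebra, that is, the split algebra $(A\times B)\oplus M$ with $M^2=0$, where $(a,b)m=bm$ and $m(a,b)=ma$. Regard $M$ as a $T$-bimodule through the projections $T\to B$ (left) and $T\to A$ (right). Hochschild cohomology $H^n(\Lambda,X)$ is the cohomology of the complex $\mathrm{Hom}_k(\Lambda^{\otimes n},X)$ with the usual differential, and $\mathrm{Ext}_{B-A}$ is taken in the category of $B$-$A$-bimodules (left $B\otimes_k A^{op}$-modules). Let $1_M\in H^1(T,M)$ be the class of the projection $T\to M$. (a) There is a long exact sequence of $k$-vector spaces $$0\to H^0(T,T)\to H^0(A,A)\oplus H^0(B,B)\xrightarrow{\delta^0}\mathrm{Hom}_{B-A}(M,M)\to H^1(T,T)\to\cdots$$ $$\cdots\to \mathrm{Ext}^{n-1}_{B-A}(M,M)\to H^n(T,T)\to H^n(A,A)\oplus H^n(B,B)\xrightarrow{\delta^n}\mathrm{Ext}^n_{B-A}(M,M)\to\cdots .$$ The map out of $H^n(T,T)$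 is induced by restricting a cochain $T^{\otimes n}\to T$ to $A^{\otimes n}\to A$ and $B^{\otimes n}\to B$. There is a canonical isomorphism $\theta^n:\mathrm{Ext}^n_{B-A}(M,M)\cong H^{n+1}(T,M)$: if $P_\bullet\to M$ is a projective resolution of bimodules and $v_n\in\mathrm{Hom}_k(T^{\otimes(n+1)},P_n)$ are cochains such that $v_0$ lifts the projection $T\to M$ and $d v_n=\partial\circ v_{n+1}$ for all $n$ (such $v_n$ exist), then $\theta^n$ sends the class of a cocycle $h:P_n\to M$ to the class of $h\circ v_n$. The map $\mathrm{Ext}^{n}_{B-A}(M,M)\to H^{n+1}(T,T)$ is $\theta^n$ followed by the map induced by the inclusion $M\subset T$. (b) Under $\theta^n$, the connecting homomorphism is given by the cup product with $1_M$: $$\delta^n f=1_M\smile f\quad (f\in H^n(A,A)),\qquad \delta^n g=(-1)^{n+1}\,g\smile 1_M\quad (g\in H^n(B,B)),$$ where cochains of $A$ and of $B$ are extended to $T$ by zero on the other components. (c) If $B=k$ and $N$ is any right $A$-module, one recovers Happel's long exact sequence for the one-point extension $T=\begin{pmatrix}A&0\\N&k\end{pmatrix}$: $$0\to H^0(T,T)\to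 H^0(A,A)\oplus k\to \mathrm{End}_A(N)\to H^1(T,T)\to H^1(A,A)\to \mathrm{Ext}^1_A(N,N)\to H^2(T,T)\to H^2(A,A)\to\cdots$$ with the maps described as in (a) and (b), $\mathrm{Ext}_A$ being taken over right $A$-modules; the first connecting map sends $(z,c)$ to the endomorphism $x\mapsto xz-cx$. -/

import Mathlib

open scoped TensorProduct
open MulOpposite (op)

universe u

/-! ### Hochschild cohomology -/

namespace Hochschild

section Cochains

variable (k Λ X : Type*) [Field k] [Ring Λ] [Algebra k Λ] [AddCommGroup X] [Module k X]

/-- Hochschild `n`-cochains `Hom_k(Λ ⊗ ⋯ ⊗ Λ, X)`, as `k`-multilinear maps in `n` variables. -/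
abbrev Cochain (n : ℕ) : Type _ := MultilinearMap k (fun _ : Fin n => Λ) X

variable {k Λ X}

/-- A linear map viewed as a `1`-cochain. -/
def ofLinear (f : Λ →ₗ[k] X) : Cochain k Λ X 1 :=
  MultilinearMap.ofSubsingleton k Λ X (0 : Fin 1) f

theorem exists_contractNth_update {n : ℕ} (j : Fin n) (t : Fin (n + 1) → Λ) (i : Fin (n + 1)) :
    ∃ (i' : Fin n) (L : Λ →ₗ[k] Λ), ∀ x : Λ,
      Fin.contractNth j.castSucc (· * ·) (Function.update t i x) =
        Function.update (Fin.contractNth j.castSucc (· * ·) t) i' (L x) := by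
  rcases lt_trichotomy (i : ℕ) j with h | h | h
  · refine ⟨⟨i, by omega⟩, LinearMap.id, fun x => funext fun l => ?_⟩
    simp only [Fin.contractNth, Function.update_apply, Fin.ext_iff, Fin.val_castSucc,
      Fin.val_succ, LinearMap.id_apply]
    split_ifs <;> first | rfl | omega
  · refine ⟨j, LinearMap.mulRight k (t j.succ), fun x => funext fun l => ?_⟩
    simp only [Fin.contractNth, Function.update_apply, Fin.ext_iff, Fin.val_castSucc,
      Fin.val_succ, LinearMap.mulRight_apply]
    split_ifs with h1 h2 h3 h4 h5 h6 <;> first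
      | rfl
      | omega
      | (have : l = j := Fin.ext (by omega)
         subst this; rfl)
  · by_cases h' : (i : ℕ) = j + 1
    · refine ⟨j, LinearMap.mulLeft k (t j.castSucc), fun x => funext fun l => ?_⟩
      simp only [Fin.contractNth, Function.update_apply, Fin.ext_iff, Fin.val_castSucc,
        Fin.val_succ, LinearMap.mulLeft_apply]
      split_ifs with h1 h2 h3 h4 h5 h6 <;> first
        | rfl
        | omega
        | (have : l = j := Fin.ext (by omega)
           subst this; rfl)
    · refine ⟨⟨i - 1, by omega⟩, LinearMap.id, fun x => funext fun l => ?_⟩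
      simp only [Fin.contractNth, Function.update_apply, Fin.ext_iff, Fin.val_castSucc,
        Fin.val_succ, LinearMap.id_apply]
      split_ifs <;> first | rfl | omega

/-- `(x₁, …, xₙ₊₁) ↦ f (x₁, …, xⱼ xⱼ₊₁, …, xₙ₊₁)` (with `j` counted from `0` in `Fin n`). -/
def merge {n : ℕ} (f : Cochain k Λ X n) (j : Fin n) : Cochain k Λ X (n + 1) where
  toFun t := f (Fin.contractNth j.castSucc (· * ·) t)
  map_update_add' {inst} t i x y := by
    obtain rfl : inst = instDecidableEqFin _ := Subsingleton.elim _ _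
    obtain ⟨i', L, h⟩ := exists_contractNth_update (k := k) j t i
    simp only [h, map_add, f.map_update_add]
  map_update_smul' {inst} t i c x := by
    obtain rfl : inst = instDecidableEqFin _ := Subsingleton.elim _ _
    obtain ⟨i', L, h⟩ := exists_contractNth_update (k := k) j t i
    simp only [h, map_smul, f.map_update_smul]

end Cochains

section Bimodule

variable (k Λ X : Type*) [Field k] [Ring Λ] [Algebra k Λ] [AddCommGroup X] [Module k X]
  [Module Λ X] [Module Λᵐᵒᵖ X] [IsScalarTower k Λ X] [IsScalarTower k Λᵐᵒᵖ X]

/-- The left action `Λ × X → X` of a `Λ`-bimodule. -/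
def actL : Λ →ₗ[k] X →ₗ[k] X :=
  LinearMap.mk₂ k (fun l x => l • x) (fun _ _ _ => add_smul _ _ _)
    (fun c l x => smul_assoc c l x) (fun _ _ _ => smul_add _ _ _)
    (fun c l x => (smul_comm c l x).symm)

/-- The right action `X × Λ → X` of a `Λ`-bimodule. -/
def actR : X →ₗ[k] Λ →ₗ[k] X :=
  LinearMap.mk₂ k (fun x l => op l • x) (fun _ _ _ => smul_add _ _ _)
    (fun c x l => (smul_comm c (op l) x).symm)
    (fun x l l' => by rw [MulOpposite.op_add, add_smul])
    (fun c x l => by rw [MulOpposite.op_smul, smul_assoc])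

variable {k Λ X}

/-- `(x₁, …, xₙ₊₁) ↦ x₁ f (x₂, …, xₙ₊₁)`. -/
def firstTerm {n : ℕ} (f : Cochain k Λ X n) : Cochain k Λ X (n + 1) :=
  LinearMap.uncurryLeft
    { toFun := fun l => (actL k Λ X l).compMultilinearMap f
      map_add' := fun l l' => by ext t; simp
      map_smul' := fun c l => by ext t; simp }

/-- `(x₁, …, xₙ₊₁) ↦ f (x₁, …, xₙ) xₙ₊₁`. -/
def lastTerm {n : ℕ} (f : Cochain k Λ X n) : Cochain k Λ X (n + 1) :=
  MultilinearMap.uncurryRight ((actR k Λ X).compMultilinearMap f)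

variable (k Λ X)

/-- The Hochschild differential; see `d_apply` for the formula. -/
def d (n : ℕ) : Cochain k Λ X n →ₗ[k] Cochain k Λ X (n + 1) where
  toFun f := firstTerm f + (∑ j : Fin n, (-1 : k) ^ ((j : ℕ) + 1) • merge f j) +
    (-1 : k) ^ (n + 1) • lastTerm f
  map_add' f g := by
    ext t
    simp only [firstTerm, lastTerm, merge, add_apply, smul_apply, sum_apply, LinearMap.uncurryLeft_apply, MultilinearMap.uncurryRight_apply,
      LinearMap.coe_mk, AddHom.coe_mk, LinearMap.compMultilinearMap_apply, MultilinearMap.coe_mk,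
      map_add, smul_add, Finset.sum_add_distrib, LinearMap.add_apply]
    abel
  map_smul' c f := by
    ext t
    simp only [firstTerm, lastTerm, merge, add_apply, smul_apply, sum_apply, LinearMap.uncurryLeft_apply, MultilinearMap.uncurryRight_apply,
      LinearMap.coe_mk, AddHom.coe_mk, LinearMap.compMultilinearMap_apply, MultilinearMap.coe_mk,
      map_smul, smul_add, Finset.smul_sum, LinearMap.smul_apply, RingHom.id_apply]
    simp only [smul_comm c]

theorem d_apply (n : ℕ) (f : Cochain k Λ X n) (t : Fin (n + 1) → Λ) :
    d k Λ X n f t = t 0 • f (Fin.tail t) +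
      (∑ j : Fin n, (-1 : k) ^ ((j : ℕ) + 1) • f (Fin.contractNth j.castSucc (· * ·) t)) +
      (-1 : k) ^ (n + 1) • (op (t (Fin.last n)) • f (Fin.init t)) := by
  simp [d, firstTerm, lastTerm, merge, actL, actR]

/-- Hochschild cocycles. -/
def cocycles (n : ℕ) : Submodule k (Cochain k Λ X n) := LinearMap.ker (d k Λ X n)

/-- Hochschild coboundaries. -/
def coboundaries : ∀ n : ℕ, Submodule k (Cochain k Λ X n)
  | 0 => ⊥
  | n + 1 => LinearMap.range (d k Λ X n)

/-- Hochschild cohomology `H^n(Λ, X)`: cocycles modulo coboundaries. -/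
abbrev HH (n : ℕ) : Type _ :=
  cocycles k Λ X n ⧸ (coboundaries k Λ X n).submoduleOf (cocycles k Λ X n)

variable {k Λ X}

/-- The cochain `c` is a cocycle, and its cohomology class is `x`. -/
def Represents {n : ℕ} (c : Cochain k Λ X n) (x : HH k Λ X n) : Prop :=
  ∃ hc : c ∈ cocycles k Λ X n, Submodule.Quotient.mk ⟨c, hc⟩ = x

end Bimodule

section Cup

variable {k Λ X Y Z : Type*} [Field k] [Ring Λ] [Algebra k Λ] [AddCommGroup X] [Module k X]
  [AddCommGroup Y] [Module k Y] [AddCommGroup Z] [Module k Z]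

/-- The cup product `(f ⌣ g)(x₁, …, xₙ₊ₘ) = f(x₁, …, xₙ) · g(xₙ₊₁, …, xₙ₊ₘ)`, where the product of
the values is a bilinear map `μ : X × Y → Z`. -/
def cup (μ : X →ₗ[k] Y →ₗ[k] Z) {n m N : ℕ} (h : n + m = N) (f : Cochain k Λ X n)
    (g : Cochain k Λ Y m) : Cochain k Λ Z N :=
  (TensorProduct.lift μ).compMultilinearMap
    ((f.domCoprod g).domDomCongr (finSumFinEquiv.trans (finCongr h)))

end Cup

section Inflation

open CategoryTheory

variable {k Λ R : Type u} [Field k] [Ring Λ] [Algebra k Λ] [Ring R] [Algebra k R]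

/-- The `Λ`-bimodule obtained from an `R`-module by restriction of scalars along an algebra
homomorphism `α : Λ ⊗ Λᵒᵖ → R`: `l x = α(l ⊗ 1) x` and `x l = α(1 ⊗ l) x`. -/
def Restr (_α : Λ ⊗[k] Λᵐᵒᵖ →ₐ[k] R) (X : ModuleCat.{u} R) : Type u := X

variable (α : Λ ⊗[k] Λᵐᵒᵖ →ₐ[k] R) (X Y : ModuleCat.{u} R)

instance : AddCommGroup (Restr α X) := inferInstanceAs (AddCommGroup X)

instance : Module R (Restr α X) := inferInstanceAs (Module R X)

instance : Module k (Restr α X) := Module.compHom X (algebraMap k R)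

instance : Module Λ (Restr α X) :=
  Module.compHom X (α.comp (Algebra.TensorProduct.includeLeft : Λ →ₐ[k] Λ ⊗[k] Λᵐᵒᵖ)).toRingHom

instance : Module Λᵐᵒᵖ (Restr α X) :=
  Module.compHom X (α.comp (Algebra.TensorProduct.includeRight : Λᵐᵒᵖ →ₐ[k] Λ ⊗[k] Λᵐᵒᵖ)).toRingHom

theorem Restr.algebra_smul_def (c : k) (x : Restr α X) : c • x = algebraMap k R c • x := rfl

theorem Restr.left_smul_def (l : Λ) (x : Restr α X) : l • x = α (l ⊗ₜ 1) • x := rfl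

theorem Restr.right_smul_def (l : Λᵐᵒᵖ) (x : Restr α X) : l • x = α (1 ⊗ₜ l) • x := rfl

instance : IsScalarTower k Λ (Restr α X) where
  smul_assoc c l x := by
    rw [Restr.left_smul_def, Restr.left_smul_def, Restr.algebra_smul_def, ← mul_smul,
      ← Algebra.smul_def, ← map_smul, TensorProduct.smul_tmul']

instance : IsScalarTower k Λᵐᵒᵖ (Restr α X) where
  smul_assoc c l x := by
    rw [Restr.right_smul_def, Restr.right_smul_def, Restr.algebra_smul_def, ← mul_smul,
      ← Algebra.smul_def, ← map_smul, TensorProduct.tmul_smul]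

instance : SMulCommClass Λ Λᵐᵒᵖ (Restr α X) where
  smul_comm l l' x := by
    rw [Restr.left_smul_def, Restr.right_smul_def, Restr.right_smul_def, Restr.left_smul_def,
      ← mul_smul, ← mul_smul, ← map_mul, ← map_mul]
    simp

variable {X Y}

/-- A homomorphism of `R`-modules as a `k`-linear map between the restricted bimodules. -/
def Restr.map (h : X ⟶ Y) : Restr α X →ₗ[k] Restr α Y where
  toFun x := h.hom x
  map_add' x y := map_add h.hom x y
  map_smul' c x := map_smul h.hom (algebraMap k R c) x

/-- Let `P → X` be a projective resolution of the `R`-module `X` and let `u` be a Hochschild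
`1`-cochain of `Λ` with values in `X`. A lift of `u` to the resolution is a sequence of cochains
`v n ∈ C^{n+1}(Λ, Pₙ)` such that `v 0` lifts `u` through the augmentation `P₀ → X` and such that
the Hochschild differential of `v n` is the composition of `v (n + 1)` with `Pₙ₊₁ → Pₙ`. -/
structure IsLift (P : ProjectiveResolution X) (u : Cochain k Λ (Restr α X) 1)
    (v : ∀ n : ℕ, Cochain k Λ (Restr α (P.complex.X n)) (n + 1)) : Prop where
  augmentation : (Restr.map α (P.π.f 0)).compMultilinearMap (v 0) = u
  differential : ∀ n : ℕ, d k Λ (Restr α (P.complex.X n)) (n + 1) (v n) =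
    (Restr.map α (P.complex.d (n + 1) n)).compMultilinearMap (v (n + 1))

end Inflation

end Hochschild

/-! ### Triangular matrix algebras -/

/-- The set of matrices with rows `(a, 0)` and `(m, b)`, where `a ∈ A`, `b ∈ B`, `m ∈ M`. -/
@[ext]
structure Tri (A B M : Type*) where
  a : A
  m : M
  b : B

namespace Tri

section Module

variable {k A B M : Type*}

/-- The underlying triple of a triangular matrix. -/
def equivProd : Tri A B M ≃ A × M × B where
  toFun t := (t.a, t.m, t.b)
  invFun p := ⟨p.1, p.2.1, p.2.2⟩

variable [Ring A] [Ring B] [AddCommGroup M] [Field k] [Algebra k A] [Algebra k B] [Module k M]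

instance : AddCommGroup (Tri A B M) := equivProd.addCommGroup

instance : Module k (Tri A B M) := equivProd.module k

@[simp] theorem add_a (s t : Tri A B M) : (s + t).a = s.a + t.a := rfl
@[simp] theorem add_m (s t : Tri A B M) : (s + t).m = s.m + t.m := rfl
@[simp] theorem add_b (s t : Tri A B M) : (s + t).b = s.b + t.b := rfl
@[simp] theorem zero_a : (0 : Tri A B M).a = 0 := rfl
@[simp] theorem zero_m : (0 : Tri A B M).m = 0 := rfl
@[simp] theorem zero_b : (0 : Tri A B M).b = 0 := rfl
@[simp] theorem smul_a (c : k) (t : Tri A B M) : (c • t).a = c • t.a := rfl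
@[simp] theorem smul_m (c : k) (t : Tri A B M) : (c • t).m = c • t.m := rfl
@[simp] theorem smul_b (c : k) (t : Tri A B M) : (c • t).b = c • t.b := rfl

end Module

section Ring

variable {A B M : Type*} [Ring A] [Ring B] [AddCommGroup M] [Module B M] [Module Aᵐᵒᵖ M]

/-- Matrix multiplication. -/
instance : Mul (Tri A B M) where
  mul s t := ⟨s.a * t.a, op t.a • s.m + s.b • t.m, s.b * t.b⟩

instance : One (Tri A B M) where
  one := ⟨1, 0, 1⟩

@[simp] theorem mul_a (s t : Tri A B M) : (s * t).a = s.a * t.a := rfl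
@[simp] theorem mul_m (s t : Tri A B M) : (s * t).m = op t.a • s.m + s.b • t.m := rfl
@[simp] theorem mul_b (s t : Tri A B M) : (s * t).b = s.b * t.b := rfl
@[simp] theorem one_a : (1 : Tri A B M).a = 1 := rfl
@[simp] theorem one_m : (1 : Tri A B M).m = 0 := rfl
@[simp] theorem one_b : (1 : Tri A B M).b = 1 := rfl

variable [SMulCommClass B Aᵐᵒᵖ M]

instance : Ring (Tri A B M) where
  __ := (inferInstance : AddCommGroup (Tri A B M))
  left_distrib r s t := by ext <;> simp [mul_add, add_smul]; abel
  right_distrib r s t := by ext <;> simp [add_mul, add_smul]; abel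
  zero_mul t := by ext <;> simp
  mul_zero t := by ext <;> simp
  mul_assoc r s t := by
    ext <;> simp [mul_assoc, mul_smul, add_assoc, smul_comm r.b (op t.a) s.m]
  one_mul t := by ext <;> simp
  mul_one t := by ext <;> simp

end Ring

section Algebra

variable (k A B M : Type*) [Field k] [Ring A] [Algebra k A] [Ring B] [Algebra k B]
  [AddCommGroup M] [Module k M] [Module B M] [Module Aᵐᵒᵖ M] [SMulCommClass B Aᵐᵒᵖ M]
  [IsScalarTower k B M] [IsScalarTower k Aᵐᵒᵖ M]

instance : Algebra k (Tri A B M) :=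
  Algebra.ofModule
    (fun c s t => by
      ext <;> simp [smul_add, smul_comm c (op t.a) s.m])
    (fun c s t => by
      ext <;> simp [smul_add, smul_comm c s.b t.m])

/-- The projection `T → A`, with kernel `M ⊕ B`. -/
def projA : Tri A B M →ₐ[k] A :=
  AlgHom.ofLinearMap { toFun := Tri.a, map_add' := fun _ _ => rfl, map_smul' := fun _ _ => rfl }
    rfl (fun _ _ => rfl)

/-- The projection `T → B`, with kernel `A ⊕ M`. -/
def projB : Tri A B M →ₐ[k] B :=
  AlgHom.ofLinearMap { toFun := Tri.b, map_add' := fun _ _ => rfl, map_smul' := fun _ _ => rfl }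
    rfl (fun _ _ => rfl)

/-- The projection of vector spaces `T = A ⊕ M ⊕ B → M`. -/
def projM : Tri A B M →ₗ[k] M where
  toFun := Tri.m
  map_add' _ _ := rfl
  map_smul' _ _ := rfl

/-- The inclusion `A → T` (multiplicative, not unital). -/
def inclA : A →ₗ[k] Tri A B M where
  toFun a := ⟨a, 0, 0⟩
  map_add' _ _ := by ext <;> simp
  map_smul' _ _ := by ext <;> simp

/-- The inclusion `B → T` (multiplicative, not unital). -/
def inclB : B →ₗ[k] Tri A B M where
  toFun b := ⟨0, 0, b⟩
  map_add' _ _ := by ext <;> simp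
  map_smul' _ _ := by ext <;> simp

/-- The inclusion of the ideal `M` into `T`. -/
def inclM : M →ₗ[k] Tri A B M where
  toFun m := ⟨0, m, 0⟩
  map_add' _ _ := by ext <;> simp
  map_smul' _ _ := by ext <;> simp

open Hochschild

/-- The restriction of a cochain `F : T ⊗ ⋯ ⊗ T → T` to `A ⊗ ⋯ ⊗ A → A`. -/
def restrictA {n : ℕ} (F : Cochain k (Tri A B M) (Tri A B M) n) : Cochain k A A n :=
  (projA k A B M).toLinearMap.compMultilinearMap (F.compLinearMap fun _ => inclA k A B M)

/-- The restriction of a cochain `F : T ⊗ ⋯ ⊗ T → T` to `B ⊗ ⋯ ⊗ B → B`. -/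
def restrictB {n : ℕ} (F : Cochain k (Tri A B M) (Tri A B M) n) : Cochain k B B n :=
  (projB k A B M).toLinearMap.compMultilinearMap (F.compLinearMap fun _ => inclB k A B M)

/-- A cochain of `A` as a cochain of `T` with values in `A ⊆ T`, zero on the tensors that have a
factor in `M` or in `B`. -/
def extendA {n : ℕ} (f : Cochain k A A n) : Cochain k (Tri A B M) (Tri A B M) n :=
  (inclA k A B M).compMultilinearMap (f.compLinearMap fun _ => (projA k A B M).toLinearMap)

/-- A cochain of `B` as a cochain of `T` with values in `B ⊆ T`, zero on the tensors that have a
factor in `A` or in `M`. -/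
def extendB {n : ℕ} (g : Cochain k B B n) : Cochain k (Tri A B M) (Tri A B M) n :=
  (inclB k A B M).compMultilinearMap (g.compLinearMap fun _ => (projB k A B M).toLinearMap)

end Algebra

section Bimodule

variable (k A B M : Type u) [Field k] [Ring A] [Algebra k A] [Ring B] [Algebra k B]
  [AddCommGroup M] [Module k M] [Module B M] [Module Aᵐᵒᵖ M] [SMulCommClass B Aᵐᵒᵖ M]
  [IsScalarTower k B M] [IsScalarTower k Aᵐᵒᵖ M]

open Hochschild

/-- The `B`-`A`-bimodule `M` as an object of the category of `B`-`A`-bimodules, that is, of left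
modules over `B ⊗ Aᵒᵖ`, with `(b ⊗ a) m = b m a`. -/
abbrev bimod : ModuleCat.{u} (B ⊗[k] Aᵐᵒᵖ) :=
  letI : Module (B ⊗[k] Aᵐᵒᵖ) M := TensorProduct.Algebra.module
  ModuleCat.of (B ⊗[k] Aᵐᵒᵖ) M

/-- The homomorphism `T ⊗ Tᵒᵖ → B ⊗ Aᵒᵖ` given by the projections. Restriction of scalars along it
turns a `B`-`A`-bimodule into a `T`-bimodule, on which `T` acts on the left through `B` and on the
right through `A`. -/
def toBA : Tri A B M ⊗[k] (Tri A B M)ᵐᵒᵖ →ₐ[k] B ⊗[k] Aᵐᵒᵖ :=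
  Algebra.TensorProduct.map (projB k A B M) (AlgHom.op (projA k A B M))

/-- `M` as a `T`-bimodule. -/
abbrev MBimod : Type u := Restr (toBA k A B M) (bimod k A B M)

/-- The identity, from `M` to `M` regarded as a `T`-bimodule. -/
def equivMBimod : M ≃ₗ[k] MBimod k A B M where
  toFun m := m
  invFun m := m
  map_add' _ _ := rfl
  map_smul' c m := by
    change c • m = TensorProduct.Algebra.moduleAux (algebraMap k (B ⊗[k] Aᵐᵒᵖ) c) m
    rw [Algebra.TensorProduct.algebraMap_apply, TensorProduct.Algebra.moduleAux_apply, one_smul,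
      algebraMap_smul]

/-- The `1`-cocycle `1_M`: the projection `T → M`. -/
def oneM : Cochain k (Tri A B M) (MBimod k A B M) 1 :=
  ofLinear ((equivMBimod k A B M).toLinearMap ∘ₗ projM k A B M)

/-- The inclusion `M → T` of `T`-bimodules. -/
def inclMBimod : MBimod k A B M →ₗ[k] Tri A B M :=
  inclM k A B M ∘ₗ (equivMBimod k A B M).symm.toLinearMap

end Bimodule

section OnePoint

variable (k A N : Type u) [Field k] [Ring A] [Algebra k A]
  [AddCommGroup N] [Module k N] [Module Aᵐᵒᵖ N] [IsScalarTower k Aᵐᵒᵖ N]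

open Hochschild

/-- For `T` the one-point extension of `A` by the right `A`-module `N` (the case `B = k`), the
homomorphism `T ⊗ Tᵒᵖ → Aᵒᵖ`, `s ⊗ t ↦ s.b t.a`. Restriction of scalars along it turns a right
`A`-module into a `T`-bimodule. -/
def toRight : Tri A k N ⊗[k] (Tri A k N)ᵐᵒᵖ →ₐ[k] Aᵐᵒᵖ :=
  Algebra.TensorProduct.lift ((Algebra.ofId k Aᵐᵒᵖ).comp (projB k A k N))
    (AlgHom.op (projA k A k N)) (fun s _ => Algebra.commutes (projB k A k N s) _)

/-- The right `A`-module `N` as a `T`-bimodule. -/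
abbrev NBimod : Type u := Restr (toRight k A N) (ModuleCat.of Aᵐᵒᵖ N)

/-- The identity, from `N` to `N` regarded as a `T`-bimodule. -/
def equivNBimod : N ≃ₗ[k] NBimod k A N where
  toFun x := x
  invFun x := x
  map_add' _ _ := rfl
  map_smul' c x := (algebraMap_smul Aᵐᵒᵖ c x).symm

/-- The `1`-cocycle `1_N`: the projection `T → N`. -/
def oneN : Cochain k (Tri A k N) (NBimod k A N) 1 :=
  ofLinear ((equivNBimod k A N).toLinearMap ∘ₗ projM k A k N)

/-- The inclusion `N → T` of `T`-bimodules. -/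
def inclNBimod : NBimod k A N →ₗ[k] Tri A k N :=
  inclM k A k N ∘ₗ (equivNBimod k A N).symm.toLinearMap

/-- The `1`-cochain `t ↦ φ(t.m) ∈ N ⊆ T` of `T`, for an endomorphism `φ` of the right `A`-module
`N`. -/
def extendEnd (φ : Module.End Aᵐᵒᵖ N) : Cochain k (Tri A k N) (Tri A k N) 1 :=
  ofLinear (inclM k A k N ∘ₗ φ.restrictScalars k ∘ₗ projM k A k N)

end OnePoint

end Tri

/-! The sequence `0 → M → T → A × B → 0` of `T`-bimodules induces a short exact sequence of
Hochschild complexes of `T`. Its long exact sequence becomes the required one after two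
identifications.

The first is `H^n(T, A) ≅ H^n(A, A)` and `H^n(T, B) ≅ H^n(B, B)`, by restriction. The idempotent `e
= (1, 0, 0)` satisfies `eT = eTe = A`, and `T` acts on the left of `A` through `eT`. Dually `f = (0,
0, 1)` satisfies `Tf = fTf = B`. By `mem_boundaries_of_idempotent_left` and its mirror image, a
cocycle that vanishes on the corner is a coboundary. Hence (`exists_eq_extend_add`) a cochain whose
differential has values in `M` is the extension by zero of its two restrictions, up to a coboundary
and an `M`-valued cochain. The connecting map is then read off from `d_extend`: `A` is not a left
ideal of `T` and `B` is not a right ideal, so extension by zero commutes with the differential only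
up to the cup products with `1_M`.

The second is `Ext^n(M, X) ≅ H^{n+1}(T, X)` for every `B`-`A`-bimodule `X`. Composition with `1_M`
identifies `Hom(M, X)` with `H^1(T, X)`. Moreover `X` embeds in a coinduced bimodule, whose
cohomology vanishes from degree two on (`exists_differential_eq_coind`). So `X ↦ H^{n+1}(T, X)` is
effaceable for `n > 0` and agrees with `Hom(M, X)` for `n = 0`, like `Ext^n(M, X)`. The comparison
is carried out by dimension shifting on explicit cochains `v n`: `IsUniversal.exists_eq` gives
surjectivity and `IsUniversal.exists_comp_eq` injectivity.

The one-point extension is handled by the same lemmas, with `Aᵐᵒᵖ` in place of `k ⊗ Aᵐᵒᵖ`. The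
summand of `B = k` is `k` in degree zero and disappears in positive degrees. -/

set_option linter.unusedSectionVars false

/-! ### The Hochschild differential for arbitrary pairs of actions. -/

namespace Hochschild

section Differential

variable {k Λ Γ X Y : Type u} [Field k] [Ring Λ] [Algebra k Λ] [Ring Γ] [Algebra k Γ]
  [AddCommGroup X] [Module k X] [AddCommGroup Y] [Module k Y]

/-- The Hochschild differential with respect to arbitrary bilinear maps `l : Λ × X → X` and
`r : X × Λ → X` in place of the two actions of a bimodule. -/
def differential (l : Λ →ₗ[k] X →ₗ[k] X) (r : X →ₗ[k] Λ →ₗ[k] X) (n : ℕ) :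
    Cochain k Λ X n →ₗ[k] Cochain k Λ X (n + 1) where
  toFun f := LinearMap.uncurryLeft
      { toFun := fun x => (l x).compMultilinearMap f
        map_add' := fun x y => by ext t; simp
        map_smul' := fun c x => by ext t; simp } +
    (∑ j : Fin n, (-1 : k) ^ ((j : ℕ) + 1) • merge f j) +
    (-1 : k) ^ (n + 1) • MultilinearMap.uncurryRight (r.compMultilinearMap f)
  map_add' f g := by
    ext t
    simp only [merge, add_apply, smul_apply, sum_apply,
      LinearMap.uncurryLeft_apply, MultilinearMap.uncurryRight_apply,
      LinearMap.coe_mk, AddHom.coe_mk, LinearMap.compMultilinearMap_apply, MultilinearMap.coe_mk,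
      map_add, smul_add, Finset.sum_add_distrib, LinearMap.add_apply]
    abel
  map_smul' c f := by
    ext t
    simp only [merge, add_apply, smul_apply, sum_apply,
      LinearMap.uncurryLeft_apply, MultilinearMap.uncurryRight_apply,
      LinearMap.coe_mk, AddHom.coe_mk, LinearMap.compMultilinearMap_apply, MultilinearMap.coe_mk,
      map_smul, smul_add, Finset.smul_sum, LinearMap.smul_apply, RingHom.id_apply]
    simp only [smul_comm c]

theorem differential_apply (l : Λ →ₗ[k] X →ₗ[k] X) (r : X →ₗ[k] Λ →ₗ[k] X) (n : ℕ)
    (f : Cochain k Λ X n) (t : Fin (n + 1) → Λ) :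
    differential l r n f t = l (t 0) (f (Fin.tail t)) +
      (∑ j : Fin n, (-1 : k) ^ ((j : ℕ) + 1) • f (Fin.contractNth j.castSucc (· * ·) t)) +
      (-1 : k) ^ (n + 1) • r (f (Fin.init t)) (t (Fin.last n)) := by
  simp [differential, merge]

theorem d_eq_differential [Module Λ X] [Module Λᵐᵒᵖ X] [IsScalarTower k Λ X]
    [IsScalarTower k Λᵐᵒᵖ X] (n : ℕ) :
    d k Λ X n = differential (actL k Λ X) (actR k Λ X) n := rfl

/-- The two actions of a possibly non-unital bimodule. -/
structure IsBimod (l : Λ →ₗ[k] X →ₗ[k] X) (r : X →ₗ[k] Λ →ₗ[k] X) : Prop where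
  mul_left : ∀ x y v, l (x * y) v = l x (l y v)
  mul_right : ∀ v x y, r v (x * y) = r (r v x) y
  comm : ∀ x v y, r (l x v) y = l x (r v y)

/-- Currying a cochain with respect to the first variable. -/
def curryFirst {n : ℕ} (f : Cochain k Λ X (n + 1)) : Cochain k Λ (Λ →ₗ[k] X) n where
  toFun t :=
    { toFun := fun x => f (Fin.cons x t)
      map_add' := fun x y => f.cons_add t x y
      map_smul' := fun c x => f.cons_smul t c x }
  map_update_add' {inst} t i x y := by
    obtain rfl : inst = instDecidableEqFin _ := Subsingleton.elim _ _
    ext z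
    simp [Fin.cons_update]
  map_update_smul' {inst} t i c x := by
    obtain rfl : inst = instDecidableEqFin _ := Subsingleton.elim _ _
    ext z
    simp [Fin.cons_update]

@[simp] theorem curryFirst_apply {n : ℕ} (f : Cochain k Λ X (n + 1)) (t : Fin n → Λ) (x : Λ) :
    curryFirst f t x = f (Fin.cons x t) := rfl

/-- Left action on `Hom_k(Λ, X)` through right multiplication of `Λ`. -/
def homL : Λ →ₗ[k] (Λ →ₗ[k] X) →ₗ[k] (Λ →ₗ[k] X) :=
  LinearMap.mk₂ k (fun y φ => φ ∘ₗ LinearMap.mulRight k y)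
    (fun y z φ => by ext; simp [mul_add]) (fun c y φ => by ext; simp)
    (fun y φ χ => by ext; simp) (fun c y φ => by ext; simp)

/-- Right action on `Hom_k(Λ, X)` through left multiplication of `Λ`. -/
def homR : (Λ →ₗ[k] X) →ₗ[k] Λ →ₗ[k] (Λ →ₗ[k] X) :=
  LinearMap.mk₂ k (fun φ y => φ ∘ₗ LinearMap.mulLeft k y)
    (fun φ χ y => by ext; simp) (fun c φ y => by ext; simp)
    (fun φ y z => by ext; simp [add_mul]) (fun c φ y => by ext; simp)

/-- Left action on `Hom_k(Γ, X)` through `X`. -/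
def postL (l : Λ →ₗ[k] X →ₗ[k] X) : Λ →ₗ[k] (Γ →ₗ[k] X) →ₗ[k] (Γ →ₗ[k] X) :=
  LinearMap.mk₂ k (fun y φ => l y ∘ₗ φ)
    (fun y z φ => by ext; simp) (fun c y φ => by ext; simp)
    (fun y φ χ => by ext; simp) (fun c y φ => by ext; simp)

/-- Right action on `Hom_k(Γ, X)` through `X`. -/
def postR (r : X →ₗ[k] Λ →ₗ[k] X) : (Γ →ₗ[k] X) →ₗ[k] Λ →ₗ[k] (Γ →ₗ[k] X) :=
  LinearMap.mk₂ k (fun φ y => r.flip y ∘ₗ φ)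
    (fun φ χ y => by ext; simp) (fun c φ y => by ext; simp)
    (fun φ y z => by ext; simp) (fun c φ y => by ext; simp)

@[simp] theorem homL_apply (y : Λ) (φ : Λ →ₗ[k] X) (x : Λ) : homL y φ x = φ (x * y) := rfl
@[simp] theorem homR_apply (φ : Λ →ₗ[k] X) (y x : Λ) : homR φ y x = φ (y * x) := rfl
@[simp] theorem postL_apply (l : Λ →ₗ[k] X →ₗ[k] X) (y : Λ) (φ : Γ →ₗ[k] X) (x : Γ) :
    postL l y φ x = l y (φ x) := rfl
@[simp] theorem postR_apply (r : X →ₗ[k] Λ →ₗ[k] X) (φ : Γ →ₗ[k] X) (y : Λ) (x : Γ) :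
    postR r φ y x = r (φ x) y := rfl

theorem contractNth_cons_zero {n : ℕ} (x : Λ) (t : Fin (n + 1) → Λ) :
    Fin.contractNth (Fin.castSucc (0 : Fin (n + 1))) (· * ·) (Fin.cons x t : Fin (n + 2) → Λ) =
      Fin.cons (x * t 0) (Fin.tail t) := by
  ext i
  refine Fin.cases ?_ (fun i => ?_) i
  · simp [Fin.contractNth]
  · simp [Fin.contractNth, Fin.tail]

theorem contractNth_cons_succ {n : ℕ} (x : Λ) (t : Fin (n + 1) → Λ) (j : Fin n) :
    Fin.contractNth (Fin.castSucc j.succ) (· * ·) (Fin.cons x t : Fin (n + 2) → Λ) =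
      Fin.cons x (Fin.contractNth j.castSucc (· * ·) t) := by
  ext i
  refine Fin.cases ?_ (fun i => ?_) i
  · simp [Fin.contractNth]
  · simp [Fin.contractNth]

theorem contractNth_snoc_last {n : ℕ} (x : Λ) (t : Fin (n + 1) → Λ) :
    Fin.contractNth (Fin.castSucc (Fin.last n)) (· * ·) (Fin.snoc t x : Fin (n + 2) → Λ) =
      Fin.snoc (Fin.init t) (t (Fin.last n) * x) := by
  ext i
  refine Fin.lastCases ?_ (fun i => ?_) i
  · have h : (Fin.castSucc (Fin.last n)) = (Fin.last n).castSucc := rfl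
    simp only [Fin.contractNth, Fin.val_castSucc, lt_irrefl, if_false, if_true, Fin.snoc_last,
      Fin.snoc_castSucc, Fin.succ_last]
  · simp only [Fin.contractNth, Fin.val_castSucc, Fin.val_last, i.isLt, if_true, Fin.snoc_castSucc,
      Fin.init]

theorem contractNth_snoc_castSucc {n : ℕ} (x : Λ) (t : Fin (n + 1) → Λ) (j : Fin n) :
    Fin.contractNth (Fin.castSucc j.castSucc) (· * ·) (Fin.snoc t x : Fin (n + 2) → Λ) =
      Fin.snoc (Fin.contractNth j.castSucc (· * ·) t) x := by
  ext i
  refine Fin.lastCases ?_ (fun i => ?_) i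
  · have h1 : ¬ (n < (j : ℕ)) := by omega
    have h2 : ¬ (n = (j : ℕ)) := by omega
    simp only [Fin.contractNth, Fin.val_castSucc, Fin.val_last, h1, h2, if_false, Fin.snoc_last,
      Fin.succ_last]
  · simp only [Fin.contractNth, Fin.val_castSucc, Fin.snoc_castSucc, ← Fin.castSucc_succ]

theorem init_cons {n : ℕ} (x : Λ) (t : Fin (n + 1) → Λ) :
    Fin.init (Fin.cons x t : Fin (n + 2) → Λ) = Fin.cons x (Fin.init t) := by
  ext i
  refine Fin.cases ?_ (fun i => ?_) i
  · simp [Fin.init]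
  · simp [Fin.init]

theorem tail_snoc {n : ℕ} (x : Λ) (t : Fin (n + 1) → Λ) :
    Fin.tail (Fin.snoc t x : Fin (n + 2) → Λ) = Fin.snoc (Fin.tail t) x := by
  ext i
  refine Fin.lastCases ?_ (fun i => ?_) i
  · simp [Fin.tail]
  · simp only [Fin.tail, Fin.succ_castSucc, Fin.snoc_castSucc]

variable (l : Λ →ₗ[k] X →ₗ[k] X) (r : X →ₗ[k] Λ →ₗ[k] X)

theorem differential_zero_apply (f : Cochain k Λ X 0) (t : Fin 1 → Λ) :
    differential l r 0 f t = l (t 0) (f Fin.elim0) - r (f Fin.elim0) (t 0) := by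
  have h1 : Fin.tail t = Fin.elim0 := Subsingleton.elim _ _
  have h2 : Fin.init t = Fin.elim0 := Subsingleton.elim _ _
  rw [differential_apply, h1, h2]
  simp [sub_eq_add_neg]

/-- Separating the first variable trades a cochain with values in `X` for one of lower degree with
values in `Hom_k(Λ, X)`. Every induction on the degree below rests on this or on its mirror image
`differential_snoc`. -/
theorem differential_cons {n : ℕ} (f : Cochain k Λ X (n + 1)) (x : Λ) (t : Fin (n + 1) → Λ) :
    differential l r (n + 1) f (Fin.cons x t) =
      l x (f t) - differential homL (postR r) n (curryFirst f) t x := by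
  have hl : (Fin.cons x t : Fin (n + 2) → Λ) (Fin.last (n + 1)) = t (Fin.last n) := by
    rw [← Fin.succ_last, Fin.cons_succ]
  rw [differential_apply, differential_apply, Fin.sum_univ_succ, init_cons, hl,
    contractNth_cons_zero]
  simp only [contractNth_cons_succ, Fin.tail_cons, Fin.cons_zero, LinearMap.add_apply,
    LinearMap.sum_apply, LinearMap.smul_apply, LinearMap.neg_apply, homL_apply, postR_apply, curryFirst_apply,
    Fin.val_succ, pow_succ, mul_neg, mul_one, neg_smul, neg_neg, Finset.sum_neg_distrib,
    Fin.val_zero, pow_zero, one_smul]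
  abel

theorem differential_snoc {n : ℕ} (f : Cochain k Λ X (n + 1)) (x : Λ) (t : Fin (n + 1) → Λ) :
    differential l r (n + 1) f (Fin.snoc t x) =
      differential (postL l) homR n f.curryRight t x + (-1 : k) ^ n • r (f t) x := by
  have h0 : (Fin.snoc t x : Fin (n + 2) → Λ) 0 = t 0 := by
    rw [← Fin.castSucc_zero, Fin.snoc_castSucc]
  rw [differential_apply, differential_apply, Fin.sum_univ_castSucc, tail_snoc, h0,
    contractNth_snoc_last]
  simp only [contractNth_snoc_castSucc, Fin.init_snoc, Fin.snoc_last, LinearMap.add_apply,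
    LinearMap.sum_apply, LinearMap.smul_apply, LinearMap.neg_apply, homR_apply, postL_apply,
    MultilinearMap.curryRight_apply,
    Fin.val_castSucc, Fin.val_last, pow_succ, mul_neg, mul_one, neg_smul, neg_neg]
  abel

variable {l r}

/-- The inner terms of the differential commute with any linear map of coefficients. Only the two
outer terms produce a defect, and it is kept explicit because the homotopies below use maps that are
not bimodule maps. -/
theorem differential_comp_apply {l' : Λ →ₗ[k] Y →ₗ[k] Y} {r' : Y →ₗ[k] Λ →ₗ[k] Y} (φ : X →ₗ[k] Y)
    {n : ℕ} (f : Cochain k Λ X n) (t : Fin (n + 1) → Λ) :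
    differential l' r' n (φ.compMultilinearMap f) t = φ (differential l r n f t) +
      (l' (t 0) (φ (f (Fin.tail t))) - φ (l (t 0) (f (Fin.tail t)))) +
      (-1 : k) ^ (n + 1) • (r' (φ (f (Fin.init t))) (t (Fin.last n)) -
        φ (r (f (Fin.init t)) (t (Fin.last n)))) := by
  rw [differential_apply, differential_apply]
  simp only [LinearMap.compMultilinearMap_apply, map_add, map_sum, map_smul, smul_sub]
  abel

theorem differential_comp {l' : Λ →ₗ[k] Y →ₗ[k] Y} {r' : Y →ₗ[k] Λ →ₗ[k] Y} (φ : X →ₗ[k] Y)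
    (hl : ∀ x v, l' x (φ v) = φ (l x v)) (hr : ∀ v x, r' (φ v) x = φ (r v x))
    {n : ℕ} (f : Cochain k Λ X n) :
    differential l' r' n (φ.compMultilinearMap f) =
      φ.compMultilinearMap (differential l r n f) := by
  ext t
  rw [differential_comp_apply (l := l) (r := r)]
  simp [hl, hr]

/-- No unit is required of `ψ`, so this covers the corner inclusions `A → T` and `B → T` as well as
the projections. -/
theorem differential_compLinearMap {l' : Γ →ₗ[k] X →ₗ[k] X} {r' : X →ₗ[k] Γ →ₗ[k] X}
    (ψ : Γ →ₗ[k] Λ) (hψ : ∀ x y, ψ (x * y) = ψ x * ψ y) (hl : ∀ x, l' x = l (ψ x))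
    (hr : ∀ v x, r' v x = r v (ψ x)) {n : ℕ} (f : Cochain k Λ X n) :
    differential l' r' n (f.compLinearMap fun _ => ψ) =
      (differential l r n f).compLinearMap fun _ => ψ := by
  ext t
  rw [MultilinearMap.compLinearMap_apply, differential_apply, differential_apply]
  simp only [MultilinearMap.compLinearMap_apply, hl, hr]
  congr 1
  congr 1
  refine Finset.sum_congr rfl fun j _ => ?_
  congr 2
  ext i
  simp only [Fin.contractNth]
  split_ifs <;> simp [hψ]

/-- Induction on the degree by currying. The coefficients are quantified inside the induction
because the step applies the hypothesis to `Hom_k(Λ, X)`. -/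
theorem differential_differential {n : ℕ} : ∀ {X : Type u} [AddCommGroup X] [Module k X]
    {l : Λ →ₗ[k] X →ₗ[k] X} {r : X →ₗ[k] Λ →ₗ[k] X} (_ : IsBimod l r) (f : Cochain k Λ X n),
    differential l r (n + 1) (differential l r n f) = 0 := by
  induction n with
  | zero =>
    intro X _ _ l r h f
    ext t
    obtain ⟨x, t, rfl⟩ : ∃ x s, t = Fin.cons x s := ⟨_, _, (Fin.cons_self_tail t).symm⟩
    rw [differential_cons, differential_zero_apply, differential_zero_apply]
    simp only [LinearMap.sub_apply, homL_apply, postR_apply, curryFirst_apply,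
      differential_zero_apply, Fin.cons_zero]
    simp [h.mul_left, h.mul_right, h.comm]
  | succ n ih =>
    intro X _ _ l r h f
    have h' : IsBimod (homL : Λ →ₗ[k] (Λ →ₗ[k] X) →ₗ[k] (Λ →ₗ[k] X)) (postR r) :=
      ⟨fun x y v => by ext; simp [mul_assoc], fun v x y => by ext; simp [h.mul_right],
        fun x v y => by ext; simp⟩
    have hc : curryFirst (differential l r (n + 1) f) = (l.flip).compMultilinearMap f -
        differential homL (postR r) n (curryFirst f) := by
      ext t x
      simp [differential_cons]
    ext t
    obtain ⟨x, t, rfl⟩ : ∃ x s, t = Fin.cons x s := ⟨_, _, (Fin.cons_self_tail t).symm⟩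
    rw [differential_cons, hc, map_sub, ih h', differential_comp (l := l) (r := r) l.flip
      (fun x v => by ext; simp [h.mul_left]) (fun v x => by ext; simp [h.comm])]
    simp

end Differential

section Lift

variable {k Λ X Y Z : Type u} [Field k] [Ring Λ] [Algebra k Λ]
  [AddCommGroup X] [Module k X] [AddCommGroup Y] [Module k Y] [AddCommGroup Z] [Module k Z]

/-- Over a field, `φ` has a linear section over its image. This is what makes the cochain functors
exact in the coefficients. -/
theorem exists_compMultilinearMap_eq {n : ℕ} (φ : X →ₗ[k] Y) (f : Cochain k Λ Y n)
    (hf : ∀ t, f t ∈ LinearMap.range φ) : ∃ g : Cochain k Λ X n, φ.compMultilinearMap g = f := by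
  obtain ⟨s, hs⟩ := φ.rangeRestrict.exists_rightInverse_of_surjective φ.range_rangeRestrict
  refine ⟨s.compMultilinearMap (f.codRestrict _ hf), ?_⟩
  ext t
  have := LinearMap.congr_fun hs (⟨f t, hf t⟩ : LinearMap.range φ)
  exact congrArg Subtype.val this

end Lift

end Hochschild

/-! ### Partial evaluation and reduction to a corner of the algebra. -/

namespace Hochschild

section Boundaries

variable {k Λ X : Type u} [Field k] [Ring Λ] [Algebra k Λ] [AddCommGroup X] [Module k X]

/-- The image of the generalized differential in degree `n`. -/
def boundaries (l : Λ →ₗ[k] X →ₗ[k] X) (r : X →ₗ[k] Λ →ₗ[k] X) :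
    ∀ n : ℕ, Submodule k (Cochain k Λ X n)
  | 0 => ⊥
  | n + 1 => LinearMap.range (differential l r n)

/-- The inverse of `curryFirst`. -/
def uncurryFirst {n : ℕ} (f : Cochain k Λ (Λ →ₗ[k] X) n) : Cochain k Λ X (n + 1) :=
  LinearMap.uncurryLeft
    { toFun := fun x => (LinearMap.applyₗ x).compMultilinearMap f
      map_add' := fun x y => by ext t; simp
      map_smul' := fun c x => by ext t; simp }

@[simp] theorem uncurryFirst_apply {n : ℕ} (f : Cochain k Λ (Λ →ₗ[k] X) n) (t : Fin (n + 1) → Λ) :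
    uncurryFirst f t = f (Fin.tail t) (t 0) := rfl

@[simp] theorem curryFirst_uncurryFirst {n : ℕ} (f : Cochain k Λ (Λ →ₗ[k] X) n) :
    curryFirst (uncurryFirst f) = f := by
  ext t x
  simp

/-- Evaluation of the first variable of a cochain. -/
def evalFirst {n : ℕ} (a : Λ) (f : Cochain k Λ X (n + 1)) : Cochain k Λ X n :=
  (LinearMap.applyₗ a).compMultilinearMap (curryFirst f)

@[simp] theorem evalFirst_apply {n : ℕ} (a : Λ) (f : Cochain k Λ X (n + 1)) (t : Fin n → Λ) :
    evalFirst a f t = f (Fin.cons a t) := rfl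

/-- Evaluation of the last variable of a cochain. -/
def evalLast {n : ℕ} (a : Λ) (f : Cochain k Λ X (n + 1)) : Cochain k Λ X n :=
  (LinearMap.applyₗ a).compMultilinearMap f.curryRight

@[simp] theorem evalLast_apply {n : ℕ} (a : Λ) (f : Cochain k Λ X (n + 1)) (t : Fin n → Λ) :
    evalLast a f t = f (Fin.snoc t a) := rfl

/-- If `a` fixes the values of a cocycle `f`, then `f(a, …)` is a primitive of `f` up to the last
bracket, which compares `x f(a, …)` with `f(a x, …)`. -/
theorem differential_evalFirst (l : Λ →ₗ[k] X →ₗ[k] X) (r : X →ₗ[k] Λ →ₗ[k] X) {n : ℕ} (a : Λ)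
    (f : Cochain k Λ X (n + 1)) (t : Fin (n + 1) → Λ) :
    differential l r n (evalFirst a f) t = l a (f t) - differential l r (n + 1) f (Fin.cons a t) +
      (l (t 0) (f (Fin.cons a (Fin.tail t))) - f (Fin.cons (a * t 0) (Fin.tail t))) := by
  rw [evalFirst, differential_comp_apply (l := homL) (r := postR r), differential_cons]
  simp

theorem differential_evalLast (l : Λ →ₗ[k] X →ₗ[k] X) (r : X →ₗ[k] Λ →ₗ[k] X) {n : ℕ} (a : Λ)
    (f : Cochain k Λ X (n + 1)) (t : Fin (n + 1) → Λ) :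
    differential l r n (evalLast a f) t = differential l r (n + 1) f (Fin.snoc t a) +
      (-1 : k) ^ (n + 1) • (r (f t) a +
      (r (f (Fin.snoc (Fin.init t) a)) (t (Fin.last n)) -
        f (Fin.snoc (Fin.init t) (t (Fin.last n) * a)))) := by
  rw [evalLast, differential_comp_apply (l := postL l) (r := homR), differential_snoc]
  simp [pow_succ, add_assoc]

end Boundaries

section Idempotent

variable {k Λ : Type u} [Field k] [Ring Λ] [Algebra k Λ]

/-- Let `e` be an idempotent such that `e Λ = e Λ e`, and let `X` be a bimodule on which `Λ` acts
on the left through `e Λ`. Then a cocycle with values in `X` that vanishes on `e Λ` is a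
coboundary. -/
theorem mem_boundaries_of_idempotent_left (e : Λ) (he : e * e = e) (he' : ∀ x, e * x * e = e * x)
    {n : ℕ} : ∀ {X : Type u} [AddCommGroup X] [Module k X] {l : Λ →ₗ[k] X →ₗ[k] X}
    {r : X →ₗ[k] Λ →ₗ[k] X} (_ : IsBimod l r) (_ : ∀ x v, l (e * x) v = l x v)
    (f : Cochain k Λ X n) (_ : differential l r n f = 0) (_ : ∀ t, l e (f t) = f t)
    (_ : ∀ t : Fin n → Λ, f (fun i => e * t i) = 0), f ∈ boundaries l r n := by
  induction n with
  | zero =>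
    intro X _ _ l r h hl f hf hv h0
    refine (Submodule.mem_bot k).2 ?_
    ext t
    rw [Subsingleton.elim t fun i => e * t i, h0]
    rfl
  | succ n ih =>
    intro X _ _ l r h hl f hf hv h0
    -- Applied to the curried cocycle, `Φ` gives, up to sign, the error term of
    -- `differential_evalFirst` at `e`. The rest of the proof shows that this error is a coboundary.
    let Φ : (Λ →ₗ[k] X) →ₗ[k] (Λ →ₗ[k] X) :=
      LinearMap.mk₂ k (fun φ γ => φ (e * γ) - l γ (φ e))
        (fun _ _ _ => by simp; abel) (fun _ _ _ => by simp [smul_sub])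
        (fun _ _ _ => by simp [mul_add]; abel) (fun _ _ _ => by simp [smul_sub])
    have hΦ : ∀ φ γ, Φ φ γ = φ (e * γ) - l γ (φ e) := fun _ _ => rfl
    -- This left action is forced by requiring that `Φ` intertwine it with `homL`. It is not unital
    -- in general, which is why `IsBimod` has no unit axiom.
    let lY : Λ →ₗ[k] (Λ →ₗ[k] X) →ₗ[k] (Λ →ₗ[k] X) :=
      LinearMap.mk₂ k (fun y φ => φ ∘ₗ LinearMap.mulLeft k e ∘ₗ LinearMap.mulRight k y -
          l.flip (φ (e * y)))
        (fun _ _ _ => by ext; simp [mul_add]; abel) (fun _ _ _ => by ext; simp [smul_sub])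
        (fun _ _ _ => by ext; simp; abel) (fun _ _ _ => by ext; simp [smul_sub])
    have hlY : ∀ y φ γ, lY y φ γ = φ (e * (γ * y)) - l γ (φ (e * y)) := fun _ _ _ => rfl
    have e1 : ∀ x, e * (x * e) = e * x := fun x => by rw [← mul_assoc, he']
    have e2 : ∀ x y, e * (x * (e * y)) = e * (x * y) := fun x y => by
      rw [← mul_assoc x, ← mul_assoc e (x * e), e1, mul_assoc]
    have e3 : ∀ x, e * (e * x) = e * x := fun x => by rw [← mul_assoc, he]
    have hl1 : ∀ x v, l e (l x v) = l x v := fun x v => by rw [← h.mul_left, hl]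
    have hB : IsBimod lY (postR r) := by
      refine ⟨fun x y φ => ?_, fun φ x y => ?_, fun x φ y => ?_⟩
      · ext γ
        simp only [hlY, map_sub, e3, h.mul_left, mul_assoc, hl1]
        abel
      · ext; simp [h.mul_right]
      · ext; simp [hlY, h.comm]
    have hF := differential_comp (l := homL) (r := postR r) (l' := lY) (r' := postR r) Φ
      (fun y φ => by
        ext γ
        simp only [hlY, hΦ, homL_apply, e3, mul_assoc, h.mul_left, map_sub, hl1]
        abel)
      (fun φ y => by ext γ; simp [hΦ, h.comm]) (curryFirst f)
    -- The cocycle condition makes the differential of the curried cochain equal to `x ↦ x f(t)`.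
    -- `Φ` kills this map because `e f(t) = f(t)`, so `Φ ∘ curryFirst f` is again a cocycle and the
    -- induction hypothesis applies to it.
    have hd : ∀ t x, differential homL (postR r) n (curryFirst f) t x = l x (f t) := fun t x => by
      have := differential_cons l r f x t
      rw [hf] at this
      exact (sub_eq_zero.1 this.symm).symm
    have key := ih (l := lY) (r := postR r) hB
      (fun y φ => by ext γ; simp [hlY, e2, e3])
      (Φ.compMultilinearMap (curryFirst f))
      (by
        rw [hF]
        ext t γ
        simp [hΦ, hd, hl, hv])
      (fun t => by
        ext γ
        simp [hlY, hΦ, e1, e3, he, hl, hv])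
      (fun t => by
        ext γ
        have h1 := h0 (Fin.cons γ t)
        have h2 := h0 (Fin.cons e t)
        have h3 : ∀ y, (fun i => e * (Fin.cons y t : Fin (n + 1) → Λ) i) =
            Fin.cons (e * y) (fun i => e * t i) := fun y => by
          ext i
          refine Fin.cases ?_ (fun i => ?_) i <;> simp
        rw [h3] at h1 h2
        rw [he] at h2
        simp [hΦ, h1, h2])
    obtain ⟨u, hu⟩ : ∃ u : Cochain k Λ X n, ∀ t, differential l r n u t =
        - Φ (curryFirst f (Fin.tail t)) (t 0) := by
      cases n with
      | zero =>
        refine ⟨0, fun t => ?_⟩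
        have h1 := (Submodule.mem_bot k).1 key
        have h2 : Φ (curryFirst f (Fin.tail t)) = 0 := congrArg (fun F => F (Fin.tail t)) h1
        simp [h2]
      | succ m =>
        obtain ⟨U, hU⟩ := key
        let Υ : (Λ →ₗ[k] X) →ₗ[k] (Λ →ₗ[k] X) := LinearMap.lcomp k X (LinearMap.mulLeft k e)
        -- Precomposition with left multiplication by `e` does not quite intertwine `lY` and `homL`.
        -- Its defect cancels the outer term `x u(t)` that appears when the first variable is put
        -- back.
        refine ⟨uncurryFirst (Υ.compMultilinearMap U), fun s => ?_⟩
        obtain ⟨x, t, rfl⟩ : ∃ x t, s = Fin.cons x t := ⟨_, _, (Fin.cons_self_tail s).symm⟩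
        rw [differential_cons, curryFirst_uncurryFirst,
          differential_comp_apply (l := lY) (r := postR r), hU]
        simp [Υ, hlY, hΦ, e3, hl, mul_assoc]
    refine ⟨evalFirst e f - u, ?_⟩
    ext t
    rw [map_sub, sub_apply, differential_evalFirst, hf, hu, hv]
    simp [hΦ]

/-- Let `e` be an idempotent such that `Λ e = e Λ e`, and let `X` be a bimodule on which `Λ` acts
on the right through `Λ e`. Then a cocycle with values in `X` that vanishes on `Λ e` is a
coboundary. -/
theorem mem_boundaries_of_idempotent_right (e : Λ) (he : e * e = e) (he' : ∀ x, e * x * e = x * e)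
    {n : ℕ} : ∀ {X : Type u} [AddCommGroup X] [Module k X] {l : Λ →ₗ[k] X →ₗ[k] X}
    {r : X →ₗ[k] Λ →ₗ[k] X} (_ : IsBimod l r) (_ : ∀ v x, r v (x * e) = r v x)
    (f : Cochain k Λ X n) (_ : differential l r n f = 0) (_ : ∀ t, r (f t) e = f t)
    (_ : ∀ t : Fin n → Λ, f (fun i => t i * e) = 0), f ∈ boundaries l r n := by
  induction n with
  | zero =>
    intro X _ _ l r h hr f hf hv h0
    refine (Submodule.mem_bot k).2 ?_
    ext t
    rw [Subsingleton.elim t fun i => t i * e, h0]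
    rfl
  | succ n ih =>
    intro X _ _ l r h hr f hf hv h0
    -- The mirror image of the left-handed argument: the last variable is separated and `f(…, e)`
    -- serves as the first approximation to a primitive.
    let Φ : (Λ →ₗ[k] X) →ₗ[k] (Λ →ₗ[k] X) :=
      LinearMap.mk₂ k (fun φ γ => φ (γ * e) - r (φ e) γ)
        (fun _ _ _ => by simp; abel) (fun _ _ _ => by simp [smul_sub])
        (fun _ _ _ => by simp [add_mul]; abel) (fun _ _ _ => by simp [smul_sub])
    have hΦ : ∀ φ γ, Φ φ γ = φ (γ * e) - r (φ e) γ := fun _ _ => rfl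
    let rY : (Λ →ₗ[k] X) →ₗ[k] Λ →ₗ[k] (Λ →ₗ[k] X) :=
      LinearMap.mk₂ k (fun φ y => φ ∘ₗ LinearMap.mulRight k e ∘ₗ LinearMap.mulLeft k y -
          r (φ (y * e)))
        (fun _ _ _ => by ext; simp; abel) (fun _ _ _ => by ext; simp [smul_sub])
        (fun _ _ _ => by ext; simp [add_mul]; abel) (fun _ _ _ => by ext; simp [smul_sub])
    have hrY : ∀ φ y γ, rY φ y γ = φ (y * γ * e) - r (φ (y * e)) γ := fun _ _ _ => rfl
    have e1 : ∀ x, e * (x * e) = x * e := fun x => by rw [← mul_assoc, he']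
    have e3 : ∀ x, x * e * e = x * e := fun x => by rw [mul_assoc, he]
    have e2 : ∀ x y, x * e * y * e = x * y * e := fun x y => by
      rw [mul_assoc (x * e), mul_assoc x e, e1, mul_assoc]
    have hr1 : ∀ x v, r (r v x) e = r v x := fun x v => by rw [← h.mul_right, hr]
    have hB : IsBimod (postL l) rY := by
      refine ⟨fun x y φ => ?_, fun φ x y => ?_, fun x φ y => ?_⟩
      · ext; simp [h.mul_left]
      · ext γ
        simp only [hrY, map_sub, LinearMap.sub_apply, e3, h.mul_right, ← mul_assoc, hr1]
        abel
      · ext; simp [hrY, h.comm]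
    have hF := differential_comp (l := postL l) (r := homR) (l' := postL l) (r' := rY) Φ
      (fun φ y => by ext γ; simp [hΦ, h.comm])
      (fun φ y => by
        ext γ
        simp only [hrY, hΦ, homR_apply, e3, ← mul_assoc, h.mul_right, map_sub,
          LinearMap.sub_apply, hr1]
        abel)
      f.curryRight
    have hd : ∀ t x, differential (postL l) homR n f.curryRight t x =
        - (-1 : k) ^ n • r (f t) x := fun t x => by
      have := differential_snoc l r f x t
      rw [hf] at this
      rw [neg_smul]
      exact eq_neg_of_add_eq_zero_left this.symm
    have key := ih (l := postL l) (r := rY) hB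
      (fun φ y => by ext γ; simp [hrY, e2, e3])
      (Φ.compMultilinearMap f.curryRight)
      (by
        rw [hF]
        ext t γ
        simp [hΦ, hd, hr, hv])
      (fun t => by
        ext γ
        simp [hrY, hΦ, e3, he, he', hr, hv])
      (fun t => by
        ext γ
        have h1 := h0 (Fin.snoc t γ)
        have h2 := h0 (Fin.snoc t e)
        have h3 : ∀ y, (fun i => (Fin.snoc t y : Fin (n + 1) → Λ) i * e) =
            Fin.snoc (fun i => t i * e) (y * e) := fun y => by
          ext i
          refine Fin.lastCases ?_ (fun i => ?_) i <;> simp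
        rw [h3] at h1 h2
        rw [he] at h2
        simp [hΦ, h1, h2])
    obtain ⟨u, hu⟩ : ∃ u : Cochain k Λ X n, ∀ t, differential l r n u t =
        Φ (f.curryRight (Fin.init t)) (t (Fin.last n)) := by
      cases n with
      | zero =>
        refine ⟨0, fun t => ?_⟩
        have h1 := (Submodule.mem_bot k).1 key
        have h2 : Φ (f.curryRight (Fin.init t)) = 0 := congrArg (fun F => F (Fin.init t)) h1
        rw [h2]
        simp
      | succ m =>
        obtain ⟨U, hU⟩ := key
        let Υ : (Λ →ₗ[k] X) →ₗ[k] (Λ →ₗ[k] X) := LinearMap.lcomp k X (LinearMap.mulRight k e)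
        refine ⟨(Υ.compMultilinearMap U).uncurryRight, fun s => ?_⟩
        obtain ⟨t, x, rfl⟩ : ∃ t x, s = Fin.snoc t x := ⟨_, _, (Fin.snoc_init_self s).symm⟩
        rw [differential_snoc, MultilinearMap.curry_uncurryRight,
          differential_comp_apply (l := postL l) (r := rY), hU]
        simp [Υ, hrY, hΦ, e3, hr, pow_succ, ← mul_assoc]
    refine ⟨(-1 : k) ^ (n + 1) • evalLast e f + u, ?_⟩
    ext t
    have h1 : (-1 : k) ^ (n + 1) * (-1 : k) ^ (n + 1) = 1 := by
      rw [← mul_pow]; simp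
    rw [map_add, map_smul, add_apply, smul_apply, differential_evalLast, hf, hu, hv, zero_apply,
      zero_add, smul_smul, h1, one_smul]
    simp only [hΦ, MultilinearMap.curryRight_apply]
    abel

/-- A cocycle with values in a bimodule on which `Λ` acts on the right through `Λ e = e Λ e` is a
coboundary if its restriction to `Λ e` is a coboundary. -/
theorem exists_differential_eq_of_idempotent_right {X : Type u} [AddCommGroup X] [Module k X]
    {l : Λ →ₗ[k] X →ₗ[k] X} {r : X →ₗ[k] Λ →ₗ[k] X} (e : Λ) (he : e * e = e)
    (he' : ∀ x, e * x * e = x * e) (h : IsBimod l r) (hr : ∀ v x, r v (x * e) = r v x)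
    (hv : ∀ v, r v e = v) {n : ℕ} (f : Cochain k Λ X (n + 1))
    (hf : differential l r (n + 1) f = 0) (p : Cochain k Λ X n)
    (h0 : ∀ t : Fin (n + 1) → Λ, f (fun i => t i * e) = differential l r n p fun i => t i * e) :
    ∃ g, differential l r n g = f := by
  obtain ⟨u, hu⟩ := mem_boundaries_of_idempotent_right e he he' h hr (f - differential l r n p)
    (by rw [map_sub, hf, differential_differential h, sub_zero]) (fun t => hv _)
    (fun t => by rw [sub_apply, h0, sub_self])
  exact ⟨u + p, by rw [map_add, hu, sub_add_cancel]⟩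

end Idempotent

end Hochschild

/-! ### Contracting homotopies for coinduced coefficients and for the ground field. -/

namespace Hochschild

section Coinduced

variable {k Λ V : Type u} [Field k] [Ring Λ] [Algebra k Λ] [AddCommGroup V] [Module k V]

/-- Hochschild cocycles of positive degree with values in a coinduced bimodule are coboundaries. -/
theorem exists_differential_eq_of_coinduced (r : V →ₗ[k] Λ →ₗ[k] V) {n : ℕ}
    (f : Cochain k Λ (Λ →ₗ[k] V) (n + 1)) (hf : differential homL (postR r) (n + 1) f = 0) :
    ∃ g, differential homL (postR r) n g = f := by
  -- The primitive is `g(t)(x) = f(x, t)(1)`: the argument of the coinduced value becomes the first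
  -- variable.
  let Θ : (Λ →ₗ[k] (Λ →ₗ[k] V)) →ₗ[k] (Λ →ₗ[k] V) :=
    LinearMap.llcomp k Λ (Λ →ₗ[k] V) V (LinearMap.applyₗ (1 : Λ))
  refine ⟨Θ.compMultilinearMap (curryFirst f), ?_⟩
  rw [differential_comp (l := homL) (r := postR (postR r)) Θ (fun x φ => by ext; simp [Θ])
    (fun φ x => by ext; simp [Θ])]
  ext t x
  have h := differential_cons homL (postR r) f x t
  rw [hf] at h
  have h' := LinearMap.congr_fun (sub_eq_zero.1 h.symm) 1
  simpa [Θ] using h'.symm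

/-- Cocycles of positive degree of the ground field are coboundaries. -/
theorem exists_differential_eq_of_field {X : Type u} [AddCommGroup X] [Module k X]
    (l : k →ₗ[k] X →ₗ[k] X) (r : X →ₗ[k] k →ₗ[k] X) (hl : ∀ v, l 1 v = v) {n : ℕ}
    (f : Cochain k k X (n + 1)) (hf : differential l r (n + 1) f = 0) :
    ∃ g, differential l r n g = f := by
  -- With `a = 1` the error term of `differential_evalFirst` vanishes, since `f` is linear over `k`
  -- in its first variable and the left action is scalar multiplication.
  refine ⟨evalFirst 1 f, MultilinearMap.ext fun t => ?_⟩
  have h1 : ∀ (x : k) v, l x v = x • v := fun x v => by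
    rw [← mul_one x, ← smul_eq_mul, map_smul, LinearMap.smul_apply, hl, smul_eq_mul, mul_one]
  have h2 : f (Fin.cons (1 * t 0) (Fin.tail t)) = t 0 • f (Fin.cons 1 (Fin.tail t)) := by
    rw [← f.cons_smul, smul_eq_mul, mul_comm]
  rw [differential_evalFirst, hf, hl, h1, h2]
  simp

end Coinduced

end Hochschild

/-! ### Cohomology of the triangular algebra in coinduced bimodules. -/

namespace Tri

open Hochschild

section Coinduced

variable (k A B M W : Type u) [Field k] [Ring A] [Algebra k A] [Ring B] [Algebra k B]
  [AddCommGroup M] [Module k M] [Module B M] [Module Aᵐᵒᵖ M] [SMulCommClass B Aᵐᵒᵖ M]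
  [IsScalarTower k B M] [IsScalarTower k Aᵐᵒᵖ M] [AddCommGroup W] [Module k W]

@[simp] theorem projA_apply (t : Tri A B M) : projA k A B M t = t.a := rfl
@[simp] theorem projB_apply (t : Tri A B M) : projB k A B M t = t.b := rfl
@[simp] theorem projM_apply (t : Tri A B M) : projM k A B M t = t.m := rfl
@[simp] theorem inclA_apply (a : A) : inclA k A B M a = ⟨a, 0, 0⟩ := rfl
@[simp] theorem inclB_apply (b : B) : inclB k A B M b = ⟨0, 0, b⟩ := rfl
@[simp] theorem inclM_apply (m : M) : inclM k A B M m = ⟨0, m, 0⟩ := rfl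

/-- The left action of the triangular algebra on the coinduced `B`-`A`-bimodule. -/
def coindL : Tri A B M →ₗ[k] (B →ₗ[k] A →ₗ[k] W) →ₗ[k] (B →ₗ[k] A →ₗ[k] W) :=
  homL ∘ₗ (projB k A B M).toLinearMap

/-- The right action of the triangular algebra on the coinduced `B`-`A`-bimodule. -/
def coindR : (B →ₗ[k] A →ₗ[k] W) →ₗ[k] Tri A B M →ₗ[k] (B →ₗ[k] A →ₗ[k] W) :=
  postR (homR.compl₂ (projA k A B M).toLinearMap)

/-- The right action of `B` on `Hom_k(M, W)`. -/
def homMR : (M →ₗ[k] W) →ₗ[k] B →ₗ[k] (M →ₗ[k] W) :=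
  (LinearMap.llcomp k M M W).compl₂ (Algebra.lsmul k k M).toLinearMap

variable {k A B M W}

@[simp] theorem coindL_apply (t : Tri A B M) (φ : B →ₗ[k] A →ₗ[k] W) (b : B) :
    coindL k A B M W t φ b = φ (b * t.b) := rfl

@[simp] theorem coindR_apply (t : Tri A B M) (φ : B →ₗ[k] A →ₗ[k] W) (b : B) (a : A) :
    coindR k A B M W φ t b a = φ b (t.a * a) := rfl

@[simp] theorem homMR_apply (φ : M →ₗ[k] W) (b : B) (m : M) :
    homMR k B M W φ b m = φ (b • m) := rfl

/-- Moving the argument in `A` into the last variable would contract the complex if `A` were a left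
ideal of `T`. Since `x · a` also has the component `x.m · a` in `M`, an error remains, governed by
the cochain `q` obtained by putting `M` in the last slot. On the coefficients of `q` the algebra
acts through `B` on both sides, and for `B` they are coinduced, so `q` is a coboundary as soon as
its degree `n + 1` is positive. This is why `c` has degree at least two; in degree one the
cohomology is `Hom(M, -)`. -/
theorem exists_differential_eq_coind {n : ℕ} (c : Cochain k (Tri A B M) (B →ₗ[k] A →ₗ[k] W) (n + 2))
    (hc : differential (coindL k A B M W) (coindR k A B M W) (n + 2) c = 0) :
    ∃ w, differential (coindL k A B M W) (coindR k A B M W) (n + 1) w = c := by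
  let lQ : Tri A B M →ₗ[k] (B →ₗ[k] M →ₗ[k] W) →ₗ[k] (B →ₗ[k] M →ₗ[k] W) :=
    homL ∘ₗ (projB k A B M).toLinearMap
  let rQ : (B →ₗ[k] M →ₗ[k] W) →ₗ[k] Tri A B M →ₗ[k] (B →ₗ[k] M →ₗ[k] W) :=
    postR ((homMR k B M W).compl₂ (projB k A B M).toLinearMap)
  have hlQ : ∀ t φ b, lQ t φ b = φ (b * t.b) := fun _ _ _ => rfl
  have hrQ : ∀ φ t b m, rQ φ t b m = φ b (t.b • m) := fun _ _ _ _ => rfl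
  have hQ : IsBimod lQ rQ :=
    ⟨fun x y φ => by ext; simp [hlQ, mul_assoc], fun φ x y => by ext; simp [hrQ, mul_smul],
      fun x φ y => by ext; simp [hlQ, hrQ]⟩
  have hc' : ∀ t x, differential (postL (coindL k A B M W)) homR (n + 1) c.curryRight t x =
      (-1 : k) ^ n • coindR k A B M W (c t) x := fun t x => by
    have := differential_snoc (coindL k A B M W) (coindR k A B M W) c x t
    rw [hc] at this
    rw [eq_neg_of_add_eq_zero_left this.symm]
    simp [pow_succ]
  -- the part of the cochain with last variable in `M`
  let Ψ : (Tri A B M →ₗ[k] B →ₗ[k] A →ₗ[k] W) →ₗ[k] (B →ₗ[k] M →ₗ[k] W) :=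
    LinearMap.mk₂ k (fun φ b => (LinearMap.applyₗ (1 : A) ∘ₗ LinearMap.applyₗ b) ∘ₗ
        φ ∘ₗ inclM k A B M)
      (fun _ _ _ => by ext; simp) (fun _ _ _ => by ext; simp)
      (fun _ _ _ => by ext; simp) (fun _ _ _ => by ext; simp)
  have hΨ : ∀ φ b m, Ψ φ b m = φ (inclM k A B M m) b 1 := fun _ _ _ => rfl
  set q : Cochain k (Tri A B M) (B →ₗ[k] M →ₗ[k] W) (n + 1) := Ψ.compMultilinearMap c.curryRight with hq
  have hMsmul : ∀ (y : Tri A B M) (m : M), y * ⟨0, m, 0⟩ = ⟨0, y.b • m, 0⟩ := fun y m => by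
    ext <;> simp
  have hdq : differential lQ rQ (n + 1) q = 0 := by
    rw [hq, differential_comp (l := postL (coindL k A B M W)) (r := homR) Ψ
      (fun x φ => by ext; simp [hlQ, hΨ]) (fun φ x => by ext b m; simp [hrQ, hΨ, hMsmul])]
    ext t b m
    simp [hΨ, hc']
  obtain ⟨u, hu⟩ : ∃ u, differential lQ rQ n u = q := by
    obtain ⟨p, hp⟩ := exists_differential_eq_of_coinduced (homMR k B M W)
      (q.compLinearMap fun _ => inclB k A B M) (by
        rw [differential_compLinearMap (l := lQ) (r := rQ) (inclB k A B M)
          (fun x y => by ext <;> simp) (fun x => rfl) (fun v x => rfl), hdq]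
        rfl)
    -- The primitive found over `B` is pulled back to `T`. Its differential agrees with `q` on the
    -- corner `T (0, 0, 1)`, which suffices by the idempotent lemma.
    let p' : Cochain k (Tri A B M) (B →ₗ[k] M →ₗ[k] W) n :=
      p.compLinearMap fun _ => (projB k A B M).toLinearMap
    have hp' : differential lQ rQ n p' = _ := differential_compLinearMap (l := homL) (r := postR (homMR k B M W)) (l' := lQ)
      (r' := rQ) (projB k A B M).toLinearMap (fun x y => by simp) (fun x => rfl) (fun v x => rfl) p
    refine exists_differential_eq_of_idempotent_right (⟨0, 0, 1⟩ : Tri A B M) (by ext <;> simp)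
      (fun x => by ext <;> simp) hQ (fun v x => by ext; simp [hrQ]) (fun v => by ext; simp [hrQ])
      q hdq p' (fun t => ?_)
    have h : (fun i => t i * (⟨0, 0, 1⟩ : Tri A B M)) = fun i => inclB k A B M ((t i).b) := by
      funext i; ext <;> simp
    rw [h, hp', hp]
    simp
  -- the part of the cochain with last variable in `A`
  let Ξ : (Tri A B M →ₗ[k] B →ₗ[k] A →ₗ[k] W) →ₗ[k] (B →ₗ[k] A →ₗ[k] W) :=
    LinearMap.mk₂ k (fun φ b => (LinearMap.applyₗ (1 : A) ∘ₗ LinearMap.applyₗ b) ∘ₗ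
        φ ∘ₗ inclA k A B M)
      (fun _ _ _ => by ext; simp) (fun _ _ _ => by ext; simp)
      (fun _ _ _ => by ext; simp) (fun _ _ _ => by ext; simp)
  have hΞ : ∀ φ b a, Ξ φ b a = φ (inclA k A B M a) b 1 := fun _ _ _ => rfl
  -- `Υ` turns a primitive of `q` into a cochain whose differential is precisely the error left by
  -- `Ξ`.
  let Υ : (B →ₗ[k] M →ₗ[k] W) →ₗ[k] (Tri A B M →ₗ[k] B →ₗ[k] A →ₗ[k] W) :=
    LinearMap.mk₂ k (fun φ x => LinearMap.mk₂ k (fun b a => φ b (op a • x.m))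
        (fun _ _ _ => by simp) (fun _ _ _ => by simp)
        (fun _ _ _ => by simp [add_smul]) (fun _ _ _ => by simp))
      (fun _ _ _ => by ext; simp) (fun _ _ _ => by ext; simp)
      (fun _ _ _ => by ext; simp) (fun c _ _ => by ext _ a; simp [smul_comm (op a) c])
  have hΥ : ∀ φ x b a, Υ φ x b a = φ b (op a • x.m) := fun _ _ _ _ => rfl
  have hAmul : ∀ (y : Tri A B M) (a : A), y * ⟨a, 0, 0⟩ = ⟨y.a * a, 0, 0⟩ + ⟨0, op a • y.m, 0⟩ :=
    fun y a => by ext <;> simp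
  have hw : ∀ t b a, differential (coindL k A B M W) (coindR k A B M W) (n + 1)
      (Ξ.compMultilinearMap c.curryRight) t b a = (-1 : k) ^ n • c t b a -
        (-1 : k) ^ n • q (Fin.init t) b (op a • (t (Fin.last _)).m) := fun t b a => by
    rw [differential_comp_apply (l := postL (coindL k A B M W)) (r := homR)]
    simp [hΞ, hc', hAmul, pow_succ, hq, hΨ, MultilinearMap.snoc_add, smul_sub]
    rw [sub_eq_add_neg]
  have hv : ∀ t b a, differential (coindL k A B M W) (coindR k A B M W) (n + 1)
      (Υ.compMultilinearMap u).uncurryRight t b a =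
        q (Fin.init t) b (op a • (t (Fin.last _)).m) := fun s b a => by
    obtain ⟨t, x, rfl⟩ : ∃ t x, s = Fin.snoc t x := ⟨_, _, (Fin.snoc_init_self s).symm⟩
    rw [differential_snoc, MultilinearMap.curry_uncurryRight,
      differential_comp_apply (l := lQ) (r := rQ), hu]
    simp [hlQ, hrQ, hΥ, pow_succ, mul_smul, smul_add, smul_comm]
  refine ⟨(-1 : k) ^ n • Ξ.compMultilinearMap c.curryRight + (Υ.compMultilinearMap u).uncurryRight,
    ?_⟩
  have h1 : (-1 : k) ^ n * (-1 : k) ^ n = 1 := by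
    rw [← mul_pow]; simp
  ext t b a
  rw [map_add, map_smul, add_apply, smul_apply]
  simp only [LinearMap.add_apply, LinearMap.smul_apply, hw, hv, smul_sub, smul_smul, h1, one_smul]
  abel

end Coinduced

end Tri

/-! ### Comparison of Ext with Hochschild cohomology by a universal cocycle. -/

namespace Hochschild

open CategoryTheory CategoryTheory.Abelian CategoryTheory.Limits

noncomputable section Inflation

variable {k Λ R : Type u} [Field k] [Ring Λ] [Algebra k Λ] [Ring R] [Algebra k R]
  (α : Λ ⊗[k] Λᵐᵒᵖ →ₐ[k] R) {X Y Z : ModuleCat.{u} R}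

/-- Composition of a cochain with a homomorphism of coefficient modules. -/
def mapCochain (h : X ⟶ Y) {n : ℕ} (c : Cochain k Λ (Restr α X) n) : Cochain k Λ (Restr α Y) n :=
  (Restr.map α h).compMultilinearMap c

theorem mapCochain_comp (h : X ⟶ Y) (h' : Y ⟶ Z) {n : ℕ} (c : Cochain k Λ (Restr α X) n) :
    mapCochain α (h ≫ h') c = mapCochain α h' (mapCochain α h c) := rfl

theorem mapCochain_add (h : X ⟶ Y) {n : ℕ} (c c' : Cochain k Λ (Restr α X) n) :
    mapCochain α h (c + c') = mapCochain α h c + mapCochain α h c' :=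
  MultilinearMap.ext fun t => map_add (Restr.map α h) (c t) (c' t)

theorem mapCochain_sub (h : X ⟶ Y) {n : ℕ} (c c' : Cochain k Λ (Restr α X) n) :
    mapCochain α h (c - c') = mapCochain α h c - mapCochain α h c' :=
  MultilinearMap.ext fun t => map_sub (Restr.map α h) (c t) (c' t)

theorem mapCochain_zero (h : X ⟶ Y) {n : ℕ} :
    mapCochain α h (0 : Cochain k Λ (Restr α X) n) = 0 :=
  MultilinearMap.ext fun _ => map_zero (Restr.map α h)

theorem sub_mapCochain (h h' : X ⟶ Y) {n : ℕ} (c : Cochain k Λ (Restr α X) n) :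
    mapCochain α (h - h') c = mapCochain α h c - mapCochain α h' c := rfl

theorem zero_mapCochain {n : ℕ} (c : Cochain k Λ (Restr α X) n) :
    mapCochain α (0 : X ⟶ Y) c = 0 := rfl

theorem d_mapCochain (h : X ⟶ Y) {n : ℕ} (c : Cochain k Λ (Restr α X) n) :
    d k Λ (Restr α Y) n (mapCochain α h c) = mapCochain α h (d k Λ (Restr α X) n c) :=
  differential_comp (l := actL k Λ (Restr α X)) (r := actR k Λ (Restr α X)) (Restr.map α h)
    (fun l x => (map_smul h.hom (α (l ⊗ₜ 1)) (x : X)).symm)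
    (fun x l => (map_smul h.hom (α (1 ⊗ₜ op l)) (x : X)).symm) c

theorem d_d (X : Type u) [AddCommGroup X] [Module k X] [Module Λ X] [Module Λᵐᵒᵖ X]
    [IsScalarTower k Λ X] [IsScalarTower k Λᵐᵒᵖ X] [SMulCommClass Λ Λᵐᵒᵖ X] {n : ℕ}
    (c : Cochain k Λ X n) : d k Λ X (n + 1) (d k Λ X n c) = 0 :=
  differential_differential
    ⟨fun x y v => mul_smul x y v, fun v x y => mul_smul (op y) (op x) v,
      fun x v y => (smul_comm x (op y) v).symm⟩ c

theorem exists_mapCochain_eq_of_exact {S : ShortComplex (ModuleCat.{u} R)} (hS : S.Exact) {n : ℕ}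
    (c : Cochain k Λ (Restr α S.X₂) n) (hc : mapCochain α S.g c = 0) :
    ∃ c' : Cochain k Λ (Restr α S.X₁) n, mapCochain α S.f c' = c :=
  exists_compMultilinearMap_eq _ c fun t =>
    S.moduleCat_exact_iff.1 hS (c t : S.X₂) (congrArg (fun F => F t) hc)

theorem exists_mapCochain_eq_of_epi (p : X ⟶ Y) [Epi p] {n : ℕ} (c : Cochain k Λ (Restr α Y) n) :
    ∃ c' : Cochain k Λ (Restr α X) n, mapCochain α p c' = c :=
  exists_compMultilinearMap_eq _ c fun t => (ModuleCat.epi_iff_surjective p).1 inferInstance (c t : Y)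

theorem mapCochain_injective (i : X ⟶ Y) [Mono i] {n : ℕ} :
    Function.Injective (mapCochain α i (n := n)) := fun _ _ h =>
  MultilinearMap.ext fun t => (ModuleCat.mono_iff_injective i).1 inferInstance (congrArg (fun F => F t) h)

variable {M : ModuleCat.{u} R}

/-- A `1`-cocycle `u` with values in `M` is universal if `h ↦ h ∘ u` identifies `Hom_R(M, X)` with
the first Hochschild cohomology of `X` for all `R`-modules `X`, and if the higher Hochschild
cohomology is effaceable on the category of `R`-modules. -/
structure IsUniversal (u : Cochain k Λ (Restr α M) 1) : Prop where
  cocycle : d k Λ (Restr α M) 1 u = 0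
  exists_hom : ∀ (X : ModuleCat.{u} R) (c : Cochain k Λ (Restr α X) 1),
    d k Λ (Restr α X) 1 c = 0 → ∃ (h : M ⟶ X) (x : Cochain k Λ (Restr α X) 0),
      c = mapCochain α h u + d k Λ (Restr α X) 0 x
  hom_eq_zero : ∀ (X : ModuleCat.{u} R) (h : M ⟶ X) (x : Cochain k Λ (Restr α X) 0),
    mapCochain α h u = d k Λ (Restr α X) 0 x → h = 0
  effaceable : ∀ X : ModuleCat.{u} R, ∃ (X' : ModuleCat.{u} R) (i : X ⟶ X'), Mono i ∧
    ∀ (n : ℕ) (c : Cochain k Λ (Restr α X') (n + 2)), d k Λ (Restr α X') (n + 2) c = 0 →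
      ∃ w, d k Λ (Restr α X') (n + 1) w = c

variable {α} {u : Cochain k Λ (Restr α M) 1} (P : ProjectiveResolution M)

/-- The augmentation of a projective resolution. -/
def aug : P.complex.X 0 ⟶ M := P.π.f 0

instance : Epi (aug P) := inferInstanceAs (Epi (P.π.f 0))

theorem d_aug : P.complex.d 1 0 ≫ aug P = 0 := P.complex_d_comp_π_f_zero

theorem exact_aug : (ShortComplex.mk _ _ (d_aug P)).Exact := P.exact₀

theorem IsLift.aug_eq {v : ∀ n : ℕ, Cochain k Λ (Restr α (P.complex.X n)) (n + 1)}
    (hv : IsLift α P u v) : mapCochain α (aug P) (v 0) = u := hv.augmentation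

/-- Each stage lifts the differential of the previous cochain through the resolution. The recursion
must remember that such a lift exists, so it runs over the subtype `S n`; the condition passes to
the next stage because `∂ (d v') = d (d v) = 0`. -/
theorem exists_isLift (hu : d k Λ (Restr α M) 1 u = 0) : ∃ v, IsLift α P u v := by
  let S : ℕ → Type u := fun n => { v : Cochain k Λ (Restr α (P.complex.X n)) (n + 1) //
    ∃ v' : Cochain k Λ (Restr α (P.complex.X (n + 1))) (n + 2),
      mapCochain α (P.complex.d (n + 1) n) v' = d k Λ _ (n + 1) v }
  have h0 : ∃ v : S 0, mapCochain α (aug P) v.1 = u := by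
    obtain ⟨v, hv⟩ := exists_mapCochain_eq_of_epi α (aug P) u
    refine ⟨⟨v, exists_mapCochain_eq_of_exact α (exact_aug P) _ ?_⟩, hv⟩
    change mapCochain α (aug P) (d k Λ _ 1 v) = 0
    rw [← d_mapCochain, hv, hu]
  have hs : ∀ n (v : S n), ∃ v' : S (n + 1),
      mapCochain α (P.complex.d (n + 1) n) v'.1 = d k Λ _ (n + 1) v.1 := by
    rintro n ⟨v, v', hv⟩
    refine ⟨⟨v', exists_mapCochain_eq_of_exact α (P.exact_succ n) _ ?_⟩, hv⟩
    change mapCochain α (P.complex.d (n + 1) n) (d k Λ _ (n + 2) v') = 0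
    rw [← d_mapCochain, hv, d_d]
  obtain ⟨v0, hv0⟩ := h0
  choose next hnext using hs
  let v : ∀ n, S n := fun n => Nat.rec v0 next n
  exact ⟨fun n => (v n).1, hv0, fun n => (hnext n (v n)).symm⟩

/-- Lifts are unique up to homotopy, as for comparison maps of resolutions. The `z` obtained in one
degree is the `y` of the next. -/
theorem IsLift.exists_sub_eq {v v' : ∀ n : ℕ, Cochain k Λ (Restr α (P.complex.X n)) (n + 1)}
    (hv : IsLift α P u v) (hv' : IsLift α P u v') (n : ℕ) :
    ∃ (y : Cochain k Λ (Restr α (P.complex.X n)) n)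
      (z : Cochain k Λ (Restr α (P.complex.X (n + 1))) (n + 1)),
      v n - v' n = d k Λ _ n y + mapCochain α (P.complex.d (n + 1) n) z := by
  induction n with
  | zero =>
    obtain ⟨z, hz⟩ := exists_mapCochain_eq_of_exact α (exact_aug P) (v 0 - v' 0) (by
      change mapCochain α (aug P) (v 0 - v' 0) = 0
      rw [mapCochain_sub, hv.aug_eq, hv'.aug_eq, sub_self])
    exact ⟨0, z, by rw [map_zero]; exact hz.symm.trans (zero_add _).symm⟩
  | succ n ih =>
    obtain ⟨y, z, h⟩ := ih
    obtain ⟨z', hz'⟩ := exists_mapCochain_eq_of_exact α (P.exact_succ n)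
      (v (n + 1) - v' (n + 1) - d k Λ _ (n + 1) z) (by
        change mapCochain α (P.complex.d (n + 1) n) _ = 0
        rw [mapCochain_sub, mapCochain_sub, ← d_mapCochain, sub_eq_zero]
        have e := congrArg (d k Λ (Restr α (P.complex.X n)) (n + 1)) h
        rw [map_add, d_d, zero_add, map_sub, hv.differential, hv'.differential] at e
        exact e)
    exact ⟨z, z', eq_add_of_sub_eq' hz'.symm⟩

variable {v : ∀ n : ℕ, Cochain k Λ (Restr α (P.complex.X n)) (n + 1)}

theorem IsLift.d_mapCochain_eq (hv : IsLift α P u v) {n : ℕ} (h : P.complex.X n ⟶ X) :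
    d k Λ _ (n + 1) (mapCochain α h (v n)) =
      mapCochain α (P.complex.d (n + 1) n ≫ h) (v (n + 1)) := by
  rw [d_mapCochain, hv.differential, mapCochain_comp]
  rfl

/-- Surjectivity of the comparison, by dimension shifting. In an effacing embedding `i : X → X'` the
cocycle becomes `d w`, so `w` is a cocycle one degree lower modulo `X`, where the induction
hypothesis applies. -/
theorem IsUniversal.exists_eq (hu : IsUniversal α u) (hv : IsLift α P u v) (n : ℕ) :
    ∀ (X : ModuleCat.{u} R) (c : Cochain k Λ (Restr α X) (n + 1)),
      d k Λ (Restr α X) (n + 1) c = 0 → ∃ h : P.complex.X n ⟶ X, P.complex.d (n + 1) n ≫ h = 0 ∧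
        ∃ g, c = mapCochain α h (v n) + d k Λ (Restr α X) n g := by
  induction n with
  | zero =>
    intro X c hc
    obtain ⟨h, x, rfl⟩ := hu.exists_hom X c hc
    refine ⟨aug P ≫ h, ?_, x, ?_⟩
    · rw [← Category.assoc]
      exact (congrArg (· ≫ h) (d_aug P)).trans zero_comp
    · rw [mapCochain_comp, hv.aug_eq]
  | succ n ih =>
    intro X c hc
    obtain ⟨X', i, hi, hX'⟩ := hu.effaceable X
    obtain ⟨w, hw⟩ := hX' n (mapCochain α i c) (by rw [d_mapCochain, hc, mapCochain_zero])
    let p := cokernel.π i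
    have hip : i ≫ p = 0 := cokernel.condition i
    have hex : (ShortComplex.mk i p hip).Exact := ShortComplex.exact_cokernel i
    obtain ⟨h, hh, g, hg⟩ := ih _ (mapCochain α p w) (by
      rw [d_mapCochain, hw, ← mapCochain_comp, hip, zero_mapCochain])
    obtain ⟨g', rfl⟩ := exists_mapCochain_eq_of_epi α p g
    -- Projectivity lifts the homomorphism found for the cokernel to `X'`. Then `w - h' ∘ v n - d
    -- g'` comes from `X`, and `∂ ≫ h'` factors through `X`, giving the required homomorphism on the
    -- next term of the resolution.
    let h' : P.complex.X n ⟶ X' := Projective.factorThru h p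
    have hh' : h' ≫ p = h := Projective.factorThru_comp _ _
    obtain ⟨y, hy⟩ := exists_mapCochain_eq_of_exact α hex
      (w - mapCochain α h' (v n) - d k Λ _ n g') (by
        change mapCochain α p _ = 0
        rw [mapCochain_sub, mapCochain_sub, ← mapCochain_comp, hh', ← d_mapCochain, hg]
        abel)
    have : Mono (ShortComplex.mk i p hip).f := hi
    have hk : (P.complex.d (n + 1) n ≫ h') ≫ p = 0 := by rw [Category.assoc, hh', hh]
    let h'' : P.complex.X (n + 1) ⟶ X := hex.lift (P.complex.d (n + 1) n ≫ h') hk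
    have hh'' : h'' ≫ i = P.complex.d (n + 1) n ≫ h' := hex.lift_f _ _
    refine ⟨h'', ?_, y, ?_⟩
    · rw [← cancel_mono i, Category.assoc, hh'', ← Category.assoc, P.complex.d_comp_d, zero_comp,
        zero_comp]
    · apply mapCochain_injective α i
      change mapCochain α i y = _ at hy
      rw [mapCochain_add, ← mapCochain_comp, hh'', ← d_mapCochain, hy, map_sub, map_sub, d_d, hw,
        hv.d_mapCochain_eq]
      abel

/-- A homomorphism killed by `∂` factors through the augmentation, which carries `v 0` to the
universal cocycle. -/
theorem IsUniversal.hom_eq_zero_of_eq (hu : IsUniversal α u) (hv : IsLift α P u v)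
    (h : P.complex.X 0 ⟶ X) (hh : P.complex.d 1 0 ≫ h = 0) (g : Cochain k Λ (Restr α X) 0)
    (hg : mapCochain α h (v 0) = d k Λ (Restr α X) 0 g) : h = 0 := by
  obtain ⟨h', rfl⟩ : ∃ h' : M ⟶ X, aug P ≫ h' = h :=
    ⟨(exact_aug P).desc h hh, (exact_aug P).g_desc h hh⟩
  rw [mapCochain_comp, hv.aug_eq] at hg
  rw [hu.hom_eq_zero X h' g hg, comp_zero]

/-- Injectivity of the comparison. After embedding `X` in an injective module, `h` becomes `∂ ≫ h₁`.
Two corrections that do not change this composite make `h₁` land in `X`: surjectivity supplies `h₂`,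
and the same statement in lower degree, applied to the cokernel, supplies `h₃`. -/
theorem IsUniversal.exists_comp_eq (hu : IsUniversal α u) (hv : IsLift α P u v) (n : ℕ) :
    ∀ (X : ModuleCat.{u} R) (h : P.complex.X (n + 1) ⟶ X), P.complex.d (n + 2) (n + 1) ≫ h = 0 →
      ∀ g, mapCochain α h (v (n + 1)) = d k Λ (Restr α X) (n + 1) g →
        ∃ h' : P.complex.X n ⟶ X, P.complex.d (n + 1) n ≫ h' = h := by
  induction n using Nat.strong_induction_on with
  | _ n ih =>
  intro X h hh g hg
  let i := Injective.ι X
  let p := cokernel.π i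
  have hip : i ≫ p = 0 := cokernel.condition i
  have hex : (ShortComplex.mk i p hip).Exact := ShortComplex.exact_cokernel i
  have hi : Mono (ShortComplex.mk i p hip).f := inferInstanceAs (Mono (Injective.ι X))
  have hhi : P.complex.d (n + 2) (n + 1) ≫ h ≫ i = 0 := by
    rw [← Category.assoc, hh, zero_comp]
  let h₁ : P.complex.X n ⟶ Injective.under X := (P.exact_succ n).descToInjective (h ≫ i) hhi
  have hh₁ : P.complex.d (n + 1) n ≫ h₁ = h ≫ i :=
    (P.exact_succ n).comp_descToInjective (h ≫ i) hhi
  obtain ⟨h₂, hh₂, w, hw⟩ := hu.exists_eq P hv n _ (mapCochain α h₁ (v n) - mapCochain α i g) (by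
    rw [map_sub, hv.d_mapCochain_eq, hh₁, mapCochain_comp, hg, d_mapCochain, sub_self])
  have hd : P.complex.d (n + 1) n ≫ (h₁ - h₂) = h ≫ i := by
    rw [Preadditive.comp_sub, hh₁, hh₂, sub_zero]
  have hp : mapCochain α ((h₁ - h₂) ≫ p) (v n) = d k Λ _ n (mapCochain α p w) := by
    have e := congrArg (mapCochain α p) hw
    rw [mapCochain_sub, ← mapCochain_comp α i, hip, zero_mapCochain, sub_zero, mapCochain_add] at e
    rw [mapCochain_comp, sub_mapCochain, mapCochain_sub, e, d_mapCochain, add_sub_cancel_left]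
  obtain ⟨h₃, hh₃, hh₃'⟩ : ∃ h₃ : P.complex.X n ⟶ Injective.under X,
      P.complex.d (n + 1) n ≫ h₃ = 0 ∧ h₃ ≫ p = (h₁ - h₂) ≫ p := by
    have hdp : P.complex.d (n + 1) n ≫ (h₁ - h₂) ≫ p = 0 := by
      rw [← Category.assoc, hd, Category.assoc, hip, comp_zero]
    cases n with
    -- At the bottom of the resolution there are no coboundaries to subtract: the composite with `p`
    -- is already zero.
    | zero => exact ⟨0, comp_zero, by rw [hu.hom_eq_zero_of_eq P hv _ hdp _ hp, zero_comp]⟩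
    | succ m =>
      obtain ⟨h₄, hh₄⟩ := ih m (Nat.lt_succ_self m) _ _ hdp _ hp
      refine ⟨P.complex.d (m + 1) m ≫ Projective.factorThru h₄ p, ?_, ?_⟩
      · rw [← Category.assoc, P.complex.d_comp_d, zero_comp]
      · rw [Category.assoc, Projective.factorThru_comp, hh₄]
  have hk : (h₁ - h₂ - h₃) ≫ p = 0 := by rw [Preadditive.sub_comp, hh₃', sub_self]
  have hl : hex.lift (h₁ - h₂ - h₃) hk ≫ i = h₁ - h₂ - h₃ := hex.lift_f _ _
  refine ⟨hex.lift (h₁ - h₂ - h₃) hk, ?_⟩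
  rw [← cancel_mono i, Category.assoc, hl, Preadditive.comp_sub, hd, hh₃, sub_zero]

variable {P}

/-- In degree zero a coboundary would factor through the term after `P₀` in the cochain complex of
the resolution, and that term is zero. -/
theorem extMk_eq_zero_iff_zero {Y : ModuleCat.{u} R} (f : P.complex.X 0 ⟶ Y)
    (hf : P.complex.d 1 0 ≫ f = 0) : P.extMk f 1 rfl hf = 0 ↔ f = 0 := by
  refine ⟨fun h => ?_, fun h => by subst h; exact P.extMk_zero 1 rfl⟩
  rw [← P.extEquivCohomologyClass.apply_eq_iff_eq, P.extEquivCohomologyClass_extMk,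
    P.extEquivCohomologyClass_zero, CochainComplex.HomComplex.CohomologyClass.mk_eq_zero_iff,
    CochainComplex.HomComplex.Cocycle.toSingleMk_mem_coboundaries_iff _ _ _ _ _ 1 (by lia)] at h
  obtain ⟨g, hg⟩ := h
  have hz : IsZero (P.cochainComplex.X 1) := P.cochainComplex.isZero_of_isStrictlyLE 0 1 (by lia)
  rw [hz.eq_of_src g 0, comp_zero] at hg
  rwa [← cancel_epi (P.cochainComplexXIso 0 0 rfl).hom, comp_zero, eq_comm]

theorem extMk_smul {Y : ModuleCat.{u} R} {n : ℕ} (a : k) (f : P.complex.X n ⟶ Y)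
    (hf : P.complex.d (n + 1) n ≫ f = 0) :
    P.extMk (a • f) (n + 1) rfl (by rw [Linear.comp_smul, hf, smul_zero]) =
      a • P.extMk f (n + 1) rfl hf := by
  rw [Ext.smul_eq_comp_mk₀, P.extMk_comp_mk₀]
  congr 1

variable (k P) in
/-- Cocycles on a projective resolution. -/
def homCocycles (Y : ModuleCat.{u} R) (n : ℕ) : Submodule k (P.complex.X n ⟶ Y) :=
  LinearMap.ker (Linear.leftComp k Y (P.complex.d (n + 1) n))

variable (k P) in
/-- The class in `Ext` of a cocycle on a projective resolution. -/
def extClass (Y : ModuleCat.{u} R) (n : ℕ) : homCocycles k P Y n →ₗ[k] Ext M Y n where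
  toFun f := P.extMk f.1 (n + 1) rfl f.2
  map_add' _ _ := (P.add_extMk _ _ _ _ _ _).symm
  map_smul' a f := extMk_smul a f.1 f.2

/-- The Hochschild cohomology class of a cocycle on a projective resolution. -/
def hochschildClass (hv : IsLift α P u v) (Y : ModuleCat.{u} R) (n : ℕ) :
    homCocycles k P Y n →ₗ[k] HH k Λ (Restr α Y) (n + 1) :=
  (Submodule.mkQ _) ∘ₗ LinearMap.codRestrict (cocycles k Λ (Restr α Y) (n + 1))
    { toFun := fun f => mapCochain α f.1 (v n)
      map_add' := fun _ _ => rfl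
      map_smul' := fun _ _ => rfl }
    (fun f => by
      have hf : P.complex.d (n + 1) n ≫ f.1 = 0 := f.2
      change d k Λ _ (n + 1) (mapCochain α f.1 (v n)) = 0
      rw [hv.d_mapCochain_eq, hf, zero_mapCochain])

theorem mk_eq_mk_iff {X : Type u} [AddCommGroup X] [Module k X] [Module Λ X] [Module Λᵐᵒᵖ X]
    [IsScalarTower k Λ X] [IsScalarTower k Λᵐᵒᵖ X] {n : ℕ} (c c' : cocycles k Λ X n) :
    (Submodule.Quotient.mk c : HH k Λ X n) = Submodule.Quotient.mk c' ↔
      c.1 - c'.1 ∈ coboundaries k Λ X n :=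
  Submodule.Quotient.eq _

theorem extClass_surjective (Y : ModuleCat.{u} R) (n : ℕ) :
    Function.Surjective (extClass k P Y n) := fun x => by
  obtain ⟨f, hf, rfl⟩ := P.extMk_surjective x (n + 1) rfl
  exact ⟨⟨f, hf⟩, rfl⟩

theorem hochschildClass_surjective (hu : IsUniversal α u) (hv : IsLift α P u v)
    (Y : ModuleCat.{u} R) (n : ℕ) : Function.Surjective (hochschildClass hv Y n) := fun x => by
  obtain ⟨⟨c, hc⟩, rfl⟩ := Submodule.Quotient.mk_surjective _ x
  obtain ⟨h, hh, g, rfl⟩ := hu.exists_eq P hv n Y c hc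
  refine ⟨⟨h, hh⟩, (mk_eq_mk_iff _ _).2 ⟨-g, ?_⟩⟩
  rw [map_neg]
  exact (sub_add_cancel_left _ _).symm

/-- Both classes vanish exactly on homomorphisms that factor through `∂`, or only on zero in degree
zero. Two surjections from the same space with equal kernels then have isomorphic targets. -/
theorem ker_hochschildClass (hu : IsUniversal α u) (hv : IsLift α P u v)
    (Y : ModuleCat.{u} R) (n : ℕ) :
    LinearMap.ker (hochschildClass hv Y n) = LinearMap.ker (extClass k P Y n) := by
  ext ⟨h, hh⟩
  have e : (∃ g, d k Λ (Restr α Y) n g = mapCochain α h (v n)) ↔ P.extMk h (n + 1) rfl hh = 0 := by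
    cases n with
    | zero =>
      rw [extMk_eq_zero_iff_zero h hh]
      exact ⟨fun ⟨g, hg⟩ => hu.hom_eq_zero_of_eq P hv h hh g hg.symm,
        fun h0 => ⟨0, by rw [map_zero, h0]; rfl⟩⟩
    | succ n =>
      rw [P.extMk_eq_zero_iff h (n + 2) rfl hh n rfl]
      constructor
      · rintro ⟨g, hg⟩
        exact hu.exists_comp_eq P hv n Y h hh g hg.symm
      · rintro ⟨h', rfl⟩
        exact ⟨mapCochain α h' (v n), hv.d_mapCochain_eq P h'⟩
  refine Iff.trans ?_ e
  rw [LinearMap.mem_ker]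
  refine (Submodule.Quotient.mk_eq_zero _).trans ?_
  exact Iff.rfl

/-- The canonical isomorphism between `Ext^n(M, Y)` and Hochschild cohomology in degree `n + 1`
defined by a lift of a universal cocycle to a projective resolution. -/
def extEquivHH (hu : IsUniversal α u) (hv : IsLift α P u v) (Y : ModuleCat.{u} R) (n : ℕ) :
    Ext M Y n ≃ₗ[k] HH k Λ (Restr α Y) (n + 1) :=
  ((extClass k P Y n).quotKerEquivOfSurjective (extClass_surjective Y n)).symm ≪≫ₗ
    Submodule.quotEquivOfEq _ _ (ker_hochschildClass hu hv Y n).symm ≪≫ₗ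
    (hochschildClass hv Y n).quotKerEquivOfSurjective (hochschildClass_surjective hu hv Y n)

theorem extEquivHH_extClass (hu : IsUniversal α u) (hv : IsLift α P u v) (Y : ModuleCat.{u} R)
    (n : ℕ) (h : homCocycles k P Y n) :
    extEquivHH hu hv Y n (extClass k P Y n h) = hochschildClass hv Y n h := by
  have e : ((extClass k P Y n).quotKerEquivOfSurjective (extClass_surjective Y n)).symm
      (extClass k P Y n h) = Submodule.Quotient.mk h := by
    rw [LinearEquiv.symm_apply_eq]
    rfl
  rw [extEquivHH, LinearEquiv.trans_apply, LinearEquiv.trans_apply, e]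
  rfl

/-- The isomorphism `extEquivHH` does not depend on the resolution and on the lift. -/
theorem extEquivHH_extMk (hu : IsUniversal α u) (hv : IsLift α P u v) (Y : ModuleCat.{u} R) {n : ℕ}
    {Q : ProjectiveResolution M} {w : ∀ n : ℕ, Cochain k Λ (Restr α (Q.complex.X n)) (n + 1)}
    (hw : IsLift α Q u w) (h : Q.complex.X n ⟶ Y) (hh : Q.complex.d (n + 1) n ≫ h = 0) :
    Represents (mapCochain α h (w n)) (extEquivHH hu hv Y n (Q.extMk h (n + 1) rfl hh)) := by
  -- A comparison map of resolutions carries `v` to a lift on `Q`, which is homotopic to `w`. The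
  -- term of the homotopy coming from `∂` is killed by `h`, leaving only a Hochschild coboundary.
  let φ : ProjectiveResolution.Hom P Q (𝟙 M) :=
    { hom := ProjectiveResolution.lift (𝟙 M) P Q
      hom_f_zero_comp_π_f_zero := ProjectiveResolution.lift_commutes_zero (𝟙 M) P Q }
  have hφ : P.complex.d (n + 1) n ≫ φ.hom.f n ≫ h = 0 := by
    rw [← φ.hom.comm_assoc, hh, comp_zero]
  have e1 : Q.extMk h (n + 1) rfl hh = extClass k P Y n ⟨φ.hom.f n ≫ h, hφ⟩ := by
    rw [← Ext.mk₀_id_comp (Q.extMk h (n + 1) rfl hh)]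
    exact ProjectiveResolution.mk₀_comp_extMk h (n + 1) rfl hh φ
  have hφv : IsLift α Q u (fun n => mapCochain α (φ.hom.f n) (v n)) := by
    refine ⟨?_, fun n => ?_⟩
    · change mapCochain α (aug Q) (mapCochain α (φ.hom.f 0) (v 0)) = u
      rw [← mapCochain_comp, show φ.hom.f 0 ≫ aug Q = aug P from ?_, hv.aug_eq]
      exact (ProjectiveResolution.lift_commutes_zero (𝟙 M) P Q).trans (Category.comp_id _)
    · change _ = mapCochain α (Q.complex.d (n + 1) n) (mapCochain α (φ.hom.f (n + 1)) (v (n + 1)))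
      rw [hv.d_mapCochain_eq, ← mapCochain_comp, φ.hom.comm]
  obtain ⟨y, z, hyz⟩ := hw.exists_sub_eq Q hφv n
  refine ⟨?_, ?_⟩
  · change d k Λ _ (n + 1) (mapCochain α h (w n)) = 0
    rw [hw.d_mapCochain_eq, hh, zero_mapCochain]
  · rw [e1, extEquivHH_extClass]
    have key : d k Λ _ n (mapCochain α h y) =
        mapCochain α h (w n) - mapCochain α (φ.hom.f n ≫ h) (v n) := by
      rw [d_mapCochain, eq_sub_of_add_eq hyz.symm, mapCochain_sub, mapCochain_sub,
        ← mapCochain_comp α (Q.complex.d (n + 1) n) h, hh, zero_mapCochain, sub_zero]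
      rfl
    exact (mk_eq_mk_iff _ _).2 ⟨mapCochain α h y, key⟩

end Inflation

end Hochschild

/-! ### Degree-one cocycles and coinduced modules. -/

namespace Hochschild

section LowDegree

variable {k Λ X : Type u} [Field k] [Ring Λ] [Algebra k Λ] [AddCommGroup X] [Module k X]

theorem eq_const_zero {Y : Type*} (t : Fin 1 → Y) : t = fun _ => t 0 :=
  funext fun i => by rw [Subsingleton.elim i 0]

theorem differential_one_apply (l : Λ →ₗ[k] X →ₗ[k] X) (r : X →ₗ[k] Λ →ₗ[k] X)
    (f : Cochain k Λ X 1) (x y : Λ) :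
    differential l r 1 f (Fin.cons x fun _ => y) =
      l x (f fun _ => y) - f (fun _ => x * y) + r (f fun _ => x) y := by
  have h : ∀ z : Λ, (Fin.cons z Fin.elim0 : Fin 1 → Λ) = fun _ => z := fun z => eq_const_zero _
  rw [differential_cons, differential_zero_apply]
  simp only [LinearMap.sub_apply, homL_apply, postR_apply, curryFirst_apply, h]
  abel

theorem map_mul_of_cocycle {l : Λ →ₗ[k] X →ₗ[k] X} {r : X →ₗ[k] Λ →ₗ[k] X}
    {f : Cochain k Λ X 1} (hf : differential l r 1 f = 0) (x y : Λ) :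
    f (fun _ => x * y) = l x (f fun _ => y) + r (f fun _ => x) y := by
  have h := differential_one_apply l r f x y
  rw [hf, zero_apply] at h
  rw [← sub_eq_zero, ← neg_eq_zero, h]
  abel

end LowDegree

/-- The coinduced module `Hom_k(R, V)`. -/
def Coind (k R V : Type u) [Field k] [Ring R] [Algebra k R] [AddCommGroup V] [Module k V] : Type u :=
  R →ₗ[k] V

section Coind

variable (k R V : Type u) [Field k] [Ring R] [Algebra k R] [AddCommGroup V] [Module k V]

instance : AddCommGroup (Coind k R V) := inferInstanceAs (AddCommGroup (R →ₗ[k] V))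

instance : Module R (Coind k R V) where
  smul r φ := LinearMap.comp φ (LinearMap.mulRight k r)
  one_smul φ := LinearMap.ext fun s => congrArg φ.toFun (mul_one s)
  mul_smul r r' φ := LinearMap.ext fun s => congrArg φ.toFun (mul_assoc s r r').symm
  smul_zero _ := rfl
  smul_add _ _ _ := rfl
  add_smul r r' φ := LinearMap.ext fun s =>
    (congrArg φ.toFun (mul_add s r r')).trans (φ.map_add' _ _)
  zero_smul φ := LinearMap.ext fun s =>
    (congrArg φ.toFun (mul_zero s)).trans (LinearMap.map_zero φ)

variable {k R V}

/-- The value of an element of the coinduced module. -/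
def Coind.eval (s : R) : Coind k R V →+ V := LinearMap.toAddMonoidHom (LinearMap.applyₗ (R := k) s)

theorem Coind.eval_smul (s r : R) (φ : Coind k R V) : eval s (r • φ) = eval (s * r) φ := rfl

end Coind

end Hochschild

/-! ### Universality of the projection to `M`. -/

namespace Tri

open Hochschild CategoryTheory

section Universal

variable {k A B M R : Type u} [Field k] [Ring A] [Algebra k A] [Ring B] [Algebra k B]
  [AddCommGroup M] [Module k M] [Module B M] [Module Aᵐᵒᵖ M] [SMulCommClass B Aᵐᵒᵖ M]
  [IsScalarTower k B M] [IsScalarTower k Aᵐᵒᵖ M] [Ring R] [Algebra k R]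
  (σ : B ⊗[k] Aᵐᵒᵖ ≃ₐ[k] R) {α : Tri A B M ⊗[k] (Tri A B M)ᵐᵒᵖ →ₐ[k] R}

/-- The ring `R` is an abstract copy of `B ⊗ Aᵐᵒᵖ`, so that the arguments serve both for bimodules
(`σ` the identity) and for right `A`-modules when `B = k` (`σ` the left unit isomorphism). -/
theorem left_smul_eq (hα : ∀ s t, α (s ⊗ₜ t) = σ (s.b ⊗ₜ op t.unop.a)) {X : ModuleCat.{u} R}
    (s : Tri A B M) (x : Restr α X) : s • x = σ (s.b ⊗ₜ 1) • x := by
  rw [Restr.left_smul_def, hα]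
  rfl

theorem right_smul_eq (hα : ∀ s t, α (s ⊗ₜ t) = σ (s.b ⊗ₜ op t.unop.a)) {X : ModuleCat.{u} R}
    (t : Tri A B M) (x : Restr α X) : op t • x = σ (1 ⊗ₜ op t.a) • x := by
  rw [Restr.right_smul_def, hα]
  rfl

/-- The coinduced module as a module of bilinear maps. -/
def coindToHom (V : Type u) [AddCommGroup V] [Module k V] :
    Restr α (ModuleCat.of R (Coind k R V)) →ₗ[k] (B →ₗ[k] A →ₗ[k] V) where
  toFun φ := (TensorProduct.curry ((show R →ₗ[k] V from φ) ∘ₗ σ.toLinearMap)).compl₂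
    (MulOpposite.opLinearEquiv k).toLinearMap
  map_add' _ _ := rfl
  map_smul' c φ := LinearMap.ext fun b => LinearMap.ext fun a => by
    change (show R →ₗ[k] V from φ) (σ (b ⊗ₜ op a) * algebraMap k R c) =
      c • (show R →ₗ[k] V from φ) (σ (b ⊗ₜ op a))
    rw [← Algebra.commutes, ← Algebra.smul_def, map_smul]

theorem coindToHom_apply (V : Type u) [AddCommGroup V] [Module k V]
    (φ : Restr α (ModuleCat.of R (Coind k R V))) (b : B) (a : A) :
    coindToHom σ V φ b a = Coind.eval (σ (b ⊗ₜ op a)) φ := rfl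

theorem coindToHom_bijective (V : Type u) [AddCommGroup V] [Module k V] :
    Function.Bijective (coindToHom σ V : Restr α (ModuleCat.of R (Coind k R V)) →ₗ[k] _) := by
  constructor
  · intro φ φ' h
    have e : (show R →ₗ[k] V from φ) ∘ₗ σ.toLinearMap = (show R →ₗ[k] V from φ') ∘ₗ σ.toLinearMap :=
      TensorProduct.ext' fun b a => LinearMap.congr_fun (LinearMap.congr_fun h b) a.unop
    refine LinearMap.ext fun s => ?_
    have := LinearMap.congr_fun e (σ.symm s)
    rwa [LinearMap.comp_apply, LinearMap.comp_apply, AlgEquiv.toLinearMap_apply,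
      AlgEquiv.apply_symm_apply] at this
  · intro g
    refine ⟨TensorProduct.lift (g.compl₂ (MulOpposite.opLinearEquiv k).symm.toLinearMap) ∘ₗ
      σ.symm.toLinearMap, LinearMap.ext fun b => LinearMap.ext fun a => ?_⟩
    change TensorProduct.lift (g.compl₂ (MulOpposite.opLinearEquiv k).symm.toLinearMap)
      (σ.symm (σ (b ⊗ₜ op a))) = g b a
    simp

theorem coindToHom_left_smul (hα : ∀ s t, α (s ⊗ₜ t) = σ (s.b ⊗ₜ op t.unop.a))
    (V : Type u) [AddCommGroup V] [Module k V] (t : Tri A B M)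
    (φ : Restr α (ModuleCat.of R (Coind k R V))) :
    coindToHom σ V (t • φ) = coindL k A B M V t (coindToHom σ V φ) := by
  ext b a
  rw [coindL_apply, coindToHom_apply, coindToHom_apply, left_smul_eq σ hα]
  refine (Coind.eval_smul _ _ _).trans ?_
  rw [← map_mul, Algebra.TensorProduct.tmul_mul_tmul, mul_one]

theorem coindToHom_right_smul (hα : ∀ s t, α (s ⊗ₜ t) = σ (s.b ⊗ₜ op t.unop.a))
    (V : Type u) [AddCommGroup V] [Module k V] (t : Tri A B M)
    (φ : Restr α (ModuleCat.of R (Coind k R V))) :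
    coindToHom σ V (op t • φ) = coindR k A B M V (coindToHom σ V φ) t := by
  ext b a
  rw [coindR_apply, coindToHom_apply, coindToHom_apply, right_smul_eq σ hα]
  refine (Coind.eval_smul _ _ _).trans ?_
  rw [← map_mul, Algebra.TensorProduct.tmul_mul_tmul, mul_one, ← MulOpposite.op_mul]

/-- The embedding of a module into a coinduced module. -/
def toCoind (X : ModuleCat.{u} R) : X ⟶ ModuleCat.of R (Coind k R (Restr α X)) :=
  ModuleCat.ofHom
    { toFun := fun x => (LinearMap.mk ⟨fun r : R => (r • x : X), fun r s => add_smul r s x⟩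
        (fun c r => by
          change (c • r) • x = algebraMap k R c • r • x
          rw [Algebra.smul_def, mul_smul]) : R →ₗ[k] Restr α X)
      map_add' := fun x y => LinearMap.ext fun r => smul_add r x y
      map_smul' := fun s x => LinearMap.ext fun r => (mul_smul r s x).symm }

theorem mono_toCoind (X : ModuleCat.{u} R) : Mono (toCoind (α := α) X) := by
  refine (ModuleCat.mono_iff_injective _).2 fun x y h => ?_
  have := LinearMap.congr_fun (show (show R →ₗ[k] Restr α X from _) = _ from h) 1
  exact (one_smul R x).symm.trans (this.trans (one_smul R y))

theorem exists_d_eq_coind (hα : ∀ s t, α (s ⊗ₜ t) = σ (s.b ⊗ₜ op t.unop.a))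
    (V : Type u) [AddCommGroup V] [Module k V] {n : ℕ}
    (c : Cochain k (Tri A B M) (Restr α (ModuleCat.of R (Coind k R V))) (n + 2))
    (hc : d k (Tri A B M) _ (n + 2) c = 0) : ∃ w, d k (Tri A B M) _ (n + 1) w = c := by
  have hd : ∀ (m : ℕ) (c : Cochain k (Tri A B M) (Restr α (ModuleCat.of R (Coind k R V))) m),
      differential (coindL k A B M V) (coindR k A B M V) m ((coindToHom σ V).compMultilinearMap c) =
        (coindToHom σ V).compMultilinearMap (d k (Tri A B M) _ m c) := fun m c =>
    differential_comp (l := actL k (Tri A B M) (Restr α (ModuleCat.of R (Coind k R V))))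
      (r := actR k (Tri A B M) (Restr α (ModuleCat.of R (Coind k R V)))) (coindToHom σ V)
      (fun x v => (coindToHom_left_smul σ hα V x v).symm)
      (fun v x => (coindToHom_right_smul σ hα V x v).symm) c
  obtain ⟨w, hw⟩ := exists_differential_eq_coind ((coindToHom σ V).compMultilinearMap c) (by
    rw [hd, hc]
    ext1 t
    exact map_zero (coindToHom σ V))
  obtain ⟨w, rfl⟩ := exists_compMultilinearMap_eq (coindToHom (α := α) σ V) w
    fun t => (coindToHom_bijective (α := α) σ V).2 _
  refine ⟨w, MultilinearMap.ext fun t => (coindToHom_bijective (α := α) σ V).1 ?_⟩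
  rw [hd] at hw
  exact congrArg (fun F => F t) hw

/-- The value of a `1`-cochain as a linear map. -/
def toLinear {X : Type u} [AddCommGroup X] [Module k X] (c : Cochain k (Tri A B M) X 1) :
    Tri A B M →ₗ[k] X := (MultilinearMap.ofSubsingleton k (Tri A B M) X (0 : Fin 1)).symm c

section Cocycle

variable {X : ModuleCat.{u} R} {c : Cochain k (Tri A B M) (Restr α X) 1}

theorem toLinear_mul (hα : ∀ s t, α (s ⊗ₜ t) = σ (s.b ⊗ₜ op t.unop.a))
    (hc : d k (Tri A B M) _ 1 c = 0) (s t : Tri A B M) :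
    toLinear c (s * t) = σ (s.b ⊗ₜ 1) • toLinear c t + σ (1 ⊗ₜ op t.a) • toLinear c s := by
  rw [← left_smul_eq σ hα, ← right_smul_eq σ hα]
  exact map_mul_of_cocycle hc s t

/-- The idempotent `(1, 0, 0)` acts as zero on the left and `(0, 0, 1)` as zero on the right.
Writing `a = (1, 0, 0) a` and `b = b (0, 0, 1)`, the derivation rule shows that a cocycle vanishing
on `(1, 0, 0)` vanishes on `A` and on `B`. -/
theorem toLinear_eq_of_apply_eq_zero (hα : ∀ s t, α (s ⊗ₜ t) = σ (s.b ⊗ₜ op t.unop.a))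
    (hc : d k (Tri A B M) _ 1 c = 0) (he : toLinear c ⟨1, 0, 0⟩ = 0) (t : Tri A B M) :
    toLinear c t = toLinear c ⟨0, t.m, 0⟩ := by
  have h1 : toLinear c 1 = 0 := by
    have := toLinear_mul σ hα hc 1 1
    rw [mul_one, one_b, one_a, MulOpposite.op_one, ← Algebra.TensorProduct.one_def, map_one σ,
      one_smul] at this
    exact left_eq_add.1 this
  have he' : toLinear c ⟨0, 0, 1⟩ = 0 := by
    have : (⟨0, 0, 1⟩ : Tri A B M) = 1 - ⟨1, 0, 0⟩ := eq_sub_of_add_eq (by ext <;> simp)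
    rw [this, map_sub, h1, he, sub_zero]
  have hA : ∀ a, toLinear c ⟨a, 0, 0⟩ = 0 := fun a => by
    have : (⟨a, 0, 0⟩ : Tri A B M) = ⟨1, 0, 0⟩ * ⟨a, 0, 0⟩ := by ext <;> simp
    rw [this, toLinear_mul σ hα hc, he, TensorProduct.zero_tmul, map_zero, zero_smul, smul_zero,
      add_zero]
  have hB : ∀ b, toLinear c ⟨0, 0, b⟩ = 0 := fun b => by
    have : (⟨0, 0, b⟩ : Tri A B M) = ⟨0, 0, b⟩ * ⟨0, 0, 1⟩ := by ext <;> simp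
    rw [this, toLinear_mul σ hα hc, he', MulOpposite.op_zero, TensorProduct.tmul_zero, map_zero,
      zero_smul, smul_zero, add_zero]
  have : t = ⟨t.a, 0, 0⟩ + ⟨0, t.m, 0⟩ + ⟨0, 0, t.b⟩ := by ext <;> simp
  conv_lhs => rw [this]
  rw [map_add, map_add, hA, hB, zero_add, add_zero]

theorem toLinear_smul_of_apply_eq_zero (hα : ∀ s t, α (s ⊗ₜ t) = σ (s.b ⊗ₜ op t.unop.a))
    (hc : d k (Tri A B M) _ 1 c = 0) (he : toLinear c ⟨1, 0, 0⟩ = 0) (b : B) (a : A) (m : M) :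
    toLinear c ⟨0, b • op a • m, 0⟩ = σ (b ⊗ₜ op a) • toLinear c ⟨0, m, 0⟩ := by
  have h : (⟨0, b • op a • m, 0⟩ : Tri A B M) = ⟨0, 0, b⟩ * (⟨0, m, 0⟩ * ⟨a, 0, 0⟩) := by
    ext <;> simp
  have hA := toLinear_eq_of_apply_eq_zero σ hα hc he ⟨a, 0, 0⟩
  have hB := toLinear_eq_of_apply_eq_zero σ hα hc he ⟨0, 0, b⟩
  have h0 : toLinear c ⟨0, 0, 0⟩ = 0 := map_zero (toLinear c)
  rw [h, toLinear_mul σ hα hc, toLinear_mul σ hα hc, hA, hB, h0, smul_zero, smul_zero, zero_add,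
    add_zero, ← mul_smul, ← map_mul, Algebra.TensorProduct.tmul_mul_tmul, mul_one, one_mul]

end Cocycle

variable {M0 : ModuleCat.{u} R} (ε : M ≃ₗ[k] Restr α M0)

/-- The projection to `M` is a universal `1`-cocycle. -/
theorem isUniversal (hα : ∀ s t, α (s ⊗ₜ t) = σ (s.b ⊗ₜ op t.unop.a))
    (hε : ∀ (b : B) (a : A) (m : M), ε (b • op a • m) = σ (b ⊗ₜ op a) • ε m) :
    IsUniversal α (ofLinear (ε.toLinearMap ∘ₗ projM k A B M)) where
  cocycle := by
    ext t
    obtain ⟨x, y, rfl⟩ : ∃ x y, t = Fin.cons x fun _ => y :=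
      ⟨t 0, t 1, funext fun i => by fin_cases i <;> rfl⟩
    refine (differential_one_apply _ _ _ x y).trans ?_
    change x • ε y.m - ε (op y.a • x.m + x.b • y.m) + op y • ε x.m = 0
    have h1 := hε 1 y.a x.m
    have h2 := hε x.b 1 y.m
    rw [one_smul] at h1
    rw [MulOpposite.op_one, one_smul] at h2
    rw [map_add, h1, h2, left_smul_eq σ hα, right_smul_eq σ hα]
    abel
  exists_hom X c hc := by
    -- With `e = (1, 0, 0)`, the coboundary of `x = c(e)` takes the value `e x - x e = -x` at `e`,
    -- so adding it normalises the cocycle to vanish there.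
    let x : Cochain k (Tri A B M) (Restr α X) 0 :=
      MultilinearMap.constOfIsEmpty k _ (toLinear c ⟨1, 0, 0⟩)
    let c' := c + d k (Tri A B M) _ 0 x
    have hc' : d k (Tri A B M) _ 1 c' = 0 := by rw [map_add, hc, d_d, add_zero]
    have he : toLinear c' ⟨1, 0, 0⟩ = 0 := by
      have h := toLinear_mul σ hα hc ⟨1, 0, 0⟩ ⟨1, 0, 0⟩
      change toLinear c ⟨1, 0, 0⟩ + d k (Tri A B M) _ 0 x (fun _ => ⟨1, 0, 0⟩) = 0
      rw [d_eq_differential, differential_zero_apply]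
      change _ + ((⟨1, 0, 0⟩ : Tri A B M) • toLinear c ⟨1, 0, 0⟩ -
        op (⟨1, 0, 0⟩ : Tri A B M) • toLinear c ⟨1, 0, 0⟩) = 0
      rw [left_smul_eq σ hα, right_smul_eq σ hα, TensorProduct.zero_tmul, map_zero, zero_smul,
        MulOpposite.op_one, ← Algebra.TensorProduct.one_def, map_one, one_smul, zero_sub,
        add_neg_cancel]
    have hadd : ∀ m m', toLinear c' ⟨0, m + m', 0⟩ = toLinear c' ⟨0, m, 0⟩ + toLinear c' ⟨0, m', 0⟩ :=
      fun m m' => (congrArg _ (by ext <;> simp)).trans (map_add (toLinear c') _ _)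
    have hs : ∀ (z : B ⊗[k] Aᵐᵒᵖ) (y : Restr α M0), toLinear c' ⟨0, ε.symm (σ z • y), 0⟩ =
        σ z • toLinear c' ⟨0, ε.symm y, 0⟩ := fun z y => by
      induction z with
      | zero => rw [map_zero, zero_smul, zero_smul, map_zero]; exact map_zero _
      | tmul b a =>
        obtain ⟨a, rfl⟩ := MulOpposite.op_surjective a
        rw [← toLinear_smul_of_apply_eq_zero σ hα hc' he b a]
        congr
        rw [LinearEquiv.symm_apply_eq, hε, LinearEquiv.apply_symm_apply]
      | add z z' h h' => rw [map_add, add_smul, map_add, hadd, h, h', add_smul]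
    refine ⟨ModuleCat.ofHom (X := M0) (Y := X)
      { toFun := fun y => toLinear c' ⟨0, ε.symm y, 0⟩
        map_add' := fun y y' =>
          (congrArg (fun m => toLinear c' ⟨0, m, 0⟩) (map_add ε.symm _ _)).trans (hadd _ _)
        map_smul' := fun r y => by
          have := hs (σ.symm r) y
          rwa [AlgEquiv.apply_symm_apply] at this }, -x, ?_⟩
    rw [map_neg, ← sub_eq_add_neg, eq_sub_iff_add_eq]
    refine MultilinearMap.ext fun t => ?_
    rw [eq_const_zero t]
    refine (toLinear_eq_of_apply_eq_zero σ hα hc' he (t 0)).trans ?_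
    change _ = toLinear c' ⟨0, ε.symm (ε (t 0).m), 0⟩
    rw [LinearEquiv.symm_apply_apply]
  hom_eq_zero X h x hx := by
    ext y
    have := congrArg (fun F => F fun _ => (⟨0, ε.symm y, 0⟩ : Tri A B M)) hx
    refine Eq.trans ?_ (this.trans ?_)
    · exact (congrArg h.hom (LinearEquiv.apply_symm_apply ε y)).symm
    -- Inner derivations vanish on `M`, because `M` acts as zero on both sides.
    · refine (differential_zero_apply _ _ _ _).trans ?_
      change (⟨0, ε.symm y, 0⟩ : Tri A B M) • x Fin.elim0 -
        op (⟨0, ε.symm y, 0⟩ : Tri A B M) • x Fin.elim0 = 0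
      rw [left_smul_eq σ hα, right_smul_eq σ hα, TensorProduct.zero_tmul, MulOpposite.op_zero,
        TensorProduct.tmul_zero, sub_self]
  effaceable X := ⟨_, toCoind (α := α) X, mono_toCoind X, fun _ c hc => exists_d_eq_coind (α := α) σ hα _ c hc⟩

end Universal
end Tri

/-! ### Cup products and representatives of cohomology classes. -/

namespace Hochschild

theorem cup_apply {k Λ X Y Z : Type*} [Field k] [Ring Λ] [Algebra k Λ] [AddCommGroup X]
    [Module k X] [AddCommGroup Y] [Module k Y] [AddCommGroup Z] [Module k Z]
    (μ : X →ₗ[k] Y →ₗ[k] Z) {n m N : ℕ} (h : n + m = N) (f : Cochain k Λ X n)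
    (g : Cochain k Λ Y m) (t : Fin N → Λ) :
    cup μ h f g t = μ (f fun i => t (Fin.cast h (Fin.castAdd m i)))
      (g fun i => t (Fin.cast h (Fin.natAdd n i))) := rfl

section Represents

variable {k Λ X : Type u} [Field k] [Ring Λ] [Algebra k Λ] [AddCommGroup X] [Module k X]
  [Module Λ X] [Module Λᵐᵒᵖ X] [IsScalarTower k Λ X] [IsScalarTower k Λᵐᵒᵖ X] {n : ℕ}

theorem exists_represents (x : HH k Λ X n) : ∃ c, d k Λ X n c = 0 ∧ Represents c x := by
  obtain ⟨⟨c, hc⟩, rfl⟩ := Submodule.Quotient.mk_surjective _ x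
  exact ⟨c, hc, hc, rfl⟩

theorem exists_represents_of_d_eq_zero {c : Cochain k Λ X n} (hc : d k Λ X n c = 0) :
    ∃ x : HH k Λ X n, Represents c x := ⟨_, hc, rfl⟩

theorem Represents.d_eq_zero {c : Cochain k Λ X n} {x : HH k Λ X n} (h : Represents c x) :
    d k Λ X n c = 0 := h.1

theorem Represents.eq_iff {c c' : Cochain k Λ X n} {x x' : HH k Λ X n} (h : Represents c x)
    (h' : Represents c' x') : x = x' ↔ c - c' ∈ coboundaries k Λ X n := by
  obtain ⟨hc, rfl⟩ := h
  obtain ⟨hc', rfl⟩ := h'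
  exact mk_eq_mk_iff _ _

theorem represents_zero : Represents (0 : Cochain k Λ X n) (0 : HH k Λ X n) :=
  ⟨Submodule.zero_mem _, rfl⟩

theorem Represents.add {c c' : Cochain k Λ X n} {x x' : HH k Λ X n} (h : Represents c x)
    (h' : Represents c' x') : Represents (c + c') (x + x') := by
  obtain ⟨hc, rfl⟩ := h
  obtain ⟨hc', rfl⟩ := h'
  exact ⟨Submodule.add_mem _ hc hc', rfl⟩

theorem Represents.eq_zero_iff {c : Cochain k Λ X n} {x : HH k Λ X n} (h : Represents c x) :
    x = 0 ↔ c ∈ coboundaries k Λ X n := by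
  rw [h.eq_iff represents_zero, sub_zero]

theorem Represents.eq {c : Cochain k Λ X n} {x x' : HH k Λ X n} (h : Represents c x)
    (h' : Represents c x') : x = x' := by
  rw [h.eq_iff h', sub_self]
  exact Submodule.zero_mem _

variable {Λ' X' : Type u} [Ring Λ'] [Algebra k Λ'] [AddCommGroup X'] [Module k X']
  [Module Λ' X'] [Module Λ'ᵐᵒᵖ X'] [IsScalarTower k Λ' X'] [IsScalarTower k Λ'ᵐᵒᵖ X'] {m : ℕ}

/-- The map on cohomology induced by a map of cochains. -/
def HH.map (φ : Cochain k Λ X n →ₗ[k] Cochain k Λ' X' m)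
    (h : ∀ c, d k Λ X n c = 0 → d k Λ' X' m (φ c) = 0)
    (h' : ∀ c ∈ coboundaries k Λ X n, φ c ∈ coboundaries k Λ' X' m) :
    HH k Λ X n →ₗ[k] HH k Λ' X' m :=
  Submodule.mapQ _ _ (φ.restrict (p := cocycles k Λ X n) (q := cocycles k Λ' X' m) h)
    fun c hc => h' c.1 hc

theorem Represents.map {φ : Cochain k Λ X n →ₗ[k] Cochain k Λ' X' m}
    {h : ∀ c, d k Λ X n c = 0 → d k Λ' X' m (φ c) = 0}
    {h' : ∀ c ∈ coboundaries k Λ X n, φ c ∈ coboundaries k Λ' X' m}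
    {c : Cochain k Λ X n} {x : HH k Λ X n} (hx : Represents c x) :
    Represents (φ c) (HH.map φ h h' x) := by
  obtain ⟨hc, rfl⟩ := hx
  exact ⟨h c hc, rfl⟩

end Represents

end Hochschild

/-! ### Restriction, extension by zero and cup product with `1_M`. -/

namespace Tri

open Hochschild

section Cochain

variable (k A B M : Type u) [Field k] [Ring A] [Algebra k A] [Ring B] [Algebra k B]
  [AddCommGroup M] [Module k M] [Module B M] [Module Aᵐᵒᵖ M] [SMulCommClass B Aᵐᵒᵖ M]
  [IsScalarTower k B M] [IsScalarTower k Aᵐᵒᵖ M]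

/-- The left action of the triangular algebra on `A`. -/
def leftA : Tri A B M →ₗ[k] A →ₗ[k] A := LinearMap.mul k A ∘ₗ (projA k A B M).toLinearMap

/-- The right action of the triangular algebra on `A`. -/
def rightA : A →ₗ[k] Tri A B M →ₗ[k] A := (LinearMap.mul k A).compl₂ (projA k A B M).toLinearMap

/-- The left action of the triangular algebra on `B`. -/
def leftB : Tri A B M →ₗ[k] B →ₗ[k] B := LinearMap.mul k B ∘ₗ (projB k A B M).toLinearMap

/-- The right action of the triangular algebra on `B`. -/
def rightB : B →ₗ[k] Tri A B M →ₗ[k] B := (LinearMap.mul k B).compl₂ (projB k A B M).toLinearMap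

@[simp] theorem leftA_apply (t : Tri A B M) (a : A) : leftA k A B M t a = t.a * a := rfl
@[simp] theorem rightA_apply (t : Tri A B M) (a : A) : rightA k A B M a t = a * t.a := rfl
@[simp] theorem leftB_apply (t : Tri A B M) (b : B) : leftB k A B M t b = t.b * b := rfl
@[simp] theorem rightB_apply (t : Tri A B M) (b : B) : rightB k A B M b t = b * t.b := rfl

variable {k A B M} {n : ℕ}

theorem isBimodA : IsBimod (leftA k A B M) (rightA k A B M) :=
  ⟨fun _ _ _ => by simp [mul_assoc], fun _ _ _ => by simp [mul_assoc],
    fun _ _ _ => by simp [mul_assoc]⟩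

theorem isBimodB : IsBimod (leftB k A B M) (rightB k A B M) :=
  ⟨fun _ _ _ => by simp [mul_assoc], fun _ _ _ => by simp [mul_assoc],
    fun _ _ _ => by simp [mul_assoc]⟩

theorem differential_projA (F : Cochain k (Tri A B M) (Tri A B M) n) :
    differential (leftA k A B M) (rightA k A B M) n
      ((projA k A B M).toLinearMap.compMultilinearMap F) =
        (projA k A B M).toLinearMap.compMultilinearMap (d k _ _ n F) :=
  differential_comp (l := actL k (Tri A B M) (Tri A B M)) (r := actR k (Tri A B M) (Tri A B M)) _
    (fun _ _ => rfl) (fun _ _ => rfl) F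

theorem differential_projB (F : Cochain k (Tri A B M) (Tri A B M) n) :
    differential (leftB k A B M) (rightB k A B M) n
      ((projB k A B M).toLinearMap.compMultilinearMap F) =
        (projB k A B M).toLinearMap.compMultilinearMap (d k _ _ n F) :=
  differential_comp (l := actL k (Tri A B M) (Tri A B M)) (r := actR k (Tri A B M) (Tri A B M)) _
    (fun _ _ => rfl) (fun _ _ => rfl) F

theorem differential_comp_projA (f : Cochain k A A n) :
    differential (leftA k A B M) (rightA k A B M) n
      (f.compLinearMap fun _ => (projA k A B M).toLinearMap) =
        (d k A A n f).compLinearMap fun _ => (projA k A B M).toLinearMap :=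
  differential_compLinearMap (l := actL k A A) (r := actR k A A) _ (fun _ _ => rfl)
    (fun _ => rfl) (fun _ _ => rfl) f

theorem differential_comp_projB (g : Cochain k B B n) :
    differential (leftB k A B M) (rightB k A B M) n
      (g.compLinearMap fun _ => (projB k A B M).toLinearMap) =
        (d k B B n g).compLinearMap fun _ => (projB k A B M).toLinearMap :=
  differential_compLinearMap (l := actL k B B) (r := actR k B B) _ (fun _ _ => rfl)
    (fun _ => rfl) (fun _ _ => rfl) g

theorem d_comp_inclA (c : Cochain k (Tri A B M) A n) :
    d k A A n (c.compLinearMap fun _ => inclA k A B M) =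
      (differential (leftA k A B M) (rightA k A B M) n c).compLinearMap fun _ => inclA k A B M :=
  differential_compLinearMap _ (fun _ _ => by ext <;> simp) (fun _ => rfl) (fun _ _ => rfl) c

theorem d_comp_inclB (c : Cochain k (Tri A B M) B n) :
    d k B B n (c.compLinearMap fun _ => inclB k A B M) =
      (differential (leftB k A B M) (rightB k A B M) n c).compLinearMap fun _ => inclB k A B M :=
  differential_compLinearMap _ (fun _ _ => by ext <;> simp) (fun _ => rfl) (fun _ _ => rfl) c

theorem restrictA_d (F : Cochain k (Tri A B M) (Tri A B M) n) :
    restrictA k A B M (d k _ _ n F) = d k A A n (restrictA k A B M F) := by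
  refine Eq.trans ?_ (d_comp_inclA ((projA k A B M).toLinearMap.compMultilinearMap F)).symm
  rw [differential_projA]
  rfl

theorem restrictB_d (F : Cochain k (Tri A B M) (Tri A B M) n) :
    restrictB k A B M (d k _ _ n F) = d k B B n (restrictB k A B M F) := by
  refine Eq.trans ?_ (d_comp_inclB ((projB k A B M).toLinearMap.compMultilinearMap F)).symm
  rw [differential_projB]
  rfl

/-- The inclusion of `A` respects right multiplication by `T` but not left multiplication, since `M
· A` lies in `M`. Thus only the first term of the differential contributes an error. -/
theorem d_extendA_apply (f : Cochain k A A n) (t : Fin (n + 1) → Tri A B M) :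
    d k _ _ n (extendA k A B M f) t = extendA k A B M (d k A A n f) t +
      inclM k A B M (op (f fun i => (t i.succ).a) • (t 0).m) := by
  refine (differential_comp_apply (l := leftA k A B M) (r := rightA k A B M) _ _ t).trans ?_
  rw [differential_comp_projA]
  have h1 : actR k (Tri A B M) (Tri A B M)
      (inclA k A B M (f.compLinearMap (fun _ => (projA k A B M).toLinearMap) (Fin.init t)))
        (t (Fin.last n)) =
      inclA k A B M (rightA k A B M
        (f.compLinearMap (fun _ => (projA k A B M).toLinearMap) (Fin.init t)) (t (Fin.last n))) := by
    change (⟨_, 0, 0⟩ : Tri A B M) * _ = _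
    ext <;> simp
  have h2 : actL k (Tri A B M) (Tri A B M) (t 0)
      (inclA k A B M (f.compLinearMap (fun _ => (projA k A B M).toLinearMap) (Fin.tail t))) =
      inclA k A B M (leftA k A B M (t 0)
        (f.compLinearMap (fun _ => (projA k A B M).toLinearMap) (Fin.tail t))) +
      inclM k A B M (op (f fun i => (t i.succ).a) • (t 0).m) := by
    change _ * (⟨_, 0, 0⟩ : Tri A B M) = _
    ext <;> simp <;> rfl
  rw [h1, h2, sub_self, smul_zero, add_zero, add_sub_cancel_left]
  rfl

/-- Here right multiplication produces the error, so it carries the sign of the last term of the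
differential. This is the origin of the sign in the connecting map. -/
theorem d_extendB_apply (g : Cochain k B B n) (t : Fin (n + 1) → Tri A B M) :
    d k _ _ n (extendB k A B M g) t = extendB k A B M (d k B B n g) t +
      inclM k A B M ((-1 : k) ^ (n + 1) • (g fun i => (t i.castSucc).b) • (t (Fin.last n)).m) := by
  refine (differential_comp_apply (l := leftB k A B M) (r := rightB k A B M) _ _ t).trans ?_
  rw [differential_comp_projB]
  have h1 : actR k (Tri A B M) (Tri A B M)
      (inclB k A B M (g.compLinearMap (fun _ => (projB k A B M).toLinearMap) (Fin.init t)))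
        (t (Fin.last n)) =
      inclB k A B M (rightB k A B M
        (g.compLinearMap (fun _ => (projB k A B M).toLinearMap) (Fin.init t)) (t (Fin.last n))) +
      inclM k A B M ((g fun i => (t i.castSucc).b) • (t (Fin.last n)).m) := by
    change (⟨0, 0, _⟩ : Tri A B M) * _ = _
    ext <;> simp <;> rfl
  have h2 : actL k (Tri A B M) (Tri A B M) (t 0)
      (inclB k A B M (g.compLinearMap (fun _ => (projB k A B M).toLinearMap) (Fin.tail t))) =
      inclB k A B M (leftB k A B M (t 0)
        (g.compLinearMap (fun _ => (projB k A B M).toLinearMap) (Fin.tail t))) := by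
    change _ * (⟨0, 0, _⟩ : Tri A B M) = _
    ext <;> simp
  rw [h1, h2, sub_self, add_zero, add_sub_cancel_left, map_smul (inclM k A B M)]
  rfl

/-- The primitive is composed with the inclusion of `A` in `T`. The component of its differential in
`M` is not controlled, and need not be. -/
theorem exists_coboundary_projA (c : Cochain k (Tri A B M) A n)
    (hc : c ∈ boundaries (leftA k A B M) (rightA k A B M) n) :
    ∃ b ∈ coboundaries k (Tri A B M) (Tri A B M) n,
      (projA k A B M).toLinearMap.compMultilinearMap b = c ∧
      (projB k A B M).toLinearMap.compMultilinearMap b = 0 := by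
  cases n with
  | zero =>
    obtain rfl := (Submodule.mem_bot k).1 hc
    exact ⟨0, Submodule.zero_mem _, rfl, rfl⟩
  | succ n =>
    obtain ⟨p, rfl⟩ := hc
    refine ⟨_, ⟨(inclA k A B M).compMultilinearMap p, rfl⟩, ?_, ?_⟩
    · rw [← differential_projA]
      rfl
    · rw [← differential_projB]
      exact map_zero (differential (leftB k A B M) (rightB k A B M) n)

theorem exists_coboundary_projB (c : Cochain k (Tri A B M) B n)
    (hc : c ∈ boundaries (leftB k A B M) (rightB k A B M) n) :
    ∃ b ∈ coboundaries k (Tri A B M) (Tri A B M) n,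
      (projA k A B M).toLinearMap.compMultilinearMap b = 0 ∧
      (projB k A B M).toLinearMap.compMultilinearMap b = c := by
  cases n with
  | zero =>
    obtain rfl := (Submodule.mem_bot k).1 hc
    exact ⟨0, Submodule.zero_mem _, rfl, rfl⟩
  | succ n =>
    obtain ⟨p, rfl⟩ := hc
    refine ⟨_, ⟨(inclB k A B M).compMultilinearMap p, rfl⟩, ?_, ?_⟩
    · rw [← differential_projA]
      exact map_zero (differential (leftA k A B M) (rightA k A B M) n)
    · rw [← differential_projB]
      rfl

theorem exists_eq_of_projA_eq_zero (F : Cochain k (Tri A B M) (Tri A B M) n)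
    (hA : (projA k A B M).toLinearMap.compMultilinearMap F = 0)
    (hB : (projB k A B M).toLinearMap.compMultilinearMap F = 0) :
    ∃ w : Cochain k (Tri A B M) M n, F = (inclM k A B M).compMultilinearMap w := by
  refine ⟨(projM k A B M).compMultilinearMap F, MultilinearMap.ext fun t => ?_⟩
  ext
  · exact congrArg (fun c => c t) hA
  · rfl
  · exact congrArg (fun c => c t) hB

/-- A cochain whose differential has values in `M` is, up to a coboundary and a cochain with values
in `M`, extended from its restrictions to the two diagonal algebras. -/
theorem exists_eq_extend_add (F : Cochain k (Tri A B M) (Tri A B M) n)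
    (hA : (projA k A B M).toLinearMap.compMultilinearMap (d k _ _ n F) = 0)
    (hB : (projB k A B M).toLinearMap.compMultilinearMap (d k _ _ n F) = 0) :
    ∃ w : Cochain k (Tri A B M) M n, ∃ b ∈ coboundaries k (Tri A B M) (Tri A B M) n,
      F = extendA k A B M (restrictA k A B M F) + extendB k A B M (restrictB k A B M F) +
        (inclM k A B M).compMultilinearMap w + b := by
  have hA' : restrictA k A B M (d k _ _ n F) = 0 :=
    congrArg (fun c => c.compLinearMap fun _ => inclA k A B M) hA
  have hB' : restrictB k A B M (d k _ _ n F) = 0 :=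
    congrArg (fun c => c.compLinearMap fun _ => inclB k A B M) hB
  rw [← differential_projA] at hA
  rw [← differential_projB] at hB
  obtain ⟨b, hb, hbA, hbB⟩ := exists_coboundary_projA
    ((projA k A B M).toLinearMap.compMultilinearMap F -
      (restrictA k A B M F).compLinearMap fun _ => (projA k A B M).toLinearMap)
    -- The `A`-component of `F` and the pullback of its restriction agree on the corner `A`, and
    -- their difference is a cocycle.
    (mem_boundaries_of_idempotent_left (⟨1, 0, 0⟩ : Tri A B M) (by ext <;> simp)
      (fun x => by ext <;> simp) isBimodA (fun x v => by simp) _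
      (by
        rw [map_sub, hA, differential_comp_projA, ← restrictA_d, hA', sub_eq_zero]
        rfl)
      (fun t => by simp)
      (fun t => by
        have h : (fun i => (⟨1, 0, 0⟩ : Tri A B M) * t i) = fun i => ⟨(t i).a, 0, 0⟩ := by
          funext i; ext <;> simp
        rw [h]
        exact sub_self _))
  obtain ⟨b', hb', hbA', hbB'⟩ := exists_coboundary_projB
    ((projB k A B M).toLinearMap.compMultilinearMap F -
      (restrictB k A B M F).compLinearMap fun _ => (projB k A B M).toLinearMap)
    (mem_boundaries_of_idempotent_right (⟨0, 0, 1⟩ : Tri A B M) (by ext <;> simp)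
      (fun x => by ext <;> simp) isBimodB (fun x v => by simp) _
      (by
        rw [map_sub, hB, differential_comp_projB, ← restrictB_d, hB', sub_eq_zero]
        rfl)
      (fun t => by simp)
      (fun t => by
        have h : (fun i => t i * (⟨0, 0, 1⟩ : Tri A B M)) = fun i => ⟨0, 0, (t i).b⟩ := by
          funext i; ext <;> simp
        rw [h]
        exact sub_self _))
  obtain ⟨w, hw⟩ := exists_eq_of_projA_eq_zero
    (F - (extendA k A B M (restrictA k A B M F) + extendB k A B M (restrictB k A B M F)) - (b + b'))
    (MultilinearMap.ext fun t => by
      have h1 := congrArg (fun c => c t) hbA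
      have h2 := congrArg (fun c => c t) hbA'
      change (b t).a = (F t).a - (restrictA k A B M F) (fun i => (t i).a) at h1
      change (b' t).a = 0 at h2
      change (F t).a - ((restrictA k A B M F) (fun i => (t i).a) + 0) - ((b t).a + (b' t).a) = 0
      rw [h1, h2]
      abel)
    (MultilinearMap.ext fun t => by
      have h1 := congrArg (fun c => c t) hbB
      have h2 := congrArg (fun c => c t) hbB'
      change (b t).b = 0 at h1
      change (b' t).b = (F t).b - (restrictB k A B M F) (fun i => (t i).b) at h2
      change (F t).b - (0 + (restrictB k A B M F) (fun i => (t i).b)) - ((b t).b + (b' t).b) = 0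
      rw [h1, h2]
      abel)
  refine ⟨w, b + b', Submodule.add_mem _ hb hb', ?_⟩
  rw [← hw]
  abel

end Cochain

section Coefficients

variable {k A B M X : Type u} [Field k] [Ring A] [Algebra k A] [Ring B] [Algebra k B]
  [AddCommGroup M] [Module k M] [Module B M] [Module Aᵐᵒᵖ M] [SMulCommClass B Aᵐᵒᵖ M]
  [IsScalarTower k B M] [IsScalarTower k Aᵐᵒᵖ M]
  [AddCommGroup X] [Module k X] [Module (Tri A B M) X] [Module (Tri A B M)ᵐᵒᵖ X]
  [IsScalarTower k (Tri A B M) X] [IsScalarTower k (Tri A B M)ᵐᵒᵖ X]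

variable (A B) in
/-- The `T`-bimodule `X` is a copy of the ideal `M`. -/
structure IsIdealEquiv (ψ : M ≃ₗ[k] X) : Prop where
  left_smul : ∀ (t : Tri A B M) (m : M), ψ (t.b • m) = t • ψ m
  right_smul : ∀ (t : Tri A B M) (m : M), ψ (op t.a • m) = op t • ψ m

variable (ψ : M ≃ₗ[k] X) {n : ℕ}

variable (A B) in
/-- Inclusion of the ideal, on cochains. -/
def inclCochain (n : ℕ) : Cochain k (Tri A B M) X n →ₗ[k] Cochain k (Tri A B M) (Tri A B M) n where
  toFun := (inclM k A B M ∘ₗ ψ.symm.toLinearMap).compMultilinearMap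
  map_add' _ _ := MultilinearMap.ext fun _ =>
    map_add (inclM k A B M ∘ₗ ψ.symm.toLinearMap) _ _
  map_smul' a _ := MultilinearMap.ext fun _ =>
    map_smul (inclM k A B M ∘ₗ ψ.symm.toLinearMap) a _

theorem inclCochain_apply (c : Cochain k (Tri A B M) X n) (t : Fin n → Tri A B M) :
    inclCochain A B ψ n c t = inclM k A B M (ψ.symm (c t)) := rfl

theorem inclCochain_injective : Function.Injective (inclCochain A B ψ n) := fun _ _ h =>
  MultilinearMap.ext fun t => ψ.symm.injective (congrArg (fun F => (F t).m) h)

theorem exists_inclCochain_eq (w : Cochain k (Tri A B M) M n) :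
    ∃ c, inclCochain A B ψ n c = (inclM k A B M).compMultilinearMap w :=
  ⟨ψ.toLinearMap.compMultilinearMap w, MultilinearMap.ext fun t =>
    congrArg (inclM k A B M) (ψ.symm_apply_apply (w t))⟩

theorem projA_inclCochain (c : Cochain k (Tri A B M) X n) :
    (projA k A B M).toLinearMap.compMultilinearMap (inclCochain A B ψ n c) = 0 := rfl

theorem projB_inclCochain (c : Cochain k (Tri A B M) X n) :
    (projB k A B M).toLinearMap.compMultilinearMap (inclCochain A B ψ n c) = 0 := rfl

variable (B) in
/-- Cup product of a cochain of `A` with the class of the projection to `M`. -/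
def cupA (n : ℕ) : Cochain k A A n →ₗ[k] Cochain k (Tri A B M) X (n + 1) where
  toFun f := cup (actR k (Tri A B M) X) (Nat.add_comm 1 n) (ofLinear (ψ.toLinearMap ∘ₗ projM k A B M))
    (extendA k A B M f)
  map_add' f f' := MultilinearMap.ext fun t => by
    rw [add_apply, cup_apply, cup_apply, cup_apply, ← map_add]
    congr 1
    exact map_add (inclA k A B M) _ _
  map_smul' a f := MultilinearMap.ext fun t => by
    rw [smul_apply, cup_apply, cup_apply, RingHom.id_apply, ← map_smul]
    congr 1
    exact map_smul (inclA k A B M) _ _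

variable (A) in
/-- Signed cup product of a cochain of `B` with the class of the projection to `M`. -/
def cupB (n : ℕ) : Cochain k B B n →ₗ[k] Cochain k (Tri A B M) X (n + 1) where
  toFun g := (-1 : k) ^ (n + 1) • cup (actL k (Tri A B M) X) rfl (extendB k A B M g)
    (ofLinear (ψ.toLinearMap ∘ₗ projM k A B M))
  map_add' g g' := MultilinearMap.ext fun t => by
    rw [add_apply, smul_apply, smul_apply, smul_apply, cup_apply, cup_apply, cup_apply, ← smul_add,
      ← LinearMap.add_apply, ← map_add]
    congr 3
    exact map_add (inclB k A B M) _ _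
  map_smul' a g := MultilinearMap.ext fun t => by
    have e : ∀ t, extendB k A B M (a • g) t = a • extendB k A B M g t :=
      fun t => map_smul (inclB k A B M) a _
    rw [smul_apply, smul_apply, smul_apply, cup_apply, cup_apply, RingHom.id_apply, e, map_smul,
      LinearMap.smul_apply, smul_comm]

variable {ψ}

theorem inclCochain_cupA (hψ : IsIdealEquiv A B ψ)
    (f : Cochain k A A n) (t : Fin (n + 1) → Tri A B M) :
    inclCochain A B ψ (n + 1) (cupA B ψ n f) t = inclM k A B M (op (f fun i => (t i.succ).a) • (t 0).m) := by
  have h : cupA B ψ n f t = op (inclA k A B M (f fun i => (t i.succ).a)) • ψ (t 0).m := by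
    have e : ∀ i : Fin n, Fin.cast (Nat.add_comm 1 n) (Fin.natAdd 1 i) = i.succ :=
      fun i => Fin.ext (Nat.add_comm 1 i)
    refine (cup_apply _ _ _ _ _).trans ?_
    simp only [e]
    rfl
  rw [inclCochain_apply, h, ← hψ.right_smul, LinearEquiv.symm_apply_apply]
  rfl

theorem inclCochain_cupB (hψ : IsIdealEquiv A B ψ)
    (g : Cochain k B B n) (t : Fin (n + 1) → Tri A B M) :
    inclCochain A B ψ (n + 1) (cupB A ψ n g) t =
      inclM k A B M ((-1 : k) ^ (n + 1) • (g fun i => (t i.castSucc).b) • (t (Fin.last n)).m) := by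
  have h : cupB A ψ n g t =
    (-1 : k) ^ (n + 1) • (inclB k A B M (g fun i => (t i.castSucc).b)) • ψ (t (Fin.last n)).m := rfl
  rw [inclCochain_apply, h, ← hψ.left_smul, ← map_smul, LinearEquiv.symm_apply_apply]
  rfl

theorem d_inclCochain (hψ : IsIdealEquiv A B ψ) (c : Cochain k (Tri A B M) X n) :
    d k _ _ n (inclCochain A B ψ n c) = inclCochain A B ψ (n + 1) (d k _ _ n c) :=
  differential_comp (l := actL k (Tri A B M) X) (r := actR k (Tri A B M) X) _
    (fun t x => by
      obtain ⟨m, rfl⟩ := ψ.surjective x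
      change t * inclM k A B M (ψ.symm (ψ m)) = inclM k A B M (ψ.symm (t • ψ m))
      rw [← hψ.left_smul, LinearEquiv.symm_apply_apply, LinearEquiv.symm_apply_apply]
      ext <;> simp)
    (fun x t => by
      obtain ⟨m, rfl⟩ := ψ.surjective x
      change inclM k A B M (ψ.symm (ψ m)) * t = inclM k A B M (ψ.symm (op t • ψ m))
      rw [← hψ.right_smul, LinearEquiv.symm_apply_apply, LinearEquiv.symm_apply_apply]
      ext <;> simp) c

/-- For cocycles `f` and `g` the first two terms on the right disappear. This identity is then the
snake-lemma computation of the connecting map with extension by zero as the chosen lift. -/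
theorem d_extend (hψ : IsIdealEquiv A B ψ) (f : Cochain k A A n) (g : Cochain k B B n) :
    d k _ _ n (extendA k A B M f + extendB k A B M g) =
      extendA k A B M (d k A A n f) + extendB k A B M (d k B B n g) +
        inclCochain A B ψ (n + 1) (cupA B ψ n f + cupB A ψ n g) := by
  refine MultilinearMap.ext fun t => ?_
  rw [map_add, map_add, add_apply, add_apply, add_apply, add_apply, d_extendA_apply,
    d_extendB_apply, inclCochain_cupA hψ, inclCochain_cupB hψ]
  abel

/-- Applying the differential once more to `d_extend` yields this Leibniz rule without any
computation with cup products. -/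
theorem d_cup (hψ : IsIdealEquiv A B ψ) [SMulCommClass (Tri A B M) (Tri A B M)ᵐᵒᵖ X]
    (f : Cochain k A A n) (g : Cochain k B B n) :
    d k _ _ (n + 1) (cupA B ψ n f + cupB A ψ n g) =
      -(cupA B ψ (n + 1) (d k A A n f) + cupB A ψ (n + 1) (d k B B n g)) := by
  have h := congrArg (d k (Tri A B M) (Tri A B M) (n + 1)) (d_extend hψ f g)
  rw [d_d, map_add, d_extend hψ, d_d, d_d, d_inclCochain hψ] at h
  have h0 : extendA k A B M (0 : Cochain k A A (n + 2)) + extendB k A B M (0 : Cochain k B B (n + 2)) =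
      0 := MultilinearMap.ext fun t => by ext <;> exact add_zero _
  rw [h0, zero_add, ← map_add (inclCochain A B ψ (n + 2))] at h
  exact eq_neg_of_add_eq_zero_right ((inclCochain_injective (A := A) (B := B) ψ) (h.symm.trans (map_zero _).symm))

end Coefficients
end Tri

/-! ### The long exact sequence with coefficients in the ideal `M`. -/

namespace Tri

open Hochschild

section Restriction

variable (k A B M : Type u) [Field k] [Ring A] [Algebra k A] [Ring B] [Algebra k B]
  [AddCommGroup M] [Module k M] [Module B M] [Module Aᵐᵒᵖ M] [SMulCommClass B Aᵐᵒᵖ M]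
  [IsScalarTower k B M] [IsScalarTower k Aᵐᵒᵖ M] (n : ℕ)

/-- Restriction of cochains to `A` as a linear map. -/
def restrictLinearA : Cochain k (Tri A B M) (Tri A B M) n →ₗ[k] Cochain k A A n where
  toFun := restrictA k A B M
  map_add' _ _ := rfl
  map_smul' _ _ := rfl

/-- The map on cohomology induced by restriction of cochains to `A`. -/
def resA : HH k (Tri A B M) (Tri A B M) n →ₗ[k] HH k A A n :=
  HH.map (restrictLinearA k A B M n)
    (fun F hF => by
      change d k A A n (restrictA k A B M F) = 0
      rw [← restrictA_d, hF]
      rfl)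
    (fun F hF => by
      cases n with
      | zero =>
        obtain rfl := (Submodule.mem_bot k).1 hF
        exact Submodule.zero_mem _
      | succ n =>
        obtain ⟨G, rfl⟩ := hF
        exact ⟨restrictA k A B M G, (restrictA_d G).symm⟩)

/-- Restriction of cochains to `B` as a linear map. -/
def restrictLinearB : Cochain k (Tri A B M) (Tri A B M) n →ₗ[k] Cochain k B B n where
  toFun := restrictB k A B M
  map_add' _ _ := rfl
  map_smul' _ _ := rfl

/-- The map on cohomology induced by restriction of cochains to `B`. -/
def resB : HH k (Tri A B M) (Tri A B M) n →ₗ[k] HH k B B n :=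
  HH.map (restrictLinearB k A B M n)
    (fun F hF => by
      change d k B B n (restrictB k A B M F) = 0
      rw [← restrictB_d, hF]
      rfl)
    (fun F hF => by
      cases n with
      | zero =>
        obtain rfl := (Submodule.mem_bot k).1 hF
        exact Submodule.zero_mem _
      | succ n =>
        obtain ⟨G, rfl⟩ := hF
        exact ⟨restrictB k A B M G, (restrictB_d G).symm⟩)

/-- The map on cohomology induced by restriction of cochains to `A` and to `B`. -/
def res : HH k (Tri A B M) (Tri A B M) n →ₗ[k] HH k A A n × HH k B B n :=
  (resA k A B M n).prod (resB k A B M n)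

variable {k A B M n} {F : Cochain k (Tri A B M) (Tri A B M) n}
  {x : HH k (Tri A B M) (Tri A B M) n}

theorem represents_resA (h : Represents F x) :
    Represents (restrictA k A B M F) (resA k A B M n x) :=
  Represents.map (φ := restrictLinearA k A B M n) h

theorem represents_resB (h : Represents F x) :
    Represents (restrictB k A B M F) (resB k A B M n x) :=
  Represents.map (φ := restrictLinearB k A B M n) h

/-- A degree-zero cocycle commutes with `e = (1, 0, 0)`. Left multiplication by `e` kills the
component in `M`, while right multiplication by `e` preserves it when the component in `B` is zero.
-/
theorem res_injective : Function.Injective (res k A B M 0) := by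
  rw [injective_iff_map_eq_zero]
  intro x hx
  obtain ⟨F, hF, h⟩ := exists_represents x
  have hA := (Submodule.mem_bot k).1 ((represents_resA h).eq_zero_iff.1 (congrArg Prod.fst hx))
  have hB := (Submodule.mem_bot k).1 ((represents_resB h).eq_zero_iff.1 (congrArg Prod.snd hx))
  refine h.eq_zero_iff.2 ((Submodule.mem_bot k).2 (MultilinearMap.ext fun t => ?_))
  have ha : (F t).a = 0 := by
    rw [Subsingleton.elim t fun i => inclA k A B M (Fin.elim0 i)]
    exact congrArg (fun c => c Fin.elim0) hA
  have hb : (F t).b = 0 := by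
    rw [Subsingleton.elim t fun i => inclB k A B M (Fin.elim0 i)]
    exact congrArg (fun c => c Fin.elim0) hB
  have hd : d k (Tri A B M) (Tri A B M) 0 F (fun _ => ⟨1, 0, 0⟩) =
      (⟨1, 0, 0⟩ : Tri A B M) * F Fin.elim0 - F Fin.elim0 * ⟨1, 0, 0⟩ :=
    differential_zero_apply _ _ F _
  rw [hF, Subsingleton.elim Fin.elim0 t, zero_apply, eq_comm, sub_eq_zero] at hd
  have hm := congrArg Tri.m hd
  ext
  · exact ha
  · simpa [hb] using hm.symm
  · exact hb

end Restriction

section LongExactSequence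

variable {k A B M X : Type u} [Field k] [Ring A] [Algebra k A] [Ring B] [Algebra k B]
  [AddCommGroup M] [Module k M] [Module B M] [Module Aᵐᵒᵖ M] [SMulCommClass B Aᵐᵒᵖ M]
  [IsScalarTower k B M] [IsScalarTower k Aᵐᵒᵖ M]
  [AddCommGroup X] [Module k X] [Module (Tri A B M) X] [Module (Tri A B M)ᵐᵒᵖ X]
  [IsScalarTower k (Tri A B M) X] [IsScalarTower k (Tri A B M)ᵐᵒᵖ X]
  {ψ : M ≃ₗ[k] X}

/-- The map on cohomology induced by the inclusion of the ideal `M`. -/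
def inclHH (hψ : IsIdealEquiv A B ψ) (n : ℕ) :
    HH k (Tri A B M) X n →ₗ[k] HH k (Tri A B M) (Tri A B M) n :=
  HH.map (inclCochain A B ψ n)
    (fun c hc => by rw [d_inclCochain hψ, hc, map_zero])
    (fun c hc => by
      cases n with
      | zero =>
        obtain rfl := (Submodule.mem_bot k).1 hc
        rw [map_zero]
        exact Submodule.zero_mem _
      | succ n =>
        obtain ⟨w, rfl⟩ := hc
        exact ⟨_, d_inclCochain hψ w⟩)

theorem represents_inclHH (hψ : IsIdealEquiv A B ψ) {n : ℕ}
    {c : Cochain k (Tri A B M) X n} {x : HH k (Tri A B M) X n} (h : Represents c x) : Represents (inclCochain A B ψ n c) (inclHH hψ n x) :=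
  Represents.map (φ := inclCochain A B ψ n) h

theorem exists_eq_extend_add_inclCochain (ψ : M ≃ₗ[k] X) {n : ℕ}
    (F : Cochain k (Tri A B M) (Tri A B M) n) {c : Cochain k (Tri A B M) X (n + 1)}
    (hc : d k _ _ n F = inclCochain A B ψ (n + 1) c) :
    ∃ w : Cochain k (Tri A B M) X n, ∃ b ∈ coboundaries k (Tri A B M) (Tri A B M) n,
      F = extendA k A B M (restrictA k A B M F) + extendB k A B M (restrictB k A B M F) +
        inclCochain A B ψ n w + b := by
  obtain ⟨w, b, hb, h⟩ := exists_eq_extend_add F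
    (by rw [hc]; exact projA_inclCochain ψ c) (by rw [hc]; exact projB_inclCochain ψ c)
  obtain ⟨w', hw'⟩ := exists_inclCochain_eq (A := A) (B := B) ψ w
  exact ⟨w', b, hb, by rw [hw']; exact h⟩

variable [SMulCommClass (Tri A B M) (Tri A B M)ᵐᵒᵖ X]

theorem d_eq_zero_of_mem_coboundaries {Λ Y : Type u} [Ring Λ] [Algebra k Λ] [AddCommGroup Y]
    [Module k Y] [Module Λ Y] [Module Λᵐᵒᵖ Y] [IsScalarTower k Λ Y] [IsScalarTower k Λᵐᵒᵖ Y]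
    [SMulCommClass Λ Λᵐᵒᵖ Y] {n : ℕ} {b : Cochain k Λ Y n} (hb : b ∈ coboundaries k Λ Y n) :
    d k Λ Y n b = 0 := by
  cases n with
  | zero => rw [(Submodule.mem_bot k).1 hb, map_zero]
  | succ n =>
    obtain ⟨g, rfl⟩ := hb
    exact d_d Y g

theorem d_cupA (hψ : IsIdealEquiv A B ψ) {n : ℕ} (f : Cochain k A A n) :
    d k _ _ (n + 1) (cupA B ψ n f) = -cupA B ψ (n + 1) (d k A A n f) := by
  have h := d_cup hψ f (0 : Cochain k B B n)
  rwa [map_zero, map_zero, map_zero, add_zero, add_zero] at h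

theorem d_cupB (hψ : IsIdealEquiv A B ψ) {n : ℕ} (g : Cochain k B B n) :
    d k _ _ (n + 1) (cupB A ψ n g) = -cupB A ψ (n + 1) (d k B B n g) := by
  have h := d_cup hψ (0 : Cochain k A A n) g
  rwa [map_zero, map_zero, map_zero, zero_add, zero_add] at h

/-- The map on cohomology induced by the cup product with cochains of `A`. -/
def connA (hψ : IsIdealEquiv A B ψ) (n : ℕ) : HH k A A n →ₗ[k] HH k (Tri A B M) X (n + 1) :=
  HH.map (cupA B ψ n) (fun f hf => by rw [d_cupA hψ, hf, map_zero, neg_zero])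
    (fun f hf => by
      cases n with
      | zero =>
        obtain rfl := (Submodule.mem_bot k).1 hf
        rw [map_zero]
        exact Submodule.zero_mem _
      | succ n =>
        obtain ⟨p, rfl⟩ := hf
        exact ⟨-cupA B ψ n p, by rw [map_neg, d_cupA hψ, neg_neg]⟩)

/-- The map on cohomology induced by the signed cup product with cochains of `B`. -/
def connB (hψ : IsIdealEquiv A B ψ) (n : ℕ) : HH k B B n →ₗ[k] HH k (Tri A B M) X (n + 1) :=
  HH.map (cupB A ψ n) (fun f hf => by rw [d_cupB hψ, hf, map_zero, neg_zero])
    (fun f hf => by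
      cases n with
      | zero =>
        obtain rfl := (Submodule.mem_bot k).1 hf
        rw [map_zero]
        exact Submodule.zero_mem _
      | succ n =>
        obtain ⟨p, rfl⟩ := hf
        exact ⟨-cupB A ψ n p, by rw [map_neg, d_cupB hψ, neg_neg]⟩)

/-- The connecting homomorphism. -/
def conn (hψ : IsIdealEquiv A B ψ) (n : ℕ) : HH k A A n × HH k B B n →ₗ[k] HH k (Tri A B M) X (n + 1) :=
  (connA hψ n).coprod (connB hψ n)

theorem represents_connA (hψ : IsIdealEquiv A B ψ)
    {n : ℕ} {f : Cochain k A A n} {x : HH k A A n} (h : Represents f x) :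
    Represents (cupA B ψ n f) (connA hψ n x) :=
  Represents.map (φ := cupA B ψ n) h

theorem represents_connB (hψ : IsIdealEquiv A B ψ)
    {n : ℕ} {g : Cochain k B B n} {y : HH k B B n} (h : Represents g y) :
    Represents (cupB A ψ n g) (connB hψ n y) :=
  Represents.map (φ := cupB A ψ n) h

theorem represents_conn (hψ : IsIdealEquiv A B ψ)
    {n : ℕ} {f : Cochain k A A n} {g : Cochain k B B n} {x : HH k A A n}
    {y : HH k B B n} (h : Represents f x) (h' : Represents g y) :
    Represents (cupA B ψ n f + cupB A ψ n g) (conn hψ n (x, y)) :=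
  (represents_connA hψ h).add (represents_connB hψ h')

theorem d_extend_of_d_eq_zero (hψ : IsIdealEquiv A B ψ)
    {n : ℕ} {f : Cochain k A A n} {g : Cochain k B B n}
    (hf : d k A A n f = 0) (hg : d k B B n g = 0) :
    d k _ _ n (extendA k A B M f + extendB k A B M g) =
      inclCochain A B ψ (n + 1) (cupA B ψ n f + cupB A ψ n g) := by
  have h0 : extendA k A B M (0 : Cochain k A A (n + 1)) +
      extendB k A B M (0 : Cochain k B B (n + 1)) = 0 :=
    MultilinearMap.ext fun t => by ext <;> exact add_zero _
  rw [d_extend hψ, hf, hg, h0, zero_add]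

/-- If the cup product class is `d w`, then extension by zero minus `w` is a cocycle with the
prescribed restrictions. Conversely, differentiating the decomposition of a cocycle of `T` exhibits
`-w` as a primitive of the cup product. -/
theorem exact_res_conn (hψ : IsIdealEquiv A B ψ)
    (n : ℕ) : Function.Exact (res k A B M n) (conn hψ n) := by
  rintro ⟨x, y⟩
  constructor
  · intro h
    obtain ⟨f, hf, hx⟩ := exists_represents x
    obtain ⟨g, hg, hy⟩ := exists_represents y
    obtain ⟨w, hw⟩ := (represents_conn hψ hx hy).eq_zero_iff.1 h
    obtain ⟨z, hz⟩ := exists_represents_of_d_eq_zero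
      (c := extendA k A B M f + extendB k A B M g - inclCochain A B ψ n w)
      (by rw [map_sub, d_extend_of_d_eq_zero hψ hf hg, d_inclCochain hψ, hw, sub_self])
    refine ⟨z, Prod.ext ((represents_resA hz).eq ?_) ((represents_resB hz).eq ?_)⟩
    · have : restrictA k A B M (extendA k A B M f + extendB k A B M g - inclCochain A B ψ n w) = f :=
        MultilinearMap.ext fun t => (sub_zero _).trans (add_zero _)
      rwa [this]
    · have : restrictB k A B M (extendA k A B M f + extendB k A B M g - inclCochain A B ψ n w) = g :=
        MultilinearMap.ext fun t => (sub_zero _).trans (zero_add _)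
      rwa [this]
  · rintro ⟨z, hz⟩
    obtain ⟨F, hF, h⟩ := exists_represents z
    obtain ⟨w, b, hb, hFw⟩ := exists_eq_extend_add_inclCochain ψ F (c := 0) (by rw [hF, map_zero])
    have hA := represents_resA h
    have hB := represents_resB h
    rw [← hz]
    refine (represents_conn hψ hA hB).eq_zero_iff.2 ⟨-w, inclCochain_injective (A := A) (B := B) ψ ?_⟩
    have e := congrArg (d k (Tri A B M) (Tri A B M) n) hFw
    rw [hF, map_add, map_add, d_eq_zero_of_mem_coboundaries hb, add_zero, d_inclCochain hψ,
      d_extend_of_d_eq_zero hψ hA.d_eq_zero hB.d_eq_zero] at e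
    rw [map_neg, map_neg]
    exact (eq_neg_of_add_eq_zero_left e.symm).symm

/-- When an `M`-valued cocycle is `d G` in `T`, the restrictions of `G` are cocycles. Decomposing
`G` shows that their cup product class is the given one. -/
theorem exact_conn_inclHH (hψ : IsIdealEquiv A B ψ)
    (n : ℕ) : Function.Exact (conn hψ n) (inclHH hψ (n + 1)) := by
  intro x
  obtain ⟨c, hc, hx⟩ := exists_represents x
  constructor
  · intro h
    obtain ⟨G, hG⟩ := (represents_inclHH hψ hx).eq_zero_iff.1 h
    obtain ⟨w, b, hb, hGw⟩ := exists_eq_extend_add_inclCochain ψ G hG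
    have hA : d k A A n (restrictA k A B M G) = 0 := by
      rw [← restrictA_d, hG]
      rfl
    have hB : d k B B n (restrictB k A B M G) = 0 := by
      rw [← restrictB_d, hG]
      rfl
    obtain ⟨y, hy⟩ := exists_represents_of_d_eq_zero hA
    obtain ⟨y', hy'⟩ := exists_represents_of_d_eq_zero hB
    refine ⟨(y, y'), ((hx.eq_iff (represents_conn hψ hy hy')).2
      ⟨w, inclCochain_injective (A := A) (B := B) ψ ?_⟩).symm⟩
    have e := congrArg (d k (Tri A B M) (Tri A B M) n) hGw
    rw [hG, map_add, map_add, d_eq_zero_of_mem_coboundaries hb, add_zero, d_inclCochain hψ,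
      d_extend_of_d_eq_zero hψ hA hB] at e
    rw [map_sub, e, add_sub_cancel_left]
  · rintro ⟨⟨y, y'⟩, rfl⟩
    obtain ⟨f, hf, hy⟩ := exists_represents y
    obtain ⟨g, hg, hy'⟩ := exists_represents y'
    exact (represents_inclHH hψ (represents_conn hψ hy hy')).eq_zero_iff.2
      ⟨_, d_extend_of_d_eq_zero hψ hf hg⟩

theorem exact_inclHH_res (hψ : IsIdealEquiv A B ψ) (n : ℕ) :
    Function.Exact (inclHH hψ (n + 1)) (res k A B M (n + 1)) := by
  intro z
  constructor
  · intro h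
    obtain ⟨F, hF, hz⟩ := exists_represents z
    obtain ⟨p, hp⟩ := (represents_resA hz).eq_zero_iff.1 (congrArg Prod.fst h)
    obtain ⟨q, hq⟩ := (represents_resB hz).eq_zero_iff.1 (congrArg Prod.snd h)
    obtain ⟨w, b, hb, hFw⟩ := exists_eq_extend_add_inclCochain ψ F (c := 0) (by rw [hF, map_zero])
    -- Replacing the extensions of `d p` and `d q` by the differential of the extensions introduces
    -- cup products, which are absorbed into the `M`-valued part.
    have e : F = inclCochain A B ψ (n + 1) (w - (cupA B ψ n p + cupB A ψ n q)) +
        (d k _ _ n (extendA k A B M p + extendB k A B M q) + b) := by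
      rw [d_extend hψ, hp, hq, map_sub]
      refine hFw.trans ?_
      abel
    obtain ⟨x, hx⟩ := exists_represents_of_d_eq_zero
      (c := w - (cupA B ψ n p + cupB A ψ n q)) (inclCochain_injective (A := A) (B := B) ψ (by
        have e' := congrArg (d k (Tri A B M) (Tri A B M) (n + 1)) e
        rw [hF, map_add, map_add, d_d, d_eq_zero_of_mem_coboundaries hb, add_zero, add_zero,
          d_inclCochain hψ] at e'
        rw [← e', map_zero]))
    refine ⟨x, (((hz.eq_iff (represents_inclHH hψ hx)).2 ?_).symm)⟩
    rw [e, add_sub_cancel_left]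
    exact Submodule.add_mem _ ⟨_, rfl⟩ hb
  · rintro ⟨x, rfl⟩
    obtain ⟨c, hc, hx⟩ := exists_represents x
    have h := represents_inclHH hψ hx
    exact Prod.ext ((represents_resA h).eq represents_zero) ((represents_resB h).eq represents_zero)

end LongExactSequence
end Tri

/-- Used to exchange the middle term `H^{n+1}(T, M)` for `Ext^n(M, M)`, or for the endomorphisms of
`N`. -/
theorem LinearMap.exact_symm_comp {k U V V' W : Type*} [CommRing k] [AddCommGroup U] [Module k U]
    [AddCommGroup V] [Module k V] [AddCommGroup V'] [Module k V'] [AddCommGroup W] [Module k W]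
    {f : U →ₗ[k] V} {g : V →ₗ[k] W} (h : Function.Exact f g) (e : V' ≃ₗ[k] V) :
    Function.Exact (e.symm.toLinearMap ∘ₗ f) (g ∘ₗ e.toLinearMap) := fun y =>
  (h (e y)).trans (exists_congr fun _ => (LinearEquiv.symm_apply_eq e).symm)

/-! ### Cohomology in degree zero and cohomology of the ground field. -/

namespace Hochschild

section LowDegree

variable (k Λ X : Type u) [Field k] [Ring Λ] [Algebra k Λ] [AddCommGroup X] [Module k X]
  [Module Λ X] [Module Λᵐᵒᵖ X] [IsScalarTower k Λ X] [IsScalarTower k Λᵐᵒᵖ X]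

/-- The value of a class of degree zero. -/
def HH.evalZero : HH k Λ X 0 →ₗ[k] X :=
  Submodule.liftQ _
    (LinearMap.comp
      { toFun := fun c : Cochain k Λ X 0 => c Fin.elim0
        map_add' := fun _ _ => rfl
        map_smul' := fun _ _ => rfl }
      (cocycles k Λ X 0).subtype)
    fun c hc => by
      have h : c.1 = 0 := (Submodule.mem_bot k).1 hc
      change c.1 Fin.elim0 = 0
      rw [h, zero_apply]

variable {k Λ X}

theorem Represents.evalZero_eq {c : Cochain k Λ X 0} {x : HH k Λ X 0} (h : Represents c x) :
    HH.evalZero k Λ X x = c Fin.elim0 := by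
  obtain ⟨hc, rfl⟩ := h
  rfl

theorem evalZero_injective : Function.Injective (HH.evalZero k Λ X) := by
  rw [injective_iff_map_eq_zero]
  intro x hx
  obtain ⟨c, -, h⟩ := exists_represents x
  rw [h.evalZero_eq] at hx
  refine h.eq_zero_iff.2 ((Submodule.mem_bot k).2 (MultilinearMap.ext fun t => ?_))
  rw [Subsingleton.elim t Fin.elim0, hx, zero_apply]

variable (k)

theorem exists_represents_const (c : k) :
    ∃ x : HH k k k 0, Represents (MultilinearMap.constOfIsEmpty k (fun _ : Fin 0 => k) c) x := by
  refine exists_represents_of_d_eq_zero (MultilinearMap.ext fun t => ?_)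
  refine (differential_zero_apply _ _ _ t).trans ?_
  change t 0 * c - c * t 0 = 0
  rw [mul_comm, sub_self]

/-- The zeroth cohomology of the ground field. -/
noncomputable def HH.zeroEquiv : HH k k k 0 ≃ₗ[k] k :=
  LinearEquiv.ofBijective (HH.evalZero k k k) ⟨evalZero_injective, fun c => by
    obtain ⟨x, hx⟩ := exists_represents_const k c
    exact ⟨x, hx.evalZero_eq⟩⟩

theorem represents_zeroEquiv_symm (c : k) :
    Represents (MultilinearMap.constOfIsEmpty k (fun _ : Fin 0 => k) c)
      ((HH.zeroEquiv k).symm c) := by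
  obtain ⟨x, hx⟩ := exists_represents_const k c
  have : HH.zeroEquiv k x = c := hx.evalZero_eq
  rwa [← this, LinearEquiv.symm_apply_apply, this]

instance (n : ℕ) : Subsingleton (HH k k k (n + 1)) := by
  refine subsingleton_of_forall_eq 0 fun x => ?_
  obtain ⟨c, hc, h⟩ := exists_represents x
  exact h.eq_zero_iff.2 (exists_differential_eq_of_field (actL k k k) (actR k k k)
    (fun v => one_smul k v) c hc)

end LowDegree

end Hochschild

/-! ### Specialisation to bimodules and to one-point extensions. -/

namespace Tri

open Hochschild CategoryTheory CategoryTheory.Abelian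

section Universal

variable {k A B M R : Type u} [Field k] [Ring A] [Algebra k A] [Ring B] [Algebra k B]
  [AddCommGroup M] [Module k M] [Module B M] [Module Aᵐᵒᵖ M] [SMulCommClass B Aᵐᵒᵖ M]
  [IsScalarTower k B M] [IsScalarTower k Aᵐᵒᵖ M] [Ring R] [Algebra k R]
  (σ : B ⊗[k] Aᵐᵒᵖ ≃ₐ[k] R) {α : Tri A B M ⊗[k] (Tri A B M)ᵐᵒᵖ →ₐ[k] R}

theorem isIdealEquiv {M0 : ModuleCat.{u} R} {ε : M ≃ₗ[k] Restr α M0}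
    (hα : ∀ s t, α (s ⊗ₜ t) = σ (s.b ⊗ₜ op t.unop.a))
    (hε : ∀ (b : B) (a : A) (m : M), ε (b • op a • m) = σ (b ⊗ₜ op a) • ε m) :
    IsIdealEquiv A B ε where
  left_smul t m := by
    have h := hε t.b 1 m
    rw [MulOpposite.op_one, one_smul] at h
    rw [h, left_smul_eq σ hα]
  right_smul t m := by
    have h := hε 1 t.a m
    rw [one_smul] at h
    rw [h, right_smul_eq σ hα]

theorem d_zero_apply_inclM {X : ModuleCat.{u} R} (hα : ∀ s t, α (s ⊗ₜ t) = σ (s.b ⊗ₜ op t.unop.a))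
    (x : Cochain k (Tri A B M) (Restr α X) 0) (m : M) :
    d k _ _ 0 x (fun _ => ⟨0, m, 0⟩) = 0 := by
  refine (differential_zero_apply _ _ _ _).trans ?_
  change (⟨0, m, 0⟩ : Tri A B M) • x Fin.elim0 - op (⟨0, m, 0⟩ : Tri A B M) • x Fin.elim0 = 0
  rw [left_smul_eq σ hα, right_smul_eq σ hα, TensorProduct.zero_tmul, MulOpposite.op_zero,
    TensorProduct.tmul_zero, sub_self]

end Universal

section Bimodule

variable (k A B M : Type u) [Field k] [Ring A] [Algebra k A] [Ring B] [Algebra k B]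
  [AddCommGroup M] [Module k M] [Module B M] [Module Aᵐᵒᵖ M] [SMulCommClass B Aᵐᵒᵖ M]
  [IsScalarTower k B M] [IsScalarTower k Aᵐᵒᵖ M]

theorem toBA_tmul (s : Tri A B M) (t : (Tri A B M)ᵐᵒᵖ) :
    toBA k A B M (s ⊗ₜ t) = (AlgEquiv.refl : B ⊗[k] Aᵐᵒᵖ ≃ₐ[k] _) (s.b ⊗ₜ op t.unop.a) := rfl

theorem equivMBimod_smul (b : B) (a : A) (m : M) : equivMBimod k A B M (b • op a • m) =
    (AlgEquiv.refl : B ⊗[k] Aᵐᵒᵖ ≃ₐ[k] _) (b ⊗ₜ op a) • equivMBimod k A B M m := rfl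

theorem isUniversal_oneM : IsUniversal (toBA k A B M) (oneM k A B M) :=
  isUniversal AlgEquiv.refl _ (toBA_tmul k A B M) (equivMBimod_smul k A B M)

theorem isIdealEquiv_equivMBimod : IsIdealEquiv A B (equivMBimod k A B M) :=
  isIdealEquiv AlgEquiv.refl (toBA_tmul k A B M) (equivMBimod_smul k A B M)

end Bimodule

section OnePoint

variable (k A N : Type u) [Field k] [Ring A] [Algebra k A]
  [AddCommGroup N] [Module k N] [Module Aᵐᵒᵖ N] [IsScalarTower k Aᵐᵒᵖ N]

theorem toRight_tmul (s : Tri A k N) (t : (Tri A k N)ᵐᵒᵖ) :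
    toRight k A N (s ⊗ₜ t) = Algebra.TensorProduct.lid k Aᵐᵒᵖ (s.b ⊗ₜ op t.unop.a) := by
  rw [Algebra.TensorProduct.lid_tmul, Algebra.smul_def]
  rfl

theorem equivNBimod_smul (c : k) (a : A) (x : N) : equivNBimod k A N (c • op a • x) =
    Algebra.TensorProduct.lid k Aᵐᵒᵖ (c ⊗ₜ op a) • equivNBimod k A N x := by
  rw [Algebra.TensorProduct.lid_tmul, ← smul_assoc]
  rfl

theorem isUniversal_oneN : IsUniversal (toRight k A N) (oneN k A N) :=
  isUniversal (Algebra.TensorProduct.lid k Aᵐᵒᵖ) _ (toRight_tmul k A N) (equivNBimod_smul k A N)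

theorem isIdealEquiv_equivNBimod : IsIdealEquiv A k (equivNBimod k A N) :=
  isIdealEquiv (Algebra.TensorProduct.lid k Aᵐᵒᵖ) (toRight_tmul k A N) (equivNBimod_smul k A N)

/-- The cochain `t ↦ φ(t.m)` with values in `N`. -/
def endCochain : Module.End Aᵐᵒᵖ N →ₗ[k] Cochain k (Tri A k N) (NBimod k A N) 1 where
  toFun φ := mapCochain (toRight k A N) (ModuleCat.ofHom φ) (oneN k A N)
  map_add' _ _ := rfl
  map_smul' c φ := MultilinearMap.ext fun t => (algebraMap_smul Aᵐᵒᵖ c (φ (t 0).m)).symm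

theorem d_endCochain (φ : Module.End Aᵐᵒᵖ N) : d k _ _ 1 (endCochain k A N φ) = 0 := by
  refine (d_mapCochain (toRight k A N) (ModuleCat.ofHom φ) (oneN k A N)).trans ?_
  rw [(isUniversal_oneN k A N).cocycle, mapCochain_zero]

/-- The class in `H¹(T, N)` of an endomorphism of `N`. -/
def endClass : Module.End Aᵐᵒᵖ N →ₗ[k] HH k (Tri A k N) (NBimod k A N) 1 :=
  Submodule.mkQ _ ∘ₗ LinearMap.codRestrict (cocycles k _ _ 1) (endCochain k A N) (d_endCochain k A N)

theorem represents_endClass (φ : Module.End Aᵐᵒᵖ N) :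
    Represents (endCochain k A N φ) (endClass k A N φ) := ⟨d_endCochain k A N φ, rfl⟩

/-- Endomorphisms of `N` as the first cohomology of `T` with coefficients in `N`. -/
noncomputable def endEquiv : Module.End Aᵐᵒᵖ N ≃ₗ[k] HH k (Tri A k N) (NBimod k A N) 1 :=
  LinearEquiv.ofBijective (endClass k A N) (by
    constructor
    · rw [injective_iff_map_eq_zero]
      intro φ hφ
      obtain ⟨x, hx⟩ := (represents_endClass k A N φ).eq_zero_iff.1 hφ
      have := (isUniversal_oneN k A N).hom_eq_zero _ (ModuleCat.ofHom φ) x hx.symm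
      exact congrArg ModuleCat.Hom.hom this
    · intro y
      obtain ⟨c, hc, hy⟩ := exists_represents y
      obtain ⟨h, x, hx⟩ := (isUniversal_oneN k A N).exists_hom (ModuleCat.of Aᵐᵒᵖ N) c hc
      refine ⟨h.hom, ((represents_endClass k A N h.hom).eq_iff hy).2 ⟨-x, ?_⟩⟩
      rw [map_neg, hx]
      exact (sub_add_cancel_left _ _).symm)

theorem represents_endEquiv (φ : Module.End Aᵐᵒᵖ N) :
    Represents (endCochain k A N φ) (endEquiv k A N φ) := represents_endClass k A N φ

theorem inclCochain_endCochain (φ : Module.End Aᵐᵒᵖ N) :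
    inclCochain A k (equivNBimod k A N) 1 (endCochain k A N φ) = extendEnd k A N φ := rfl

/-- The identification of the zeroth cohomology of the ground field with `k`, in a product. -/
noncomputable def zeroProdEquiv : (HH k A A 0 × HH k k k 0) ≃ₗ[k] HH k A A 0 × k :=
  (LinearEquiv.refl k (HH k A A 0)).prodCongr (HH.zeroEquiv k)

/-- The connecting homomorphism of the one-point extension in degree zero. -/
noncomputable def connZero : HH k A A 0 × k →ₗ[k] Module.End Aᵐᵒᵖ N :=
  (endEquiv k A N).symm.toLinearMap ∘ₗ (conn (isIdealEquiv_equivNBimod k A N) 0) ∘ₗ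
    (zeroProdEquiv k A).symm.toLinearMap

theorem endEquiv_connZero (x : HH k A A 0) (c : k) : endEquiv k A N (connZero k A N (x, c)) =
    conn (isIdealEquiv_equivNBimod k A N) 0 (x, (HH.zeroEquiv k).symm c) :=
  (endEquiv k A N).apply_symm_apply _

/-- The endomorphism and the cup product are cohomologous cochains, and they are compared at `(0, m,
0)`. Coboundaries vanish there, so the values agree; the minus sign is `(-1)^{n+1}` at `n = 0`. -/
theorem connZero_apply {x : HH k A A 0} {f : Cochain k A A 0} (hf : Represents f x) (c : k)
    (m : N) : connZero k A N (x, c) m = op (f Fin.elim0) • m - c • m := by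
  let φ := connZero k A N (x, c)
  obtain ⟨w, hw⟩ := ((represents_endEquiv k A N φ).eq_iff
    (represents_conn (isIdealEquiv_equivNBimod k A N) hf (represents_zeroEquiv_symm k c))).1
      (endEquiv_connZero k A N x c)
  let t : Fin 1 → Tri A k N := fun _ => ⟨0, m, 0⟩
  have h1 := (d_zero_apply_inclM (Algebra.TensorProduct.lid k Aᵐᵒᵖ) (toRight_tmul k A N) w m).symm.trans
    (congrArg (fun F => F t) hw)
  have hA := congrArg Tri.m (inclCochain_cupA (isIdealEquiv_equivNBimod k A N) f t)
  have hB := congrArg Tri.m (inclCochain_cupB (isIdealEquiv_equivNBimod k A N)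
    (MultilinearMap.constOfIsEmpty k (fun _ : Fin 0 => k) c) t)
  change φ m = _
  have h2 : φ m - (op (f fun i => (t i.succ).a) • m + (-1 : k) ^ 1 • c • m) = 0 := by
    refine Eq.trans ?_ h1.symm
    exact congrArg (φ m - ·) (congrArg₂ (· + ·) hA hB).symm
  rw [Subsingleton.elim (fun i : Fin 0 => (t i.succ).a) Fin.elim0, pow_one, neg_one_smul,
    ← sub_eq_add_neg] at h2
  exact sub_eq_zero.1 h2

theorem exact_res_connZero : Function.Exact
    ((zeroProdEquiv k A).toLinearMap ∘ₗ res k A k N 0) (connZero k A N) :=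
  ((endEquiv k A N).symm.injective.comp_exact_iff_exact).2
    ((LinearEquiv.conj_exact_iff_exact _ _ (zeroProdEquiv k A)).2
      (exact_res_conn (isIdealEquiv_equivNBimod k A N) 0))

theorem exact_connZero_inclHH : Function.Exact (connZero k A N)
    (inclHH (isIdealEquiv_equivNBimod k A N) 1 ∘ₗ (endEquiv k A N).toLinearMap) :=
  LinearMap.exact_symm_comp (((zeroProdEquiv k A).symm.surjective.comp_exact_iff_exact).2
    (exact_conn_inclHH (isIdealEquiv_equivNBimod k A N) 0)) (endEquiv k A N)

variable {k A N} in
theorem zeroProdEquiv_res_snd {x : HH k (Tri A k N) (Tri A k N) 0}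
    {F : Cochain k (Tri A k N) (Tri A k N) 0} (hF : Represents F x) :
    (zeroProdEquiv k A (res k A k N 0 x)).2 = (F Fin.elim0).b :=
  (represents_resB hF).evalZero_eq.trans
    (congrArg (fun t => (F t).b) (Subsingleton.elim _ _))

variable {k A N} in
theorem represents_inclNBimod {n : ℕ} {c : Cochain k (Tri A k N) (NBimod k A N) n}
    {x : HH k (Tri A k N) (NBimod k A N) n} (h : Represents c x) :
    Represents ((inclNBimod k A N).compMultilinearMap c)
      (inclHH (isIdealEquiv_equivNBimod k A N) n x) :=
  represents_inclHH (isIdealEquiv_equivNBimod k A N) h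

theorem represents_extendEnd (φ : Module.End Aᵐᵒᵖ N) : Represents (extendEnd k A N φ)
    (inclHH (isIdealEquiv_equivNBimod k A N) 1 (endEquiv k A N φ)) := by
  rw [← inclCochain_endCochain]
  exact represents_inclHH _ (represents_endEquiv k A N φ)

/-- The second component is trivial because the ground field has no cohomology in positive degrees.
The same reason turns the other two exactness statements into their one-component forms. -/
theorem conn_eq_zero_iff (n : ℕ) (x : HH k A A (n + 1)) :
    conn (isIdealEquiv_equivNBimod k A N) (n + 1) (x, 0) = 0 ↔
      x ∈ Set.range (resA k A k N (n + 1)) := by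
  rw [exact_res_conn (isIdealEquiv_equivNBimod k A N) (n + 1) (x, 0)]
  constructor
  · rintro ⟨z, hz⟩
    exact ⟨z, congrArg Prod.fst hz⟩
  · rintro ⟨z, hz⟩
    exact ⟨z, Prod.ext hz (Subsingleton.elim _ _)⟩

theorem inclHH_eq_zero_iff (n : ℕ) (y : HH k (Tri A k N) (NBimod k A N) (n + 2)) :
    inclHH (isIdealEquiv_equivNBimod k A N) (n + 2) y = 0 ↔
      ∃ x, conn (isIdealEquiv_equivNBimod k A N) (n + 1) (x, 0) = y := by
  rw [exact_conn_inclHH (isIdealEquiv_equivNBimod k A N) (n + 1) y]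
  constructor
  · rintro ⟨⟨x, x'⟩, h⟩
    exact ⟨x, by rwa [Subsingleton.elim 0 x']⟩
  · rintro ⟨x, h⟩
    exact ⟨_, h⟩

theorem resA_eq_zero_iff (n : ℕ) (z : HH k (Tri A k N) (Tri A k N) (n + 1)) :
    resA k A k N (n + 1) z = 0 ↔
      z ∈ Set.range (inclHH (isIdealEquiv_equivNBimod k A N) (n + 1)) := by
  rw [← exact_inclHH_res (isIdealEquiv_equivNBimod k A N) n z]
  exact ⟨fun h => Prod.ext h (Subsingleton.elim _ _), fun h => congrArg Prod.fst h⟩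

end OnePoint
end Tri

/-! ### Assembly of both long exact sequences. -/

set_option maxHeartbeats 400000 in
open CategoryTheory CategoryTheory.Abelian Hochschild Tri in
theorem mainTheorem9 (k A B M N : Type u) [Field k] [Ring A] [Algebra k A] [Ring B] [Algebra k B]
    -- `M` is a `B`-`A`-bimodule and `N` is a right `A`-module
    [AddCommGroup M] [Module k M] [Module B M] [Module Aᵐᵒᵖ M] [SMulCommClass B Aᵐᵒᵖ M]
    [IsScalarTower k B M] [IsScalarTower k Aᵐᵒᵖ M]
    [AddCommGroup N] [Module k N] [Module Aᵐᵒᵖ N] [IsScalarTower k Aᵐᵒᵖ N] :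
    -- The long exact sequence of the triangular matrix algebra `Tri A B M`
    (∃ (r : ∀ n : ℕ, HH k (Tri A B M) (Tri A B M) n →ₗ[k] HH k A A n × HH k B B n)
      (δ : ∀ n : ℕ, HH k A A n × HH k B B n →ₗ[k] Ext (bimod k A B M) (bimod k A B M) n)
      (i : ∀ n : ℕ, Ext (bimod k A B M) (bimod k A B M) n →ₗ[k]
        HH k (Tri A B M) (Tri A B M) (n + 1))
      (θ : ∀ n : ℕ, Ext (bimod k A B M) (bimod k A B M) n ≃ₗ[k]
        HH k (Tri A B M) (MBimod k A B M) (n + 1)),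
      -- exactness
      (Function.Injective (r 0) ∧ (∀ n, Function.Exact (r n) (δ n)) ∧
        (∀ n, Function.Exact (δ n) (i n)) ∧ (∀ n, Function.Exact (i n) (r (n + 1)))) ∧
      -- `θ` is the canonical isomorphism `Ext^n_{B-A}(M, M) ≅ H^{n+1}(T, M)`: the class of a
      -- cocycle `h : Pₙ → M` on a projective resolution goes to the class of `h ∘ v n`, where
      -- `v` is a lift of `1_M`
      (∀ P : ProjectiveResolution (bimod k A B M),
        (∃ v, IsLift (toBA k A B M) P (oneM k A B M) v) ∧
        ∀ v, IsLift (toBA k A B M) P (oneM k A B M) v →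
          ∀ (n : ℕ) (h : P.complex.X n ⟶ bimod k A B M) (hh : P.complex.d (n + 1) n ≫ h = 0),
            Represents ((Restr.map (toBA k A B M) h).compMultilinearMap (v n))
              (θ n (P.extMk h (n + 1) rfl hh))) ∧
      -- `r` is induced by restriction of cochains to `A` and to `B`
      (∀ n x F, Represents F x →
        Represents (restrictA k A B M F) (r n x).1 ∧ Represents (restrictB k A B M F) (r n x).2) ∧
      -- `i` is `θ` followed by the map induced by the inclusion `M → T`
      (∀ n x c, Represents c (θ n x) →
        Represents ((inclMBimod k A B M).compMultilinearMap c) (i n x)) ∧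
      -- `δ f = 1_M ⌣ f` for `f ∈ H^n(A, A)`
      (∀ n x f, Represents f x →
        Represents (cup (actR k (Tri A B M) (MBimod k A B M)) (Nat.add_comm 1 n)
          (oneM k A B M) (extendA k A B M f)) (θ n (δ n (x, 0)))) ∧
      -- `δ g = (-1)^{n+1} g ⌣ 1_M` for `g ∈ H^n(B, B)`
      (∀ n y g, Represents g y →
        Represents ((-1 : k) ^ (n + 1) • cup (actL k (Tri A B M) (MBimod k A B M)) rfl
          (extendB k A B M g) (oneM k A B M)) (θ n (δ n (0, y))))) ∧
    -- Happel's long exact sequence of the one-point extension `Tri A k N`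
    (∃ (r₀ : HH k (Tri A k N) (Tri A k N) 0 →ₗ[k] HH k A A 0 × k)
      (δ₀ : HH k A A 0 × k →ₗ[k] Module.End Aᵐᵒᵖ N)
      (i₀ : Module.End Aᵐᵒᵖ N →ₗ[k] HH k (Tri A k N) (Tri A k N) 1)
      (r : ∀ n : ℕ, HH k (Tri A k N) (Tri A k N) (n + 1) →ₗ[k] HH k A A (n + 1))
      (δ : ∀ n : ℕ, HH k A A (n + 1) →ₗ[k]
        Ext (ModuleCat.of Aᵐᵒᵖ N) (ModuleCat.of Aᵐᵒᵖ N) (n + 1))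
      (i : ∀ n : ℕ, Ext (ModuleCat.of Aᵐᵒᵖ N) (ModuleCat.of Aᵐᵒᵖ N) (n + 1) →ₗ[k]
        HH k (Tri A k N) (Tri A k N) (n + 2))
      (θ : ∀ n : ℕ, Ext (ModuleCat.of Aᵐᵒᵖ N) (ModuleCat.of Aᵐᵒᵖ N) n ≃ₗ[k]
        HH k (Tri A k N) (NBimod k A N) (n + 1)),
      -- exactness
      (Function.Injective r₀ ∧ Function.Exact r₀ δ₀ ∧ Function.Exact δ₀ i₀ ∧
        Function.Exact i₀ (r 0) ∧ (∀ n, Function.Exact (r n) (δ n)) ∧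
        (∀ n, Function.Exact (δ n) (i n)) ∧ (∀ n, Function.Exact (i n) (r (n + 1)))) ∧
      -- the maps in low degrees
      (∀ x F, Represents F x → Represents (restrictA k A k N F) (r₀ x).1 ∧
        (r₀ x).2 = (F Fin.elim0).b) ∧
      (∀ x f, Represents f x → ∀ (c : k) (m : N),
        δ₀ (x, c) m = op (f Fin.elim0) • m - c • m) ∧
      (∀ φ : Module.End Aᵐᵒᵖ N, Represents (extendEnd k A N φ) (i₀ φ)) ∧
      -- the canonical isomorphism `Ext^n_A(N, N) ≅ H^{n+1}(T, N)`
      (∀ P : ProjectiveResolution (ModuleCat.of Aᵐᵒᵖ N),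
        (∃ v, IsLift (toRight k A N) P (oneN k A N) v) ∧
        ∀ v, IsLift (toRight k A N) P (oneN k A N) v →
          ∀ (n : ℕ) (h : P.complex.X n ⟶ ModuleCat.of Aᵐᵒᵖ N)
            (hh : P.complex.d (n + 1) n ≫ h = 0),
            Represents ((Restr.map (toRight k A N) h).compMultilinearMap (v n))
              (θ n (P.extMk h (n + 1) rfl hh))) ∧
      -- the maps in higher degrees
      (∀ n x F, Represents F x → Represents (restrictA k A k N F) (r n x)) ∧
      (∀ n x c, Represents c (θ (n + 1) x) →
        Represents ((inclNBimod k A N).compMultilinearMap c) (i n x)) ∧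
      (∀ n x f, Represents f x →
        Represents (cup (actR k (Tri A k N) (NBimod k A N)) (Nat.add_comm 1 (n + 1))
          (oneN k A N) (extendA k A k N f)) (θ (n + 1) (δ n x)))) := by
  constructor
  · have hu := isUniversal_oneM k A B M
    have hψ := isIdealEquiv_equivMBimod k A B M
    -- One resolution and one lift are fixed to define `θ`; `extEquivHH_extMk` then gives its
    -- description for every other choice.
    obtain ⟨v, hv⟩ := exists_isLift (ProjectiveResolution.of (bimod k A B M)) hu.cocycle
    let θ : ∀ n : ℕ, Ext (bimod k A B M) (bimod k A B M) n ≃ₗ[k]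
        HH k (Tri A B M) (MBimod k A B M) (n + 1) := fun n => extEquivHH hu hv _ n
    have hθ : ∀ n (y : HH k (Tri A B M) (MBimod k A B M) (n + 1)), θ n ((θ n).symm y) = y :=
      fun n => (θ n).apply_symm_apply
    refine ⟨res k A B M, fun n => (θ n).symm.toLinearMap ∘ₗ conn hψ n,
      fun n => inclHH hψ (n + 1) ∘ₗ (θ n).toLinearMap, θ,
      ⟨res_injective, fun n => ?_, fun n => ?_, fun n => ?_⟩, fun P => ⟨exists_isLift P hu.cocycle,
        fun w hw n h hh => extEquivHH_extMk hu hv _ hw h hh⟩,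
      fun n x F hF => ⟨represents_resA hF, represents_resB hF⟩,
      fun n x c hc => represents_inclHH hψ hc, fun n x f hf => ?_, fun n y g hg => ?_⟩
    · exact ((θ n).symm.injective.comp_exact_iff_exact).2 (exact_res_conn hψ n)
    · exact LinearMap.exact_symm_comp (exact_conn_inclHH hψ n) (θ n)
    · exact ((θ n).surjective.comp_exact_iff_exact).2 (exact_inclHH_res hψ n)
    · have : θ n ((θ n).symm (conn hψ n (x, 0))) = connA hψ n x := by
        rw [hθ, conn, LinearMap.coprod_apply, map_zero, add_zero]
      exact this ▸ represents_connA hψ hf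
    · have : θ n ((θ n).symm (conn hψ n (0, y))) = connB hψ n y := by
        rw [hθ, conn, LinearMap.coprod_apply, map_zero, zero_add]
      exact this ▸ represents_connB hψ hg
  · have hu := isUniversal_oneN k A N
    have hψ := isIdealEquiv_equivNBimod k A N
    obtain ⟨v, hv⟩ := exists_isLift (ProjectiveResolution.of (ModuleCat.of Aᵐᵒᵖ N)) hu.cocycle
    let θ : ∀ n : ℕ, Ext (ModuleCat.of Aᵐᵒᵖ N) (ModuleCat.of Aᵐᵒᵖ N) n ≃ₗ[k]
        HH k (Tri A k N) (NBimod k A N) (n + 1) := fun n => extEquivHH hu hv _ n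
    have hθ : ∀ n (y : HH k (Tri A k N) (NBimod k A N) (n + 1)), θ n ((θ n).symm y) = y :=
      fun n => (θ n).apply_symm_apply
    -- In degree zero `Module.End` enters through `endEquiv` and the second summand is `k` itself.
    -- From degree one on, the connecting map is restricted to the `A` summand, as the other one is
    -- zero.
    refine ⟨(zeroProdEquiv k A).toLinearMap ∘ₗ res k A k N 0, connZero k A N,
      inclHH hψ 1 ∘ₗ (endEquiv k A N).toLinearMap, fun n => resA k A k N (n + 1),
      fun n => (θ (n + 1)).symm.toLinearMap ∘ₗ conn hψ (n + 1) ∘ₗ LinearMap.inl k _ _,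
      fun n => inclHH hψ (n + 2) ∘ₗ (θ (n + 1)).toLinearMap, θ,
      ⟨(zeroProdEquiv k A).injective.comp res_injective, exact_res_connZero k A N,
        exact_connZero_inclHH k A N, ?_, fun n x => ?_, fun n x => ?_, fun n => ?_⟩,
      fun x F hF => ⟨represents_resA hF, zeroProdEquiv_res_snd hF⟩,
      fun x f hf c m => connZero_apply k A N hf c m,
      fun φ => represents_extendEnd k A N φ,
      fun P => ⟨exists_isLift P hu.cocycle, fun w hw n h hh => extEquivHH_extMk hu hv _ hw h hh⟩,
      fun n x F hF => represents_resA hF, fun n x c hc => represents_inclNBimod hc,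
      fun n x f hf => ?_⟩
    · exact ((endEquiv k A N).surjective.comp_exact_iff_exact).2 fun z => resA_eq_zero_iff k A N 0 z
    · exact ((θ (n + 1)).symm.map_eq_zero_iff).trans (conn_eq_zero_iff k A N n x)
    · exact LinearMap.exact_symm_comp (f := conn hψ (n + 1) ∘ₗ LinearMap.inl k _ _)
        (fun y => inclHH_eq_zero_iff k A N n y) (θ (n + 1)) x
    · exact ((θ (n + 1)).surjective.comp_exact_iff_exact).2 fun z => resA_eq_zero_iff k A N (n + 1) z
    · have : θ (n + 1) ((θ (n + 1)).symm (conn hψ (n + 1) (x, 0))) = connA hψ (n + 1) x := by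
        rw [hθ, conn, LinearMap.coprod_apply, map_zero, add_zero]
      exact this ▸ represents_connA hψ hf
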